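/- Let $d\in\{2,3\}$, $p\ge 1$, and let $\Omega\subset\mathbb R^d$ be a bounded domain with Lipschitz boundary, exterior unit normal $n$ and $\partial\Omega=\partial\Omega_D\cup\partial\Omega_N$ (disjoint, measurable). Let $\mu>0$, $\lambda\ge 0$ and $\gamma_a>0$, and put $$\epsilon(v)=\tfrac12\big(\nabla v+(\nabla v)^T\big),\qquad \sigma(v)=2\mu\,\epsilon(v)+\lambda\,\mathrm{tr}(\epsilon(v))\,I .$$ **Meshes.** Fix $\rho>0$ and $h_0>0$. For $h\in(0,h_0]$ consider finite conforming meshes $\mathcal K_{0,h}$ of closed nondegenerate polytopes (for instance simplices) which cover $\Omega$ and are shape regular and quasiuniform with mesh parameter $h$: every element has diameter at most $h/\rho$ and contains a ball of radius $\rho h$, and every interior face contains a $(d-1)$-dimensional ball of radius $\rho h$. Let $\mathcal K_h$ be the set of active elements, i.e. those that meet $\Omega$, let $N_h(\Omega)$ be their union, and let $\mathcal F_h(\partial\Omega)$ be the set of faces shared by two active elements at least one of which meets $\partial\Omega$. The space $V_h$ consists of the restrictions to $N_h(\Omega)$ of the continuous $\mathbb R^d$-valued fields on the mesh that are polynomials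 of total degree at most $p$ on each element. **Forms.** Let $n_F$ be a unit normal of the face $F$ and $[\cdot]$ the jump across $F$, and put $$j_h(v,w)=\sum_{F\in\mathcal F_h(\partial\Omega)}\sum_{l=1}^p h^{2l+1}\big([D^l_{n_F}v],[D^l_{n_F}w]\big)_F,$$ $$a_h(v,w)=2\mu(\epsilon(v),\epsilon(w))_\Omega+\lambda(\mathrm{tr}\,\epsilon(v),\mathrm{tr}\,\epsilon(w))_\Omega+\gamma_a h^{-2}j_h(v,w),$$ $$b_h(v,w)=2\mu(v,w)_{\partial\Omega_D}+\lambda(v\cdot n,w\cdot n)_{\partial\Omega_D},$$ $$A_h(v,w)=a_h(v,w)-(\sigma(v)\cdot n,w)_{\partial\Omega_D}-(v,\sigma(w)\cdot n)_{\partial\Omega_D}+\beta h^{-1}b_h(v,w),$$ $$|||v|||_h^2=a_h(v,v)+h\|\sigma(v)\|^2_{\partial\Omega_D}+h^{-1}b_h(v,v).$$ Here $v$ and $\sigma(v)$ are evaluated on $\partial\Omega_D$ as traces from within $\Omega$. Let $V$ be the space of fields in $H^1(\Omega)^d$ for which these expressions are defined: $v$ and $\nabla v$ have traces in $L^2(\partial\Omega_D)$,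 and for every $F\in\mathcal F_h(\partial\Omega)$ and $1\le l\le p$ the field $v$ is also defined on the two elements sharing $F$, and there $D^l_{n_F}v$ is square integrable and has a trace in $L^2(F)$. **Statement.** 1. (Continuity.) For every $\beta>0$ there is a constant $C$ such that for all $h\in(0,h_0]$ and all such meshes $$|A_h(v,w)|\le C\,|||v|||_h\,|||w|||_h\qquad\text{for all } v,w\in V+V_h .$$ 2. (Coercivity.) There are constants $\beta_0>0$ and $C$ such that for all $\beta\ge\beta_0$, all $h\in(0,h_0]$ and all such meshes $$|||v|||_h^2\le C\,A_h(v,v)\qquad\text{for all } v\in V_h .$$ The constants $C$ and $\beta_0$ depend only on $d,p,\Omega,\partial\Omega_D,\mu,\lambda,\gamma_a,\rho,h_0$ (and $C$ in part 1 on $\beta$). In particular they do not depend on $h$, on the mesh, or on how $\partial\Omega$ cuts the mesh. -/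

import Mathlib

open MeasureTheory Filter Topology
open scoped Pointwise RealInnerProductSpace ContDiff

noncomputable section

namespace CutFEM

/-- Euclidean space `ℝ^d`; displacement fields are functions `Vec d → Vec d`. -/
abbrev Vec (d : ℕ) : Type := EuclideanSpace ℝ (Fin d)

/-! ### The domain -/

/-- `Ω` has a Lipschitz boundary: near every boundary point, after a rigid motion, `Ω` is the strict
epigraph of a Lipschitz function. The function `g` of the variables orthogonal to the unit
vector `e` is represented by a function on `ℝ^d` which is constant in the direction `e`. -/
def HasLipschitzBoundary {d : ℕ} (Ω : Set (Vec d)) : Prop :=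
  ∀ x ∈ frontier Ω, ∃ (e : Vec d) (r : ℝ) (L : NNReal) (g : Vec d → ℝ),
    ‖e‖ = 1 ∧ 0 < r ∧ LipschitzWith L g ∧ (∀ (y : Vec d) (t : ℝ), g (y + t • e) = g y) ∧
      ∀ y ∈ Metric.ball x r, y ∈ Ω ↔ g y < ⟪y, e⟫

/-- `ν` is the exterior unit normal to `Ω` at `x`: close to `x`, and up to an arbitrarily thin cone
around the hyperplane orthogonal to `ν`, the set `Ω` is the half space opposite to `ν`. For given `x`
there is at most one such `ν`; on a Lipschitz boundary there is one at almost every point. -/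
def IsExteriorNormal {d : ℕ} (Ω : Set (Vec d)) (x ν : Vec d) : Prop :=
  ‖ν‖ = 1 ∧ ∀ ε : ℝ, 0 < ε → ∃ r : ℝ, 0 < r ∧ ∀ y ∈ Metric.ball x r,
    (⟪y - x, ν⟫ < -(ε * ‖y - x‖) → y ∈ Ω) ∧ (ε * ‖y - x‖ < ⟪y - x, ν⟫ → y ∉ Ω)

open Classical in
/-- The exterior unit normal field `n` (zero where there is no normal). -/
def exteriorNormal {d : ℕ} (Ω : Set (Vec d)) (x : Vec d) : Vec d :=
  if h : ∃ ν, IsExteriorNormal Ω x ν then h.choose else 0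

/-- The surface measure on a subset `Γ` of a hypersurface: the `(d-1)`-dimensional Hausdorff measure,
normalised so as to agree with Lebesgue measure on hyperplanes. -/
def surfaceMeasure {d : ℕ} (Γ : Set (Vec d)) : Measure (Vec d) :=
  (μHE[d - 1] : Measure (Vec d)).restrict Γ

/-! ### Weak derivatives and traces -/

/-- `g` is the weak `l`-th derivative of `v` in the direction `n` on the open set `U`. -/
def HasWeakDeriv {d : ℕ} (U : Set (Vec d)) (n : Vec d) (l : ℕ) (v g : Vec d → Vec d) : Prop :=
  LocallyIntegrableOn v U ∧ LocallyIntegrableOn g U ∧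
    ∀ φ : Vec d → ℝ, ContDiff ℝ ∞ φ → HasCompactSupport φ → tsupport φ ⊆ U →
      ∫ x in U, (iteratedFDeriv ℝ l φ x (fun _ => n)) • v x = (-1 : ℝ) ^ l • ∫ x in U, φ x • g x

open Classical in
/-- The weak `l`-th derivative of `v` in the direction `n` on `U`; it is determined almost everywhere
on `U`. -/
def weakDeriv {d : ℕ} (U : Set (Vec d)) (n : Vec d) (l : ℕ) (v : Vec d → Vec d) : Vec d → Vec d :=
  if h : ∃ g, HasWeakDeriv U n l v g then h.choose else 0

/-- `a` is the trace at `x` of `f`, taken from within `U`: the limit as `r → 0` of the mean values of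
`f` over the part of the ball `B(x, r)` in `U`. For Sobolev functions on Lipschitz domains this limit
exists at almost every boundary point and is the usual trace. -/
def HasTrace {d : ℕ} (U : Set (Vec d)) (f : Vec d → Vec d) (x a : Vec d) : Prop :=
  Tendsto (fun r : ℝ => ⨍ y in Metric.ball x r ∩ U, f y) (𝓝[>] 0) (𝓝 a)

open Classical in
/-- The trace of `f` from within `U`. -/
def trace {d : ℕ} (U : Set (Vec d)) (f : Vec d → Vec d) (x : Vec d) : Vec d :=
  if h : ∃ a, HasTrace U f x a then h.choose else 0

/-- `f` has a square integrable trace on `Γ` from within `U`. -/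
def HasL2Trace {d : ℕ} (U : Set (Vec d)) (f : Vec d → Vec d) (Γ : Set (Vec d)) : Prop :=
  (∀ᵐ x ∂(surfaceMeasure Γ), ∃ a, HasTrace U f x a) ∧ MemLp (trace U f) 2 (surfaceMeasure Γ)

/-- The weak partial derivative `∂_j v` on `U`. -/
def weakPartial {d : ℕ} (U : Set (Vec d)) (j : Fin d) (v : Vec d → Vec d) : Vec d → Vec d :=
  weakDeriv U (EuclideanSpace.single j 1) 1 v

/-! ### Strain and stress

A displacement gradient is given by the family of its partial derivatives, `G j = ∂_j v`. -/

/-- The strain `ε_ij = (∂_j v_i + ∂_i v_j) / 2`. -/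
def strain {d : ℕ} (G : Fin d → Vec d) : Matrix (Fin d) (Fin d) ℝ :=
  Matrix.of fun i j => (1 / 2 : ℝ) * (G j i + G i j)

/-- The stress `σ = 2 μ ε + λ tr(ε) I`. -/
def stress {d : ℕ} (mu lam : ℝ) (G : Fin d → Vec d) : Matrix (Fin d) (Fin d) ℝ :=
  (2 * mu) • strain G + (lam * (strain G).trace) • (1 : Matrix (Fin d) (Fin d) ℝ)

/-- The Frobenius product `A : B`. -/
def frob {d : ℕ} (A B : Matrix (Fin d) (Fin d) ℝ) : ℝ := ∑ i, ∑ j, A i j * B i j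

/-- The displacement gradient of `v` in `Ω`. -/
def gradIn {d : ℕ} (Ω : Set (Vec d)) (v : Vec d → Vec d) (x : Vec d) : Fin d → Vec d :=
  fun j => weakPartial Ω j v x

/-- The trace on the boundary of `Ω`, from within `Ω`, of the displacement gradient of `v`. -/
def gradTrace {d : ℕ} (Ω : Set (Vec d)) (v : Vec d → Vec d) (x : Vec d) : Fin d → Vec d :=
  fun j => trace Ω (weakPartial Ω j v) x

/-! ### Meshes -/

/-- A finite conforming mesh: the elements are nondegenerate (closed) polytopes, for instance simplices,
and the intersection of two elements is empty or a common face of both. -/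
structure Mesh (d : ℕ) where
  elements : Finset (Set (Vec d))
  polytope : ∀ K ∈ elements, ∃ s : Finset (Vec d), K = convexHull ℝ (s : Set (Vec d))
  nondegenerate : ∀ K ∈ elements, (interior K).Nonempty
  conforming : ∀ K ∈ elements, ∀ L ∈ elements, IsExposed ℝ K (K ∩ L)

/-- The closed region `Ω₀` covered by a mesh. -/
def Mesh.domain {d : ℕ} (M : Mesh d) : Set (Vec d) := ⋃ K ∈ M.elements, K

/-- `K` and `L` are neighbours: they are distinct and `K ∩ L` is `(d-1)`-dimensional. -/
def AreNeighbours {d : ℕ} (K L : Set (Vec d)) : Prop :=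
  K ≠ L ∧ Module.finrank ℝ (vectorSpan ℝ (K ∩ L)) + 1 = d

/-- The mesh is shape regular and quasiuniform with mesh parameter `h` and regularity constant `ρ`:
elements have diameter at most `h / ρ` and contain a ball of radius `ρ h`, and interior faces
contain a `(d-1)`-dimensional ball of radius `ρ h`. -/
def Mesh.IsQuasiUniform {d : ℕ} (M : Mesh d) (ρ h : ℝ) : Prop :=
  (∀ K ∈ M.elements, Metric.diam K ≤ ρ⁻¹ * h ∧ ∃ x, Metric.closedBall x (ρ * h) ⊆ K) ∧
    ∀ K ∈ M.elements, ∀ L ∈ M.elements, AreNeighbours K L →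
      ∃ x ∈ K ∩ L, Metric.closedBall x (ρ * h) ∩ (affineSpan ℝ (K ∩ L) : Set (Vec d)) ⊆ K ∩ L

/-- An element is active if it meets `Ω`. -/
def IsActive {d : ℕ} (Ω K : Set (Vec d)) : Prop := (K ∩ Ω).Nonempty

/-- The domain `N_h(Ω)` of the active mesh. -/
def activeDomain {d : ℕ} (Ω : Set (Vec d)) (M : Mesh d) : Set (Vec d) :=
  ⋃ K ∈ {K | K ∈ M.elements ∧ IsActive Ω K}, K

/-- The face shared by the elements `K` and `L` belongs to `F_h(∂Ω)`: it is an interior face of the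
active mesh, and `K` or `L` meets `∂Ω`. -/
def IsStabilized {d : ℕ} (Ω K L : Set (Vec d)) : Prop :=
  IsActive Ω K ∧ IsActive Ω L ∧ AreNeighbours K L ∧
    ((K ∩ frontier Ω).Nonempty ∨ (L ∩ frontier Ω).Nonempty)

open Classical in
/-- A unit normal to a `(d-1)`-dimensional face `F`; it is unique up to the sign, on which the forms
below do not depend. -/
def faceNormal {d : ℕ} (F : Set (Vec d)) : Vec d :=
  if h : ∃ n : Vec d, ‖n‖ = 1 ∧ n ∈ (vectorSpan ℝ F)ᗮ then h.choose else 0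

/-! ### Function spaces -/

/-- On `K`, the field `v` is a polynomial of degree at most `p`, componentwise. -/
def IsPolynomialOn {d : ℕ} (p : ℕ) (K : Set (Vec d)) (v : Vec d → Vec d) : Prop :=
  ∃ P : Fin d → MvPolynomial (Fin d) ℝ,
    ∀ i, (P i).totalDegree ≤ p ∧ ∀ x ∈ K, v x i = MvPolynomial.eval (fun j => x j) (P i)

/-- The space `V_{0,h}` of continuous piecewise polynomial fields of order `p` on the mesh. -/
def backgroundSpace {d : ℕ} (p : ℕ) (M : Mesh d) : Set (Vec d → Vec d) :=
  {v | ContinuousOn v M.domain ∧ ∀ K ∈ M.elements, IsPolynomialOn p K v}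

/-- The finite element space `V_h`: restrictions to `N_h(Ω)` of the fields in `V_{0,h}`. -/
def feSpace {d : ℕ} (p : ℕ) (Ω : Set (Vec d)) (M : Mesh d) : Set (Vec d → Vec d) :=
  {v | ∃ v₀ ∈ backgroundSpace p M, Set.EqOn v v₀ (activeDomain Ω M)}

/-- The space `V`: the fields that belong to `H¹(Ω)` and for which the boundary and face terms in the
forms are defined, that is, `v` and `∇v` have square integrable traces on `∂Ω_D`, and for every face
in `F_h(∂Ω)` and `1 ≤ l ≤ p` the `l`-th normal derivative is square integrable in the adjacent
elements and has square integrable traces on the face from both of them. All fields in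
`H^{p+1}(N_h(Ω))` belong to `V`. -/
def contSpace {d : ℕ} (p : ℕ) (Ω ΓD : Set (Vec d)) (M : Mesh d) : Set (Vec d → Vec d) :=
  {v | MemLp v 2 (volume.restrict Ω) ∧
    (∀ j : Fin d, (∃ g, HasWeakDeriv Ω (EuclideanSpace.single j 1) 1 v g) ∧
      MemLp (weakPartial Ω j v) 2 (volume.restrict Ω)) ∧
    HasL2Trace Ω v ΓD ∧ (∀ j : Fin d, HasL2Trace Ω (weakPartial Ω j v) ΓD) ∧
    ∀ K ∈ M.elements, ∀ L ∈ M.elements, IsStabilized Ω K L → ∀ l ∈ Finset.Icc 1 p,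
      (∃ g, HasWeakDeriv (interior K) (faceNormal (K ∩ L)) l v g) ∧
      MemLp (weakDeriv (interior K) (faceNormal (K ∩ L)) l v) 2 (volume.restrict (interior K)) ∧
      HasL2Trace (interior K) (weakDeriv (interior K) (faceNormal (K ∩ L)) l v) (K ∩ L)}

/-! ### Forms -/

/-- The jump `[D_n^l v]` on the face shared by `K` and `L`. -/
def normalJump {d : ℕ} (K L : Set (Vec d)) (l : ℕ) (v : Vec d → Vec d) (x : Vec d) : Vec d :=
  trace (interior K) (weakDeriv (interior K) (faceNormal (K ∩ L)) l v) x
    - trace (interior L) (weakDeriv (interior L) (faceNormal (K ∩ L)) l v) x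

open Classical in
/-- The stabilization form `j_h`. Every face in `F_h(∂Ω)` is shared by exactly two elements and so occurs
for two ordered pairs `(K, L)`, which explains the factor `1 / 2`. -/
def jForm {d : ℕ} (p : ℕ) (Ω : Set (Vec d)) (M : Mesh d) (h : ℝ) (v w : Vec d → Vec d) : ℝ :=
  (1 / 2) * ∑ K ∈ M.elements, ∑ L ∈ M.elements,
    if IsStabilized Ω K L then
      ∑ l ∈ Finset.Icc 1 p, h ^ (2 * l + 1) *
        ∫ x, ⟪normalJump K L l v x, normalJump K L l w x⟫ ∂(surfaceMeasure (K ∩ L))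
    else 0

/-- The elasticity form `a`. -/
def aForm {d : ℕ} (mu lam : ℝ) (Ω : Set (Vec d)) (v w : Vec d → Vec d) : ℝ :=
  2 * mu * (∫ x in Ω, frob (strain (gradIn Ω v x)) (strain (gradIn Ω w x)))
    + lam * ∫ x in Ω, (strain (gradIn Ω v x)).trace * (strain (gradIn Ω w x)).trace

/-- The stabilized form `a_h = a + γ_a h⁻² j_h`. -/
def ahForm {d : ℕ} (mu lam γ : ℝ) (p : ℕ) (Ω : Set (Vec d)) (M : Mesh d) (h : ℝ)
    (v w : Vec d → Vec d) : ℝ :=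
  aForm mu lam Ω v w + γ * (h ^ 2)⁻¹ * jForm p Ω M h v w

/-- The consistency term `(σ(v)·n, w)_{∂Ω_D}`. -/
def tractionForm {d : ℕ} (mu lam : ℝ) (Ω ΓD : Set (Vec d)) (v w : Vec d → Vec d) : ℝ :=
  ∫ x, (∑ i, ∑ j, stress mu lam (gradTrace Ω v x) i j * exteriorNormal Ω x j * trace Ω w x i)
    ∂(surfaceMeasure ΓD)

/-- The boundary form `b_h`. -/
def bForm {d : ℕ} (mu lam : ℝ) (Ω ΓD : Set (Vec d)) (v w : Vec d → Vec d) : ℝ :=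
  2 * mu * (∫ x, ⟪trace Ω v x, trace Ω w x⟫ ∂(surfaceMeasure ΓD))
    + lam * ∫ x, ⟪trace Ω v x, exteriorNormal Ω x⟫ * ⟪trace Ω w x, exteriorNormal Ω x⟫
        ∂(surfaceMeasure ΓD)

/-- The stabilized Nitsche form `A_h`. -/
def nitscheForm {d : ℕ} (mu lam γ β : ℝ) (p : ℕ) (Ω ΓD : Set (Vec d)) (M : Mesh d) (h : ℝ)
    (v w : Vec d → Vec d) : ℝ :=
  ahForm mu lam γ p Ω M h v w - tractionForm mu lam Ω ΓD v w - tractionForm mu lam Ω ΓD w v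
    + β * h⁻¹ * bForm mu lam Ω ΓD v w

/-- The norm `|||v|||_h`, with
`|||v|||_h² = a_h(v, v) + h ‖σ(v)‖²_{∂Ω_D} + h⁻¹ b_h(v, v)`. -/
def energyNorm {d : ℕ} (mu lam γ : ℝ) (p : ℕ) (Ω ΓD : Set (Vec d)) (M : Mesh d) (h : ℝ)
    (v : Vec d → Vec d) : ℝ :=
  Real.sqrt (ahForm mu lam γ p Ω M h v v
    + h * (∫ x, frob (stress mu lam (gradTrace Ω v x)) (stress mu lam (gradTrace Ω v x))
        ∂(surfaceMeasure ΓD))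
    + h⁻¹ * bForm mu lam Ω ΓD v v)

end CutFEM

end

open MeasureTheory Filter Topology
open scoped Pointwise RealInnerProductSpace ContDiff

noncomputable section

namespace CutFEM

/-! ### Polynomial functions -/

/-! Continuity is the Cauchy–Schwarz inequality applied term by term: the weights `h` and `h⁻¹` in
the norm cancel in the two consistency terms. Coercivity rests on one inverse estimate,
`exists_stress_boundary_le`: for finite element fields, `h ‖σ(v)‖²` on `∂Ω_D` is at most a constant
times `‖ε(v)‖²_Ω + h⁻² j_h(v, v)`, however the boundary cuts the elements. Young's inequality then
absorbs the consistency terms into half of `a_h` and a fixed multiple of `h⁻¹ b_h`, which a large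
`β` pays for. Only strains occur in the norm, so Korn's inequality plays no role.

The inverse estimate is local. If `K` is a cut element, `K ∩ Ω` may be arbitrarily thin, and the
strain on `K` cannot be recovered from it. By the uniform cone property of a bounded Lipschitz
domain there is a convex open `U ⊆ Ω` of size comparable to `h` that contains a point of `K`
(`UniformCone.exists_convex_subset`). Boundedly many elements meet `U`, so one of them, `L₀`, has a
substantial part in `Ω`. The strain of its polynomial is controlled by that part, because on
polynomials of bounded degree the square integral over any set of given measure bounds the
coefficients (`exists_sq_le_integral_sq`). Convexity of `U` links `K` to `L₀` by a short chain of
neighbours meeting `U` (`Mesh.exists_chain`). At each link either the element lies inside `Ω`, and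
the estimate is direct, or the shared face is stabilized. In the latter case the two polynomials
agree on the face by continuity, so their difference is a Taylor expansion in the normal direction
whose coefficients are the jumps in `j_h` (`exists_strainSq_le_neighbour`). This gives
`exists_strainSq_cut_le`; integrating over `K ∩ ∂Ω_D`, whose surface measure is `O(h^(d-1))` by
`UniformCone.surface_le`, and summing with finite overlap gives the inverse estimate.

The rest of the work identifies the weak derivatives and traces in the forms with the classical ones
for finite element fields. Weak derivatives come from integration by parts for Lipschitz functions.
The trace of the gradient is delicate where `∂Ω` runs along a mesh face, since the gradient may jump
there. At almost every such point `∂Ω` is asymptotically dense in the plane of the face, and the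
cone property forces `Ω` to one side of it, so a single element fills `Ω` near the point
(`Mesh.ae_exists_fillsNear`). -/

/-- `q` is a polynomial function of total degree at most `p`. -/
def PolyFun {m : ℕ} (p : ℕ) (q : Vec m → ℝ) : Prop :=
  ∃ P : MvPolynomial (Fin m) ℝ, P.totalDegree ≤ p ∧ ∀ x, q x = MvPolynomial.eval (fun j => x j) P

/-- The derivative of a function in the direction `n`. -/
def dirDeriv {m : ℕ} {F : Type*} [NormedAddCommGroup F] [NormedSpace ℝ F] (n : Vec m)
    (q : Vec m → F) : Vec m → F :=
  fun x => fderiv ℝ q x n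

namespace PolyFun

variable {m k p : ℕ} {q r : Vec m → ℝ}

lemma const (c : ℝ) : PolyFun p (fun _ : Vec m => c) :=
  ⟨MvPolynomial.C c, by simp, by simp⟩

lemma add (hq : PolyFun p q) (hr : PolyFun p r) : PolyFun p (fun x => q x + r x) := by
  obtain ⟨P, hP, hPq⟩ := hq
  obtain ⟨Q, hQ, hQr⟩ := hr
  exact ⟨P + Q, (MvPolynomial.totalDegree_add _ _).trans (max_le hP hQ), by simp [hPq, hQr]⟩

lemma const_mul (c : ℝ) (hq : PolyFun p q) : PolyFun p (fun x => c * q x) := by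
  obtain ⟨P, hP, hPq⟩ := hq
  exact ⟨c • P, (MvPolynomial.totalDegree_smul_le _ _).trans hP, by simp [hPq, MvPolynomial.smul_eval]⟩

lemma sub (hq : PolyFun p q) (hr : PolyFun p r) : PolyFun p (fun x => q x - r x) := by
  simpa [sub_eq_add_neg] using hq.add (hr.const_mul (-1))

lemma sum {ι : Type*} (s : Finset ι) {f : ι → Vec m → ℝ} (hf : ∀ i ∈ s, PolyFun p (f i)) :
    PolyFun p (fun x => ∑ i ∈ s, f i x) := by
  classical
  induction s using Finset.induction_on with
  | empty => simpa using const 0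
  | insert a s ha ih =>
    simp only [Finset.sum_insert ha]
    exact (hf a (by simp)).add (ih fun i hi => hf i (by simp [hi]))

lemma contDiff (hq : PolyFun p q) : ContDiff ℝ ∞ q := by
  obtain ⟨P, -, hPq⟩ := hq
  have : q = fun x => MvPolynomial.eval (fun j => x j) P := funext hPq
  rw [this]
  clear this hPq
  induction P using MvPolynomial.induction_on with
  | C a => simpa using contDiff_const
  | add P Q hP hQ => simpa using hP.add hQ
  | mul_X P i hP =>
    simp only [map_mul, MvPolynomial.eval_X]
    exact hP.mul (by fun_prop)

lemma continuous (hq : PolyFun p q) : Continuous q := hq.contDiff.continuous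

lemma differentiable (hq : PolyFun p q) : Differentiable ℝ q :=
  hq.contDiff.differentiable (by simp)

/-- Affine substitution does not raise the degree. This allows polynomials to be transported to a
reference ball and restricted to hyperplanes without changing `p`. -/
lemma totalDegree_bind₁_le {F : MvPolynomial (Fin m) ℝ} (hF : F.totalDegree ≤ p)
    {f : Fin m → MvPolynomial (Fin k) ℝ} (hf : ∀ i, (f i).totalDegree ≤ 1) :
    (MvPolynomial.bind₁ f F).totalDegree ≤ p := by
  rw [MvPolynomial.bind₁, MvPolynomial.aeval_def, MvPolynomial.eval₂]
  refine MvPolynomial.totalDegree_finsetSum_le fun d hd => ?_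
  refine (MvPolynomial.totalDegree_mul _ _).trans ?_
  simp only [MvPolynomial.algebraMap_eq, MvPolynomial.totalDegree_C, zero_add]
  refine (MvPolynomial.totalDegree_finsetProd _ _).trans ?_
  refine le_trans (Finset.sum_le_sum fun i _ => ?_) ((MvPolynomial.le_totalDegree hd).trans hF)
  refine (MvPolynomial.totalDegree_pow _ _).trans ?_
  simpa using Nat.mul_le_mul_left (d i) (hf i)

lemma comp (hq : PolyFun p q) {f : Vec k → Vec m} (hf : ∀ i, PolyFun 1 (fun y => f y i)) :
    PolyFun p (fun y => q (f y)) := by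
  obtain ⟨P, hP, hPq⟩ := hq
  choose Q hQ hQf using hf
  refine ⟨MvPolynomial.bind₁ Q P, totalDegree_bind₁_le hP hQ, fun y => ?_⟩
  have hQf' : ∀ i, f y i = MvPolynomial.eval (fun j => y j) (Q i) := fun i => hQf i y
  show q (f y) = _
  conv_rhs => rw [MvPolynomial.eval, MvPolynomial.eval₂Hom_bind₁]
  simp only [hPq, hQf']
  rfl

lemma coord (i : Fin m) : PolyFun 1 (fun x : Vec m => x i) :=
  ⟨MvPolynomial.X i, by simp, by simp⟩

lemma affine (y : Vec m) (A : Vec k →ₗ[ℝ] Vec m) (i : Fin m) :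
    PolyFun 1 (fun z => (y + A z) i) := by
  have h : ∀ z : Vec k, (y + A z) i = y i + ∑ j, (A (EuclideanSpace.single j 1)) i * z j := by
    intro z
    have hz : z = ∑ j, z j • EuclideanSpace.single j (1 : ℝ) := by
      ext a
      simp [Finset.sum_apply, Pi.single_apply]
    conv_lhs => rw [hz]
    simp [map_sum, mul_comm]
  simp only [h]
  exact (const _).add (sum _ fun j _ => (coord j).const_mul _)

lemma comp_affine (hq : PolyFun p q) (y : Vec m) (A : Vec k →ₗ[ℝ] Vec m) :
    PolyFun p (fun z => q (y + A z)) :=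
  hq.comp (affine y A)

lemma hasFDerivAt_eval (P : MvPolynomial (Fin m) ℝ) (x n : Vec m) :
    fderiv ℝ (fun x : Vec m => MvPolynomial.eval (fun j => x j) P) x n =
      MvPolynomial.eval (fun j => x j) (∑ j, n j • MvPolynomial.pderiv j P) := by
  have hd : ∀ Q : MvPolynomial (Fin m) ℝ,
      Differentiable ℝ (fun x : Vec m => MvPolynomial.eval (fun j => x j) Q) := fun Q =>
    (show PolyFun Q.totalDegree _ from ⟨Q, le_rfl, fun _ => rfl⟩).differentiable
  induction P using MvPolynomial.induction_on with
  | C a => simp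
  | add P Q hP hQ =>
    simp only [map_add, smul_add, Finset.sum_add_distrib]
    rw [fderiv_fun_add (hd P x) (hd Q x)]
    simp [hP, hQ]
  | mul_X P i hP =>
    simp only [map_mul, MvPolynomial.eval_X]
    have hx : HasFDerivAt (fun x : Vec m => x i) (EuclideanSpace.proj i : Vec m →L[ℝ] ℝ) x :=
      (EuclideanSpace.proj i : Vec m →L[ℝ] ℝ).hasFDerivAt
    rw [fderiv_fun_mul (hd P x) hx.differentiableAt, hx.fderiv]
    simp only [_root_.add_apply, _root_.smul_apply, hP]
    simp only [map_sum, MvPolynomial.smul_eval, Derivation.leibniz, smul_eq_mul, map_add, map_mul,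
      MvPolynomial.eval_X, MvPolynomial.pderiv_X, mul_add, Finset.sum_add_distrib, Pi.single_apply,
      Finset.mul_sum]
    congr 1
    · simp [mul_comm, apply_ite]
    · exact Finset.sum_congr rfl fun j _ => by ring

lemma totalDegree_pderiv_le (P : MvPolynomial (Fin m) ℝ) (i : Fin m) :
    (MvPolynomial.pderiv i P).totalDegree ≤ P.totalDegree := by
  conv_lhs => rw [P.as_sum]
  rw [map_sum]
  refine MvPolynomial.totalDegree_finsetSum_le fun s hs => ?_
  rw [MvPolynomial.pderiv_monomial]
  refine (MvPolynomial.totalDegree_monomial_le _ _).trans (le_trans ?_ (MvPolynomial.le_totalDegree hs))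
  exact Finsupp.degree_mono (tsub_le_self : s - Finsupp.single i 1 ≤ s)

lemma dirDeriv (hq : PolyFun p q) (n : Vec m) : PolyFun p (dirDeriv n q) := by
  obtain ⟨P, hP, hPq⟩ := hq
  refine ⟨∑ j, n j • MvPolynomial.pderiv j P, ?_, fun x => ?_⟩
  · exact MvPolynomial.totalDegree_finsetSum_le fun j _ =>
      (MvPolynomial.totalDegree_smul_le _ _).trans ((totalDegree_pderiv_le P j).trans hP)
  · rw [CutFEM.dirDeriv, ← hasFDerivAt_eval]
    rw [show q = _ from funext hPq]

lemma iterate_dirDeriv (hq : PolyFun p q) (n : Vec m) (l : ℕ) :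
    PolyFun p ((CutFEM.dirDeriv n)^[l] q) := by
  induction l generalizing q with
  | zero => exact hq
  | succ l ih => exact ih (hq.dirDeriv n)

/-- On a line the polynomial becomes univariate of degree at most `p`, so its Taylor expansion is
finite and exact. It recovers a polynomial from its normal derivatives on a face. -/
lemma taylor_line (hq : PolyFun p q) (x n : Vec m) (t : ℝ) :
    q (x + t • n) = ∑ l ∈ Finset.range (p + 1),
      t ^ l / (l.factorial : ℝ) * (CutFEM.dirDeriv n)^[l] q x := by
  obtain ⟨P, hP, hPq⟩ := id hq
  let f : Fin m → Polynomial ℝ := fun i => Polynomial.C (x i) + Polynomial.C (n i) * Polynomial.X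
  let Q : Polynomial ℝ := MvPolynomial.aeval f P
  have hQd : Q.natDegree ≤ p := by
    have := MvPolynomial.aeval_natDegree_le P hP f (n := 1) (fun i => by
      show (Polynomial.C (x i) + Polynomial.C (n i) * Polynomial.X).natDegree ≤ 1
      compute_degree)
    simpa using this
  have hQ : ∀ t : ℝ, q (x + t • n) = Q.eval t := by
    intro t
    rw [hPq]
    have : Q.eval t = Polynomial.evalRingHom t (MvPolynomial.aeval f P) := rfl
    rw [this, MvPolynomial.aeval_def, MvPolynomial.hom_eval₂]
    rw [MvPolynomial.eval, MvPolynomial.coe_eval₂Hom]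
    congr 1
    · exact RingHom.ext fun a => Polynomial.eval_C.symm
    · funext i
      simp only [f, Polynomial.coe_evalRingHom, Polynomial.eval_add,
        Polynomial.eval_mul, Polynomial.eval_C, Polynomial.eval_X, PiLp.add_apply,
        PiLp.smul_apply, smul_eq_mul]
      ring
  -- Iterated directional derivatives along the line are the formal derivatives of `Q`, by
  -- uniqueness of the one-variable derivative at each stage.
  have key : ∀ l : ℕ, ∀ t : ℝ,
      (CutFEM.dirDeriv n)^[l] q (x + t • n) = (Polynomial.derivative^[l] Q).eval t := by
    intro l
    induction l with
    | zero => exact hQ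
    | succ l ih =>
      intro t
      rw [Function.iterate_succ_apply', Function.iterate_succ_apply']
      have h1 : HasDerivAt (fun t : ℝ => (CutFEM.dirDeriv n)^[l] q (x + t • n))
          (CutFEM.dirDeriv n ((CutFEM.dirDeriv n)^[l] q) (x + t • n)) t := by
        have hl : HasDerivAt (fun t : ℝ => x + t • n) n t := by
          simpa using ((hasDerivAt_id t).smul_const n).const_add x
        exact ((hq.iterate_dirDeriv n l).differentiable _).hasFDerivAt.comp_hasDerivAt t hl
      have h2 : HasDerivAt (fun t : ℝ => (CutFEM.dirDeriv n)^[l] q (x + t • n))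
          ((Polynomial.derivative (Polynomial.derivative^[l] Q)).eval t) t := by
        simp only [ih]
        exact Polynomial.hasDerivAt _ t
      exact h1.unique h2
  rw [hQ, Polynomial.eval_eq_sum_range' (Nat.lt_succ_of_le hQd)]
  refine Finset.sum_congr rfl fun l _ => ?_
  have h0 := key l 0
  simp only [zero_smul, add_zero] at h0
  rw [h0, ← Polynomial.coeff_zero_eq_eval_zero, Polynomial.coeff_iterate_derivative, zero_add,
    Nat.descFactorial_self, nsmul_eq_mul]
  field_simp

end PolyFun

/-! ### Norm equivalence and inverse inequalities for polynomials -/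

/-- The zero set of a nonzero polynomial is a null set. -/
lemma volume_zeroSet_eq_zero {m : ℕ} (P : MvPolynomial (Fin m) ℝ) (hP : P ≠ 0) :
    volume {x : Fin m → ℝ | MvPolynomial.eval x P = 0} = 0 := by
  induction m with
  | zero =>
    obtain ⟨c, rfl⟩ := MvPolynomial.C_surjective (Fin 0) P
    have : c ≠ 0 := fun h => hP (by simp [h])
    simp [this]
  | succ m ih =>
    -- Fubini in the first variable: `P` is a polynomial in one variable with coefficients in the
    -- others. Some coefficient is nonzero, hence by induction nonvanishing for almost every value
    -- of the others, and for those values the fibre is a finite set of roots.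
    let Q := MvPolynomial.finSuccEquiv ℝ m P
    have hQ : Q ≠ 0 := by simpa [Q] using hP
    let S : Set (ℝ × (Fin m → ℝ)) :=
      {z | MvPolynomial.eval (Fin.cons z.1 z.2 : Fin (m + 1) → ℝ) P = 0}
    have hS : MeasurableSet S := by
      have : Continuous fun z : ℝ × (Fin m → ℝ) =>
          MvPolynomial.eval (Fin.cons z.1 z.2 : Fin (m + 1) → ℝ) P := by
        refine (MvPolynomial.continuous_eval P).comp ?_
        exact Continuous.finCons continuous_fst continuous_snd
      exact (isClosed_singleton.preimage this).measurableSet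
    have hpre : {x : Fin (m + 1) → ℝ | MvPolynomial.eval x P = 0} =
        MeasurableEquiv.piFinSuccAbove (fun _ => ℝ) 0 ⁻¹' S := by
      ext x
      simp only [Set.mem_ofPred_eq, Set.mem_preimage, S, MeasurableEquiv.piFinSuccAbove_apply]
      have : (Fin.cons (x 0) (Fin.tail x) : Fin (m + 1) → ℝ) = x := Fin.cons_self_tail x
      simp only [Fin.insertNthEquiv_zero, Fin.consEquiv_symm_apply]
      rw [this]
    rw [hpre, (volume_preserving_piFinSuccAbove (fun _ => ℝ) 0).measure_preimage
      hS.nullMeasurableSet]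
    have hsw : MeasurePreserving (Prod.swap : (Fin m → ℝ) × ℝ → ℝ × (Fin m → ℝ))
        (volume.prod volume) (volume.prod volume) := Measure.measurePreserving_swap
    rw [Measure.volume_eq_prod, ← hsw.measure_preimage hS.nullMeasurableSet,
      Measure.measure_prod_null (hS.preimage measurable_swap)]
    obtain ⟨j, hj⟩ : ∃ j, Q.coeff j ≠ 0 := by
      by_contra! h
      exact hQ (Polynomial.ext (by simpa using h))
    have hnull := ih (Q.coeff j) hj
    rw [← compl_mem_ae_iff] at hnull
    filter_upwards [hnull] with y hy
    have hy' : Polynomial.map (MvPolynomial.eval y) Q ≠ 0 := fun h => hy (by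
      have := congrArg (fun R => Polynomial.coeff R j) h
      simpa using this)
    have hset : Prod.mk y ⁻¹' (Prod.swap ⁻¹' S) ⊆
        (Polynomial.map (MvPolynomial.eval y) Q).rootSet ℝ := by
      intro t ht
      have ht' : MvPolynomial.eval (Fin.cons t y : Fin (m + 1) → ℝ) P = 0 := ht
      rw [MvPolynomial.eval_eq_eval_mv_eval'] at ht'
      rw [Polynomial.mem_rootSet]
      exact ⟨hy', by simpa using ht'⟩
    exact measure_mono_null hset ((Polynomial.rootSet_finite _ _).measure_zero _)

/-- A nonzero continuous function of the coefficients that is positive away from a null set is bounded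
below, uniformly near given coefficients, on all sets of a given measure. -/
lemma exists_nhds_forall_le_integral_sq {m N : ℕ} {F : (Fin N → ℝ) → Vec m → ℝ}
    (hF : Continuous fun z : (Fin N → ℝ) × Vec m => F z.1 z.2) {R c : ℝ} (hc : 0 < c)
    (a₀ : Fin N → ℝ) (h0 : volume {x | F a₀ x = 0} = 0) :
    ∃ s ∈ 𝓝 a₀, ∃ η : ℝ, 0 < η ∧ ∀ a ∈ s, ∀ E : Set (Vec m), MeasurableSet E →
      E ⊆ Metric.closedBall 0 R → ENNReal.ofReal c ≤ volume E → η ≤ ∫ x in E, F a x ^ 2 := by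
  set B := Metric.closedBall (0 : Vec m) R with hB
  have hBc : IsCompact B := isCompact_closedBall _ _
  have hFa : ∀ a, Continuous (F a) := fun a =>
    hF.comp (continuous_const.prodMk continuous_id)
  -- The sublevel sets of `|F a₀|` in the ball decrease to a null set, so one of them has measure
  -- below `c / 2`. Every admissible `E` keeps measure at least `c / 2` outside it, and there `|F
  -- a₀|` exceeds `δ`.
  let A : ℕ → Set (Vec m) := fun n => B ∩ {x | |F a₀ x| ≤ 1 / ((n : ℝ) + 1)}
  have hAm : ∀ n, MeasurableSet (A n) := fun n =>
    hBc.measurableSet.inter (isClosed_le (hFa a₀).abs continuous_const).measurableSet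
  have hAanti : Antitone A := fun i j hij x hx => by
    have h1 : |F a₀ x| ≤ 1 / ((j : ℝ) + 1) := hx.2
    exact ⟨hx.1, h1.trans (Nat.one_div_le_one_div hij)⟩
  have hAlim : Tendsto (fun n => volume (A n)) atTop (𝓝 (volume (⋂ n, A n))) :=
    tendsto_measure_iInter_atTop (fun n => (hAm n).nullMeasurableSet) hAanti
      ⟨0, ((measure_mono Set.inter_subset_left).trans_lt hBc.measure_lt_top).ne⟩
  have hA0 : volume (⋂ n, A n) = 0 := by
    refine measure_mono_null (fun x hx => ?_) h0
    rw [Set.mem_iInter] at hx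
    have : |F a₀ x| ≤ 0 := ge_of_tendsto' tendsto_one_div_add_atTop_nhds_zero_nat fun n => (hx n).2
    exact abs_nonpos_iff.mp this
  rw [hA0] at hAlim
  have hc2 : (0 : ENNReal) < ENNReal.ofReal (c / 2) := by simpa using half_pos hc
  obtain ⟨n, hn⟩ := (hAlim.eventually (gt_mem_nhds hc2)).exists
  set δ : ℝ := 1 / ((n : ℝ) + 1) with hδ
  have hδ0 : 0 < δ := by positivity
  -- Compactness of the ball makes the convergence `F a → F a₀` uniform, so the lower bound survives
  -- for nearby coefficients with `δ / 2` in place of `δ`.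
  have hunif : ∀ᶠ a in 𝓝 a₀, ∀ x ∈ B, |F a x - F a₀ x| < δ / 2 := by
    have hG : Continuous fun z : Vec m × (Fin N → ℝ) => |F z.2 z.1 - F a₀ z.1| := by
      have h1 : Continuous fun z : Vec m × (Fin N → ℝ) => F z.2 z.1 :=
        hF.comp (continuous_snd.prodMk continuous_fst)
      exact (h1.sub ((hFa a₀).comp continuous_fst)).abs
    have := hBc.eventually_forall_of_forall_eventually (x₀ := a₀)
      (P := fun a x => |F a x - F a₀ x| < δ / 2) (fun x _ => ?_)
    · exact this
    · have hop : IsOpen {z : (Fin N → ℝ) × Vec m | |F z.1 z.2 - F a₀ z.2| < δ / 2} :=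
        isOpen_lt (hG.comp continuous_swap) continuous_const
      exact hop.mem_nhds (by simpa using hδ0)
  refine ⟨_, hunif, (δ / 2) ^ 2 * (c / 2), by positivity, fun a ha E hE hEB hcE => ?_⟩
  have hEfin : volume E ≠ ⊤ := ((measure_mono hEB).trans_lt hBc.measure_lt_top).ne
  have hint : IntegrableOn (fun x => F a x ^ 2) E volume :=
    (((hFa a).pow 2).continuousOn.integrableOn_compact hBc).mono_set hEB
  have hD : ENNReal.ofReal (c / 2) ≤ volume (E \ A n) := by
    have h1 : volume E ≤ volume (E \ A n) + ENNReal.ofReal (c / 2) := by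
      calc volume E ≤ volume ((E \ A n) ∪ A n) := measure_mono fun x hx => by
            by_cases h : x ∈ A n
            · exact Or.inr h
            · exact Or.inl ⟨hx, h⟩
        _ ≤ volume (E \ A n) + volume (A n) := measure_union_le _ _
        _ ≤ _ := by gcongr
    have h2 : ENNReal.ofReal c = ENNReal.ofReal (c / 2) + ENNReal.ofReal (c / 2) := by
      rw [← ENNReal.ofReal_add (by positivity) (by positivity), add_halves]
    rw [h2] at hcE
    exact (ENNReal.add_le_add_iff_right ENNReal.ofReal_ne_top).mp (hcE.trans h1)
  have hDfin : volume (E \ A n) ≠ ⊤ := ((measure_mono Set.sdiff_subset).trans_lt hEfin.lt_top).ne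
  have hlow : ∀ x ∈ E \ A n, (δ / 2) ^ 2 ≤ F a x ^ 2 := by
    intro x hx
    have hxB : x ∈ B := hEB hx.1
    have h1 : δ < |F a₀ x| := not_le.mp fun h => hx.2 ⟨hxB, h⟩
    have h2 := ha x hxB
    have h3 : δ / 2 ≤ |F a x| := by
      have := abs_sub_abs_le_abs_sub (F a₀ x) (F a x)
      rw [abs_sub_comm] at this
      linarith
    calc (δ / 2) ^ 2 ≤ |F a x| ^ 2 := by gcongr
      _ = F a x ^ 2 := sq_abs _
  calc (δ / 2) ^ 2 * (c / 2) ≤ (δ / 2) ^ 2 * volume.real (E \ A n) := by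
        gcongr
        exact (ENNReal.ofReal_le_iff_le_toReal hDfin).mp hD
    _ = ∫ x in E \ A n, (δ / 2) ^ 2 := by simp [mul_comm]
    _ ≤ ∫ x in E \ A n, F a x ^ 2 := by
        refine setIntegral_mono_on ?_ (hint.mono_set Set.sdiff_subset) (hE.diff (hAm n)) hlow
        exact integrableOn_const hDfin
    _ ≤ ∫ x in E, F a x ^ 2 :=
        setIntegral_mono_set hint (Eventually.of_forall fun x => sq_nonneg _)
          (LE.le.eventuallyLE Set.sdiff_subset)

/-- Polynomial functions of bounded degree depend linearly and faithfully on finitely many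
coefficients. -/
lemma exists_coefficients (m p : ℕ) : ∃ (N : ℕ) (b : Fin N → Vec m → ℝ),
    (∀ i, PolyFun p (b i)) ∧ (∀ q : Vec m → ℝ, PolyFun p q → ∃ a : Fin N → ℝ,
      ∀ x, q x = ∑ i, a i * b i x) ∧
    ∀ a : Fin N → ℝ, a ≠ 0 → volume {x : Vec m | ∑ i, a i * b i x = 0} = 0 := by
  let W := MvPolynomial.restrictTotalDegree (Fin m) ℝ p
  let b := Module.finBasis ℝ W
  have heval : ∀ (a : Fin (Module.finrank ℝ W) → ℝ) (x : Vec m),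
      ∑ i, a i * MvPolynomial.eval (fun j => x j) (b i : MvPolynomial (Fin m) ℝ) =
        MvPolynomial.eval (fun j => x j) ((∑ i, a i • b i : W) : MvPolynomial (Fin m) ℝ) := by
    intro a x
    simp [MvPolynomial.smul_eval]
  refine ⟨Module.finrank ℝ W, fun i x => MvPolynomial.eval (fun j => x j) (b i : MvPolynomial (Fin m) ℝ),
    fun i => ⟨b i, (MvPolynomial.mem_restrictTotalDegree _ _ _).mp (b i).2, fun _ => rfl⟩, ?_, ?_⟩
  · rintro q ⟨P, hP, hPq⟩
    let P' : W := ⟨P, (MvPolynomial.mem_restrictTotalDegree _ _ _).mpr hP⟩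
    refine ⟨b.repr P', fun x => ?_⟩
    rw [heval, b.sum_repr, hPq]
  · intro a ha
    have hne : (∑ i, a i • b i : W) ≠ 0 := fun h =>
      ha (funext fun i => Fintype.linearIndependent_iff.mp b.linearIndependent a h i)
    have := volume_zeroSet_eq_zero ((∑ i, a i • b i : W) : MvPolynomial (Fin m) ℝ)
      (fun h => hne (Subtype.ext h))
    simp only [heval]
    rw [← (EuclideanSpace.volume_preserving_symm_measurableEquiv_toLp (Fin m)).measure_preimage_equiv]
      at this
    exact this

/-- The coefficients are controlled by the square integral over any set of a given measure. -/
lemma exists_coefficient_bound {m N p : ℕ} {b : Fin N → Vec m → ℝ} (hb : ∀ i, PolyFun p (b i))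
    (h0 : ∀ a : Fin N → ℝ, a ≠ 0 → volume {x : Vec m | ∑ i, a i * b i x = 0} = 0)
    (R : ℝ) {c : ℝ} (hc : 0 < c) : ∃ η : ℝ, 0 < η ∧ ∀ a : Fin N → ℝ, ∀ E : Set (Vec m),
      MeasurableSet E → E ⊆ Metric.closedBall 0 R → ENNReal.ofReal c ≤ volume E →
      η * ‖a‖ ^ 2 ≤ ∫ x in E, (∑ i, a i * b i x) ^ 2 := by
  have hF : Continuous fun z : (Fin N → ℝ) × Vec m => ∑ i, z.1 i * b i z.2 := by
    refine continuous_finsetSum _ fun i _ => ?_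
    exact ((continuous_apply i).comp continuous_fst).mul ((hb i).continuous.comp continuous_snd)
  -- The local lower bounds are patched over the compact unit sphere of coefficients; the general
  -- case then follows since both sides are homogeneous of degree two.
  obtain ⟨η, hη, H⟩ : ∃ η : ℝ, 0 < η ∧ ∀ a ∈ Metric.sphere (0 : Fin N → ℝ) 1, ∀ E : Set (Vec m),
      MeasurableSet E → E ⊆ Metric.closedBall 0 R → ENNReal.ofReal c ≤ volume E →
      η ≤ ∫ x in E, (∑ i, a i * b i x) ^ 2 := by
    refine (isCompact_sphere (0 : Fin N → ℝ) 1).induction_on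
      (p := fun s => ∃ η : ℝ, 0 < η ∧ ∀ a ∈ s, ∀ E : Set (Vec m),
        MeasurableSet E → E ⊆ Metric.closedBall 0 R → ENNReal.ofReal c ≤ volume E →
        η ≤ ∫ x in E, (∑ i, a i * b i x) ^ 2) ⟨1, one_pos, by simp⟩ ?_ ?_ ?_
    · rintro s t hst ⟨η, hη, H⟩
      exact ⟨η, hη, fun a ha => H a (hst ha)⟩
    · rintro s t ⟨η, hη, H⟩ ⟨η', hη', H'⟩
      refine ⟨min η η', lt_min hη hη', fun a ha E h1 h2 h3 => ?_⟩
      rcases ha with ha | ha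
      · exact (min_le_left _ _).trans (H a ha E h1 h2 h3)
      · exact (min_le_right _ _).trans (H' a ha E h1 h2 h3)
    · intro a ha
      have hane : a ≠ 0 := by
        rintro rfl
        simp at ha
      obtain ⟨s, hs, η, hη, H⟩ := exists_nhds_forall_le_integral_sq
        (F := fun a x => ∑ i, a i * b i x) hF (R := R) hc a (h0 a hane)
      exact ⟨s, mem_nhdsWithin_of_mem_nhds hs, η, hη, H⟩
  refine ⟨η, hη, fun a E h1 h2 h3 => ?_⟩
  by_cases ha : a = 0
  · simp [ha]
  have hna : 0 < ‖a‖ := norm_pos_iff.mpr ha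
  have := H (‖a‖⁻¹ • a) (by simp [norm_smul, hna.ne']) E h1 h2 h3
  have heq : ∀ x, (∑ i, (‖a‖⁻¹ • a) i * b i x) ^ 2 = (‖a‖ ^ 2)⁻¹ * (∑ i, a i * b i x) ^ 2 := by
    intro x
    simp only [Pi.smul_apply, smul_eq_mul, mul_assoc, ← Finset.mul_sum]
    rw [mul_pow, inv_pow]
  simp only [heq, integral_const_mul] at this
  rw [inv_mul_eq_div, le_div_iff₀ (by positivity)] at this
  exact this

/-- The behaviour of the Lebesgue measure under translation and dilation. -/
lemma volume_eq_volume_preimage {m : ℕ} (y : Vec m) {h : ℝ} (hh : 0 < h) (E : Set (Vec m)) :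
    volume E = ENNReal.ofReal (h ^ m) * volume ((fun z : Vec m => y + h • z) ⁻¹' E) := by
  have h1 : (fun z : Vec m => y + h • z) ⁻¹' E = (fun z => h • z) ⁻¹' ((fun z => y + z) ⁻¹' E) := rfl
  rw [h1, Measure.addHaar_preimage_smul _ hh.ne', measure_preimage_add, ← mul_assoc,
    ← ENNReal.ofReal_mul (by positivity)]
  simp [abs_of_pos hh, hh.ne']

/-- A polynomial on a ball is bounded by its square integral over any part of the ball of
comparable measure. -/
theorem exists_sq_le_integral_sq (m p : ℕ) (R : ℝ) {c : ℝ} (hc : 0 < c) :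
    ∃ C : ℝ, 0 < C ∧ ∀ h : ℝ, 0 < h → ∀ (y : Vec m) (q : Vec m → ℝ), PolyFun p q →
      ∀ E : Set (Vec m), MeasurableSet E → E ⊆ Metric.closedBall y (R * h) →
      ENNReal.ofReal (c * h ^ m) ≤ volume E → ∀ x ∈ Metric.closedBall y (R * h),
      q x ^ 2 ≤ C * (h ^ m)⁻¹ * ∫ z in E, q z ^ 2 := by
  obtain ⟨N, b, hb, hrep, h0⟩ := exists_coefficients m p
  obtain ⟨η, hη, H⟩ := exists_coefficient_bound hb h0 R hc
  obtain ⟨M, hM⟩ : ∃ M : ℝ, ∀ x ∈ Metric.closedBall (0 : Vec m) R, ∑ i, |b i x| ≤ M := by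
    obtain ⟨M, hM⟩ := (isCompact_closedBall (0 : Vec m) R).bddAbove_image
      (f := fun x => ∑ i, |b i x|)
      (continuous_finsetSum _ fun i _ => (hb i).continuous.abs).continuousOn
    exact ⟨M, fun x hx => hM ⟨x, hx, rfl⟩⟩
  -- Everything is pulled back to the reference ball of radius `R` by `z ↦ y + h z`. There `M`
  -- bounds the basis functions and `η` bounds the coefficients; the summand 1 only serves
  -- positivity.
  refine ⟨(M ^ 2 + 1) * η⁻¹, by positivity, fun h hh y q hq E hE hEB hvol x hx => ?_⟩
  have hq' : PolyFun p (fun z => q (y + h • z)) := by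
    simpa using hq.comp_affine y (h • (LinearMap.id : Vec m →ₗ[ℝ] Vec m))
  obtain ⟨a, ha⟩ := hrep _ hq'
  let φ : Vec m → Vec m := fun z => y + h • z
  have hφ : Continuous φ := by fun_prop
  set E' := φ ⁻¹' E with hE'
  have hE'm : MeasurableSet E' := hE.preimage hφ.measurable
  have hball : ∀ z, φ z ∈ Metric.closedBall y (R * h) → z ∈ Metric.closedBall (0 : Vec m) R := by
    intro z hz
    simp only [φ, Metric.mem_closedBall, dist_eq_norm, add_sub_cancel_left, norm_smul,
      Real.norm_eq_abs, abs_of_pos hh, sub_zero] at hz ⊢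
    rw [mul_comm] at hz
    exact le_of_mul_le_mul_right hz hh
  have hvolE' : volume E = ENNReal.ofReal (h ^ m) * volume E' := volume_eq_volume_preimage y hh E
  have hintE' : ∫ z in E, q z ^ 2 = h ^ m * ∫ z in E', q (φ z) ^ 2 := by
    rw [← integral_indicator hE, ← integral_indicator hE'm]
    have h1 : ∀ z, E'.indicator (fun z => q (φ z) ^ 2) z =
        (fun w => (fun u => E.indicator (fun z => q z ^ 2) (y + u)) w) (h • z) := by
      intro z
      by_cases hz : φ z ∈ E
      · rw [Set.indicator_of_mem (show z ∈ E' from hz)]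
        exact (Set.indicator_of_mem hz (fun z => q z ^ 2)).symm
      · rw [Set.indicator_of_notMem (show z ∉ E' from hz)]
        exact (Set.indicator_of_notMem hz (fun z => q z ^ 2)).symm
    simp only [h1]
    rw [Measure.integral_comp_smul volume
      (fun u => E.indicator (fun z => q z ^ 2) (y + u)) h, integral_add_left_eq_self]
    simp [abs_of_pos hh, hh.ne']
  have hc' : ENNReal.ofReal c ≤ volume E' := by
    rw [hvolE', mul_comm c, ENNReal.ofReal_mul (by positivity)] at hvol
    exact (ENNReal.mul_le_mul_iff_right (by simpa using pow_pos hh m) ENNReal.ofReal_ne_top).mp hvol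
  have hbd := H a E' hE'm (fun z hz => hball z (hEB hz)) hc'
  simp only [← ha] at hbd
  obtain ⟨z, rfl⟩ : ∃ z, φ z = x := ⟨h⁻¹ • (x - y), by simp [φ, smul_smul, hh.ne']⟩
  have hz := hball z hx
  have h1 : |q (φ z)| ≤ ‖a‖ * M := by
    have : q (φ z) = ∑ i, a i * b i z := ha z
    rw [this]
    calc |∑ i, a i * b i z| ≤ ∑ i, |a i * b i z| := Finset.abs_sum_le_sum_abs _ _
      _ ≤ ∑ i, ‖a‖ * |b i z| := by
          refine Finset.sum_le_sum fun i _ => ?_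
          rw [abs_mul]
          gcongr
          exact norm_le_pi_norm a i
      _ = ‖a‖ * ∑ i, |b i z| := by rw [Finset.mul_sum]
      _ ≤ ‖a‖ * M := by gcongr; exact hM z hz
  have h2 : q (φ z) ^ 2 ≤ ‖a‖ ^ 2 * (M ^ 2 + 1) := by
    rw [← sq_abs]
    calc |q (φ z)| ^ 2 ≤ (‖a‖ * M) ^ 2 := by gcongr
      _ ≤ ‖a‖ ^ 2 * (M ^ 2 + 1) := by nlinarith [sq_nonneg ‖a‖]
  have h3 : ‖a‖ ^ 2 ≤ η⁻¹ * ∫ z in E', q (φ z) ^ 2 := by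
    rw [inv_mul_eq_div, le_div_iff₀ hη]
    linarith
  rw [hintE']
  have hpow : (h ^ m) ≠ 0 := by positivity
  calc q (φ z) ^ 2 ≤ ‖a‖ ^ 2 * (M ^ 2 + 1) := h2
    _ ≤ (η⁻¹ * ∫ z in E', q (φ z) ^ 2) * (M ^ 2 + 1) := by gcongr
    _ = _ := by field_simp

/-- Inverse inequality: on a ball of radius proportional to `h`, a directional derivative of a
polynomial is bounded by `h⁻¹` times the maximum of the polynomial. -/
theorem exists_dirDeriv_sq_le (m p : ℕ) {R : ℝ} (hR : 0 < R) :
    ∃ C : ℝ, 0 < C ∧ ∀ h : ℝ, 0 < h → ∀ (y : Vec m) (q : Vec m → ℝ), PolyFun p q →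
      ∀ n : Vec m, ‖n‖ ≤ 1 → ∀ s : ℝ, (∀ x ∈ Metric.closedBall y (R * h), q x ^ 2 ≤ s) →
      ∀ x ∈ Metric.closedBall y (R * h), dirDeriv n q x ^ 2 ≤ C * (h ^ 2)⁻¹ * s := by
  obtain ⟨N, b, hb, hrep, h0⟩ := exists_coefficients m p
  set B := Metric.closedBall (0 : Vec m) R with hB
  have hBpos : 0 < volume B := Metric.measure_closedBall_pos _ _ hR
  have hBfin : volume B ≠ ⊤ := (isCompact_closedBall (0 : Vec m) R).measure_lt_top.ne
  have hc : 0 < volume.real B := ENNReal.toReal_pos hBpos.ne' hBfin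
  obtain ⟨η, hη, H⟩ := exists_coefficient_bound hb h0 R hc
  obtain ⟨M, hM⟩ : ∃ M : ℝ, ∀ x ∈ B, ∑ i, ‖fderiv ℝ (b i) x‖ ≤ M := by
    obtain ⟨M, hM⟩ := (isCompact_closedBall (0 : Vec m) R).bddAbove_image
      (f := fun x => ∑ i, ‖fderiv ℝ (b i) x‖)
      (continuous_finsetSum _ fun i _ =>
        ((hb i).contDiff.continuous_fderiv (by simp)).norm).continuousOn
    exact ⟨M, fun x hx => hM ⟨x, hx, rfl⟩⟩
  refine ⟨(M ^ 2 + 1) * η⁻¹ * volume.real B, by positivity, fun h hh y q hq n hn s hs x hx => ?_⟩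
  have hq' : PolyFun p (fun z => q (y + h • z)) := by
    simpa using hq.comp_affine y (h • (LinearMap.id : Vec m →ₗ[ℝ] Vec m))
  obtain ⟨a, ha⟩ := hrep _ hq'
  let φ : Vec m → Vec m := fun z => y + h • z
  have hφB : ∀ z ∈ B, φ z ∈ Metric.closedBall y (R * h) := by
    intro z hz
    simp only [hB, φ, Metric.mem_closedBall, dist_eq_norm, add_sub_cancel_left, norm_smul,
      Real.norm_eq_abs, abs_of_pos hh, sub_zero] at hz ⊢
    rw [mul_comm]
    gcongr
  have hball : ∀ z, φ z ∈ Metric.closedBall y (R * h) → z ∈ B := by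
    intro z hz
    simp only [hB, φ, Metric.mem_closedBall, dist_eq_norm, add_sub_cancel_left, norm_smul,
      Real.norm_eq_abs, abs_of_pos hh, sub_zero] at hz ⊢
    rw [mul_comm] at hz
    exact le_of_mul_le_mul_right hz hh
  have hbd := H a B Metric.isClosed_closedBall.measurableSet subset_rfl
    (ENNReal.ofReal_toReal hBfin).le
  have hint : ∫ x in B, (∑ i, a i * b i x) ^ 2 ≤ s * volume.real B := by
    have h1 : ∫ x in B, (∑ i, a i * b i x) ^ 2 ≤ ∫ _ in B, s := by
      refine setIntegral_mono_on ?_ (integrableOn_const hBfin)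
        Metric.isClosed_closedBall.measurableSet fun z hz => ?_
      · simp only [← ha]
        exact (hq'.continuous.pow 2).continuousOn.integrableOn_compact (isCompact_closedBall _ _)
      · rw [← ha]
        exact hs _ (hφB z hz)
    simpa [mul_comm] using h1
  obtain ⟨z, rfl⟩ : ∃ z, φ z = x := ⟨h⁻¹ • (x - y), by simp [φ, smul_smul, hh.ne']⟩
  have hz := hball z hx
  -- The chain rule for the rescaling produces the factor `h` responsible for the `h⁻²` in the
  -- inverse inequality.
  have hder : h * dirDeriv n q (φ z) = ∑ i, a i * fderiv ℝ (b i) z n := by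
    have h1 : HasFDerivAt (fun w => q (φ w)) ((fderiv ℝ q (φ z)).comp (h • ContinuousLinearMap.id ℝ (Vec m))) z := by
      refine (hq.differentiable _).hasFDerivAt.comp z ?_
      exact ((hasFDerivAt_id z).const_smul h).const_add y
    have h2 : HasFDerivAt (fun w => q (φ w)) (∑ i, a i • fderiv ℝ (b i) z) z := by
      have : (fun w => q (φ w)) = fun w => ∑ i, a i * b i w := funext ha
      rw [this]
      exact HasFDerivAt.fun_sum fun i _ => ((hb i).differentiable z).hasFDerivAt.const_mul (a i)
    have := congrArg (fun L : Vec m →L[ℝ] ℝ => L n) (h1.unique h2)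
    simpa [dirDeriv, _root_.sum_apply] using this
  have h1 : |h * dirDeriv n q (φ z)| ≤ ‖a‖ * M := by
    rw [hder]
    calc |∑ i, a i * fderiv ℝ (b i) z n| ≤ ∑ i, |a i * fderiv ℝ (b i) z n| :=
          Finset.abs_sum_le_sum_abs _ _
      _ ≤ ∑ i, ‖a‖ * ‖fderiv ℝ (b i) z‖ := by
          refine Finset.sum_le_sum fun i _ => ?_
          rw [abs_mul]
          gcongr
          · exact norm_le_pi_norm a i
          · exact ((fderiv ℝ (b i) z).le_opNorm n).trans
              (mul_le_of_le_one_right (norm_nonneg _) hn)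
      _ = ‖a‖ * ∑ i, ‖fderiv ℝ (b i) z‖ := by rw [Finset.mul_sum]
      _ ≤ ‖a‖ * M := by gcongr; exact hM z hz
  have h2 : (h * dirDeriv n q (φ z)) ^ 2 ≤ ‖a‖ ^ 2 * (M ^ 2 + 1) := by
    rw [← sq_abs]
    calc |h * dirDeriv n q (φ z)| ^ 2 ≤ (‖a‖ * M) ^ 2 := by gcongr
      _ ≤ ‖a‖ ^ 2 * (M ^ 2 + 1) := by nlinarith [sq_nonneg ‖a‖]
  have h3 : ‖a‖ ^ 2 ≤ η⁻¹ * (s * volume.real B) := by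
    rw [inv_mul_eq_div, le_div_iff₀ hη]
    linarith
  have h4 : (h * dirDeriv n q (φ z)) ^ 2 ≤ (η⁻¹ * (s * volume.real B)) * (M ^ 2 + 1) :=
    h2.trans (by gcongr)
  rw [mul_pow] at h4
  calc dirDeriv n q (φ z) ^ 2 = (h ^ 2)⁻¹ * (h ^ 2 * dirDeriv n q (φ z) ^ 2) := by field_simp
    _ ≤ (h ^ 2)⁻¹ * ((η⁻¹ * (s * volume.real B)) * (M ^ 2 + 1)) := by gcongr
    _ = _ := by ring

/-! ### Weak derivatives -/

section WeakDeriv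

variable {d l : ℕ} {U : Set (Vec d)} {n : Vec d} {v w g g' : Vec d → Vec d}

lemma integrable_smul_of_locallyIntegrableOn {φ : Vec d → ℝ} (hφ : Continuous φ)
    (hc : HasCompactSupport φ) (hU : tsupport φ ⊆ U) (hg : LocallyIntegrableOn g U) :
    Integrable (fun x => φ x • g x) := by
  have h1 : IntegrableOn g (tsupport φ) := hg.integrableOn_compact_subset hU hc
  have h2 : IntegrableOn (fun x => φ x • g x) (tsupport φ) :=
    h1.continuousOn_smul hφ.continuousOn hc
  refine (integrableOn_iff_integrable_of_support_subset fun x hx => ?_).mp h2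
  refine subset_tsupport φ fun h => hx ?_
  simp [h]

lemma setIntegral_smul_eq_integral {φ : Vec d → ℝ} (hU : tsupport φ ⊆ U) :
    ∫ x in U, φ x • g x = ∫ x, φ x • g x := by
  refine setIntegral_eq_integral_of_forall_compl_eq_zero fun x hx => ?_
  rw [image_eq_zero_of_notMem_tsupport fun h => hx (hU h), zero_smul]

/-- The `l`-th derivative of a test function in the direction `n`. -/
lemma contDiff_iteratedFDeriv_apply {φ : Vec d → ℝ} (hφ : ContDiff ℝ ∞ φ) (l : ℕ) (n : Vec d) :
    ContDiff ℝ ∞ (fun x => iteratedFDeriv ℝ l φ x (fun _ => n)) := by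
  have h : ContDiff ℝ ∞ (iteratedFDeriv ℝ l φ) :=
    hφ.iteratedFDeriv_right (by exact_mod_cast le_top)
  exact (ContinuousMultilinearMap.apply ℝ (fun _ : Fin l => Vec d) ℝ (fun _ => n)).contDiff.comp h

lemma tsupport_iteratedFDeriv_apply_subset (φ : Vec d → ℝ) (l : ℕ) (n : Vec d) :
    tsupport (fun x => iteratedFDeriv ℝ l φ x (fun _ => n)) ⊆ tsupport φ := by
  refine subset_trans (closure_mono fun x hx => ?_) (tsupport_iteratedFDeriv_subset (𝕜 := ℝ) l)
  intro h
  apply hx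
  simp [h]

lemma hasCompactSupport_iteratedFDeriv_apply {φ : Vec d → ℝ} (hφ : HasCompactSupport φ) (l : ℕ)
    (n : Vec d) : HasCompactSupport (fun x => iteratedFDeriv ℝ l φ x (fun _ => n)) :=
  hφ.mono' (subset_trans subset_closure (tsupport_iteratedFDeriv_apply_subset φ l n))

/-- The fundamental lemma of the calculus of variations. It makes `weakDeriv`, which is picked by
choice, determined almost everywhere. -/
lemma HasWeakDeriv.ae_eq (hU : IsOpen U) (hg : HasWeakDeriv U n l v g)
    (hg' : HasWeakDeriv U n l v g') : g =ᵐ[volume.restrict U] g' := by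
  have h := hU.ae_eq_zero_of_integral_contDiff_smul_eq_zero (μ := volume)
    (f := fun x => g x - g' x) (hg.2.1.sub hg'.2.1) (fun φ h1 h2 h3 => by
      simp only [smul_sub]
      rw [integral_sub (integrable_smul_of_locallyIntegrableOn h1.continuous h2 h3 hg.2.1)
        (integrable_smul_of_locallyIntegrableOn h1.continuous h2 h3 hg'.2.1), sub_eq_zero,
        ← setIntegral_smul_eq_integral h3, ← setIntegral_smul_eq_integral h3]
      have := (hg.2.2 φ h1 h2 h3).symm.trans (hg'.2.2 φ h1 h2 h3)
      exact smul_right_injective _ (pow_ne_zero l (by norm_num : (-1 : ℝ) ≠ 0)) this)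
  rw [EventuallyEq, ae_restrict_iff' hU.measurableSet]
  filter_upwards [h] with x hx hxU
  exact sub_eq_zero.mp (hx hxU)

lemma hasWeakDeriv_weakDeriv (h : ∃ g, HasWeakDeriv U n l v g) :
    HasWeakDeriv U n l v (weakDeriv U n l v) := by
  rw [weakDeriv, dif_pos h]
  exact h.choose_spec

lemma HasWeakDeriv.weakDeriv_ae_eq (hU : IsOpen U) (hg : HasWeakDeriv U n l v g) :
    weakDeriv U n l v =ᵐ[volume.restrict U] g :=
  (hasWeakDeriv_weakDeriv ⟨g, hg⟩).ae_eq hU hg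

lemma HasWeakDeriv.add (hv : HasWeakDeriv U n l v g) (hw : HasWeakDeriv U n l w g') :
    HasWeakDeriv U n l (v + w) (g + g') := by
  refine ⟨hv.1.add hw.1, hv.2.1.add hw.2.1, fun φ h1 h2 h3 => ?_⟩
  have e1 := (contDiff_iteratedFDeriv_apply h1 l n).continuous
  have e2 := hasCompactSupport_iteratedFDeriv_apply h2 l n
  have e3 := (tsupport_iteratedFDeriv_apply_subset φ l n).trans h3
  simp only [Pi.add_apply, smul_add]
  rw [integral_add (integrable_smul_of_locallyIntegrableOn e1 e2 e3 hv.1).integrableOn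
    (integrable_smul_of_locallyIntegrableOn e1 e2 e3 hw.1).integrableOn,
    integral_add (integrable_smul_of_locallyIntegrableOn h1.continuous h2 h3 hv.2.1).integrableOn
    (integrable_smul_of_locallyIntegrableOn h1.continuous h2 h3 hw.2.1).integrableOn, smul_add,
    hv.2.2 φ h1 h2 h3, hw.2.2 φ h1 h2 h3]

lemma weakDeriv_add_ae_eq (hU : IsOpen U) (hv : ∃ g, HasWeakDeriv U n l v g)
    (hw : ∃ g, HasWeakDeriv U n l w g) :
    weakDeriv U n l (v + w) =ᵐ[volume.restrict U] weakDeriv U n l v + weakDeriv U n l w :=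
  ((hasWeakDeriv_weakDeriv hv).add (hasWeakDeriv_weakDeriv hw)).weakDeriv_ae_eq hU

lemma HasWeakDeriv.congr (hU : IsOpen U) (hv : HasWeakDeriv U n l v g) (h : Set.EqOn w v U) :
    HasWeakDeriv U n l w g := by
  refine ⟨?_, hv.2.1, fun φ h1 h2 h3 => ?_⟩
  · intro x hx
    obtain ⟨s, hs, hsi⟩ := hv.1 x hx
    refine ⟨s ∩ U, inter_mem hs self_mem_nhdsWithin, ?_⟩
    have hs' : IntegrableOn v (s ∩ U) := hsi.mono_set Set.inter_subset_left
    have : w =ᵐ[volume.restrict (s ∩ U)] v := by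
      have h2 : ∀ᵐ x ∂(volume.restrict U), w x = v x :=
        (ae_restrict_iff' hU.measurableSet).mpr (Eventually.of_forall fun x hx => h hx)
      exact ae_mono (Measure.restrict_mono Set.inter_subset_right le_rfl) h2
    exact Integrable.congr hs' this.symm
  · rw [← hv.2.2 φ h1 h2 h3]
    exact setIntegral_congr_fun hU.measurableSet fun x hx => by simp [h hx]

end WeakDeriv

/-! ### Traces -/

section Trace

variable {d : ℕ} {U Γ : Set (Vec d)} {f g : Vec d → Vec d} {x a b : Vec d}

lemma HasTrace.unique (h : HasTrace U f x a) (h' : HasTrace U f x b) : a = b :=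
  tendsto_nhds_unique h h'

lemma HasTrace.trace_eq (h : HasTrace U f x a) : trace U f x = a := by
  have h' : ∃ a, HasTrace U f x a := ⟨a, h⟩
  rw [trace, dif_pos h']
  exact h'.choose_spec.unique h

lemma hasTrace_trace (h : ∃ a, HasTrace U f x a) : HasTrace U f x (trace U f x) := by
  rw [trace, dif_pos h]
  exact h.choose_spec

/-- Mean values ignore null sets, so traces of weak derivatives do not depend on the representative
that was chosen. -/
lemma hasTrace_congr (h : f =ᵐ[volume.restrict U] g) : HasTrace U f x a ↔ HasTrace U g x a := by
  have : ∀ r : ℝ, ⨍ y in Metric.ball x r ∩ U, f y = ⨍ y in Metric.ball x r ∩ U, g y := fun r =>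
    average_congr (ae_mono (Measure.restrict_mono Set.inter_subset_right le_rfl) h)
  simp only [HasTrace, this]

lemma trace_congr (h : f =ᵐ[volume.restrict U] g) : trace U f = trace U g := by
  funext x
  by_cases hx : ∃ a, HasTrace U f x a
  · obtain ⟨a, ha⟩ := hx
    rw [ha.trace_eq, ((hasTrace_congr h).mp ha).trace_eq]
  · have hx' : ¬ ∃ a, HasTrace U g x a := fun ⟨a, ha⟩ => hx ⟨a, (hasTrace_congr h).mpr ha⟩
    rw [trace, trace, dif_neg hx, dif_neg hx']

lemma HasTrace.add (hf : MemLp f 2 (volume.restrict U)) (hg : MemLp g 2 (volume.restrict U))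
    (ha : HasTrace U f x a) (hb : HasTrace U g x b) : HasTrace U (f + g) x (a + b) := by
  have key : ∀ {f : Vec d → Vec d}, MemLp f 2 (volume.restrict U) → ∀ r : ℝ,
      IntegrableOn f (Metric.ball x r ∩ U) := by
    intro f hf r
    have h1 : MemLp f 2 (volume.restrict (Metric.ball x r ∩ U)) :=
      hf.mono_measure (Measure.restrict_mono Set.inter_subset_right le_rfl)
    have : IsFiniteMeasure (volume.restrict (Metric.ball x r ∩ U)) :=
      ⟨by
        rw [Measure.restrict_apply_univ]
        exact (measure_mono Set.inter_subset_left).trans_lt measure_ball_lt_top⟩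
    exact h1.integrable (by norm_num)
  refine (Tendsto.add ha hb).congr fun r => ?_
  simp only [setAverage_eq, Pi.add_apply]
  rw [integral_add (key hf r) (key hg r), smul_add]

lemma HasL2Trace.congr (hf : HasL2Trace U f Γ) (h : f =ᵐ[volume.restrict U] g) :
    HasL2Trace U g Γ := by
  refine ⟨?_, trace_congr h ▸ hf.2⟩
  filter_upwards [hf.1] with x ⟨a, ha⟩
  exact ⟨a, (hasTrace_congr h).mp ha⟩

lemma HasL2Trace.add (hf : MemLp f 2 (volume.restrict U)) (hg : MemLp g 2 (volume.restrict U))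
    (h1 : HasL2Trace U f Γ) (h2 : HasL2Trace U g Γ) : HasL2Trace U (f + g) Γ := by
  constructor
  · filter_upwards [h1.1, h2.1] with x ⟨a, ha⟩ ⟨b, hb⟩
    exact ⟨a + b, ha.add hf hg hb⟩
  · refine (h1.2.add h2.2).ae_eq ?_
    filter_upwards [h1.1, h2.1] with x ⟨a, ha⟩ ⟨b, hb⟩
    rw [Pi.add_apply, (ha.add hf hg hb).trace_eq, ha.trace_eq, hb.trace_eq]

end Trace

/-- Weak derivatives add almost everywhere, and traces see only almost everywhere classes. Together
with `feSpace_subset_contSpace` this reduces continuity on `V + V_h` to continuity on `V`. -/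
lemma add_mem_contSpace {d p : ℕ} {Ω ΓD : Set (Vec d)} (hΩ : IsOpen Ω) {M : Mesh d}
    {v w : Vec d → Vec d} (hv : v ∈ contSpace p Ω ΓD M) (hw : w ∈ contSpace p Ω ΓD M) :
    v + w ∈ contSpace p Ω ΓD M := by
  obtain ⟨v1, v2, v3, v4, v5⟩ := hv
  obtain ⟨w1, w2, w3, w4, w5⟩ := hw
  have hae : ∀ j, weakPartial Ω j (v + w) =ᵐ[volume.restrict Ω] weakPartial Ω j v + weakPartial Ω j w :=
    fun j => weakDeriv_add_ae_eq hΩ (v2 j).1 (w2 j).1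
  refine ⟨v1.add w1, fun j => ⟨?_, ?_⟩, v3.add v1 w1 w3, fun j => ?_, fun K hK L hL hKL l hl => ?_⟩
  · exact ⟨_, (hasWeakDeriv_weakDeriv (v2 j).1).add (hasWeakDeriv_weakDeriv (w2 j).1)⟩
  · exact ((v2 j).2.add (w2 j).2).ae_eq (hae j).symm
  · exact ((v4 j).add (v2 j).2 (w2 j).2 (w4 j)).congr (hae j).symm
  · obtain ⟨a1, a2, a3⟩ := v5 K hK L hL hKL l hl
    obtain ⟨b1, b2, b3⟩ := w5 K hK L hL hKL l hl
    have h := weakDeriv_add_ae_eq isOpen_interior a1 b1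
    exact ⟨⟨_, (hasWeakDeriv_weakDeriv a1).add (hasWeakDeriv_weakDeriv b1)⟩,
      (a2.add b2).ae_eq h.symm, (a3.add a2 b2 b3).congr h.symm⟩

/-! ### The exterior normal -/

section Normal

variable {d : ℕ} {Ω : Set (Vec d)} {x ν ν' : Vec d}

/-- Close to `x`, and away from the cone of aperture `ε` around the hyperplane orthogonal to `ν`, the
set `Ω` is the half space opposite to `ν`. -/
def IsHalfSpaceUpTo (Ω : Set (Vec d)) (ε r : ℝ) (x ν : Vec d) : Prop :=
  ∀ y ∈ Metric.ball x r,
    (⟪y - x, ν⟫ < -(ε * ‖y - x‖) → y ∈ Ω) ∧ (ε * ‖y - x‖ < ⟪y - x, ν⟫ → y ∉ Ω)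

lemma IsHalfSpaceUpTo.mono {ε ε' r r' : ℝ} (h : IsHalfSpaceUpTo Ω ε r x ν) (hε : ε ≤ ε')
    (hr : r' ≤ r) : IsHalfSpaceUpTo Ω ε' r' x ν := by
  intro y hy
  have h1 := h y (Metric.ball_subset_ball hr hy)
  have h2 : ε * ‖y - x‖ ≤ ε' * ‖y - x‖ := by gcongr
  exact ⟨fun h3 => h1.1 (by linarith), fun h3 => h1.2 (by linarith)⟩

/-- If `ν ≠ ν'`, the vector `ν' - ν` points strictly inwards for `ν` and strictly outwards for `ν'`,
so a short step along it would land both in `Ω` and outside it. -/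
lemma IsExteriorNormal.unique (h : IsExteriorNormal Ω x ν) (h' : IsExteriorNormal Ω x ν') :
    ν = ν' := by
  by_contra hne
  have h1 : ⟪ν, ν'⟫ < 1 := (inner_lt_one_iff_real_of_norm_eq_one h.1 h'.1).mpr hne
  set w := ν' - ν with hw
  have hwn : 0 < ‖w‖ := norm_pos_iff.mpr (sub_ne_zero.mpr (Ne.symm hne))
  have hν : ⟪w, ν⟫ = -(1 - ⟪ν, ν'⟫) := by
    rw [hw, inner_sub_left, real_inner_self_eq_norm_sq, h.1, real_inner_comm]; ring
  have hν' : ⟪w, ν'⟫ = 1 - ⟪ν, ν'⟫ := by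
    rw [hw, inner_sub_left, real_inner_self_eq_norm_sq, h'.1]; ring
  set δ := 1 - ⟪ν, ν'⟫ with hδ
  have hδ0 : 0 < δ := by linarith
  obtain ⟨r, hr, H⟩ := h.2 (δ / (2 * ‖w‖)) (by positivity)
  obtain ⟨r', hr', H'⟩ := h'.2 (δ / (2 * ‖w‖)) (by positivity)
  set t := min r r' / (2 * ‖w‖) with ht
  have hm : 0 < min r r' := lt_min hr hr'
  have ht0 : 0 < t := by positivity
  have hnorm : ‖t • w‖ = min r r' / 2 := by
    rw [norm_smul, Real.norm_eq_abs, abs_of_pos ht0, ht]; field_simp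
  have hsub : x + t • w - x = t • w := by abel
  have hd : dist (x + t • w) x < min r r' := by
    rw [dist_eq_norm, hsub, hnorm]; linarith
  have e1 := (H (x + t • w) (hd.trans_le (min_le_left _ _))).1
  have e2 := (H' (x + t • w) (hd.trans_le (min_le_right _ _))).2
  rw [hsub, norm_smul, Real.norm_eq_abs, abs_of_pos ht0, inner_smul_left] at e1 e2
  rw [hν] at e1
  rw [hν'] at e2
  have hq : δ / (2 * ‖w‖) * (t * ‖w‖) = t * δ / 2 := by field_simp
  have htδ : 0 < t * δ := by positivity
  simp only [hq, conj_trivial] at e1 e2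
  exact e2 (by linarith) (e1 (by linarith))

lemma exteriorNormal_eq (h : IsExteriorNormal Ω x ν) : exteriorNormal Ω x = ν := by
  have h' : ∃ ν, IsExteriorNormal Ω x ν := ⟨ν, h⟩
  rw [exteriorNormal, dif_pos h']
  exact h'.choose_spec.unique h

lemma norm_exteriorNormal_le (Ω : Set (Vec d)) (x : Vec d) : ‖exteriorNormal Ω x‖ ≤ 1 := by
  by_cases h : ∃ ν, IsExteriorNormal Ω x ν
  · obtain ⟨ν, hν⟩ := h
    rw [exteriorNormal_eq hν, hν.1]
  · rw [exteriorNormal, dif_neg h]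
    simp

/-- Failure is witnessed by a single point `y` through strict inequalities, and the same witness
serves nearby positions and directions. -/
lemma isOpen_not_isHalfSpaceUpTo (Ω : Set (Vec d)) (ε r : ℝ) :
    IsOpen {z : Vec d × Vec d | ¬ IsHalfSpaceUpTo Ω ε r z.1 z.2} := by
  have : {z : Vec d × Vec d | ¬ IsHalfSpaceUpTo Ω ε r z.1 z.2} =
      (⋃ y ∈ Ωᶜ, {z | dist y z.1 < r} ∩ {z | ⟪y - z.1, z.2⟫ < -(ε * ‖y - z.1‖)}) ∪
      ⋃ y ∈ Ω, {z | dist y z.1 < r} ∩ {z | ε * ‖y - z.1‖ < ⟪y - z.1, z.2⟫} := by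
    ext z
    simp only [IsHalfSpaceUpTo, Set.mem_ofPred_eq, Set.mem_union, Set.mem_iUnion, Set.mem_inter_iff,
      Set.mem_compl_iff, Metric.mem_ball]
    push Not
    constructor
    · rintro ⟨y, hy, h⟩
      by_cases hyΩ : y ∈ Ω
      · exact Or.inr ⟨y, hyΩ, hy, (h fun _ => hyΩ).1⟩
      · by_cases h1 : ⟪y - z.1, z.2⟫ < -(ε * ‖y - z.1‖)
        · exact Or.inl ⟨y, hyΩ, hy, h1⟩
        · exact absurd (h fun h2 => absurd h2 h1).2 hyΩ
    · rintro (⟨y, hyΩ, hy, h⟩ | ⟨y, hyΩ, hy, h⟩)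
      · exact ⟨y, hy, fun h1 => absurd (h1 h) hyΩ⟩
      · exact ⟨y, hy, fun _ => ⟨h, hyΩ⟩⟩
  rw [this]
  refine IsOpen.union (isOpen_biUnion fun y _ => ?_) (isOpen_biUnion fun y _ => ?_)
  · exact (isOpen_lt (by fun_prop) (by fun_prop)).inter (isOpen_lt (by fun_prop) (by fun_prop))
  · exact (isOpen_lt (by fun_prop) (by fun_prop)).inter (isOpen_lt (by fun_prop) (by fun_prop))

lemma isClosed_exists_isHalfSpaceUpTo (Ω : Set (Vec d)) (ε r : ℝ) {K : Set (Vec d)}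
    (hK : IsCompact K) : IsClosed {x | ∃ ν ∈ K, IsHalfSpaceUpTo Ω ε r x ν} := by
  rw [← isOpen_compl_iff, isOpen_iff_mem_nhds]
  intro x hx
  have hx' : ∀ ν ∈ K, ¬ IsHalfSpaceUpTo Ω ε r x ν := fun ν hν h => hx ⟨ν, hν, h⟩
  have := hK.eventually_forall_of_forall_eventually (x₀ := x)
    (P := fun x ν => ¬ IsHalfSpaceUpTo Ω ε r x ν)
    fun ν hν => (isOpen_not_isHalfSpaceUpTo Ω ε r).mem_nhds (hx' ν hν)
  filter_upwards [this] with y hy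
  rintro ⟨ν, hν, h⟩
  exact hy ν hν h

/-- The set is a countable intersection of countable unions of closed sets: for each aperture `1 /
(k + 1)` some radius `1 / (m + 1)` works. The approximate normals obtained for different `k` have a
limit point by compactness of the unit sphere, and the limit is a normal for every aperture. -/
lemma measurableSet_exists_isExteriorNormal (Ω : Set (Vec d)) {C : Set (Vec d)} (hC : IsClosed C) :
    MeasurableSet {x | ∃ ν ∈ C, IsExteriorNormal Ω x ν} := by
  set S := C ∩ Metric.sphere (0 : Vec d) 1 with hS
  have hSc : IsCompact S := (isCompact_sphere _ _).inter_left hC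
  have : {x | ∃ ν ∈ C, IsExteriorNormal Ω x ν} = ⋂ k : ℕ, ⋃ m : ℕ,
      {x | ∃ ν ∈ S, IsHalfSpaceUpTo Ω (1 / ((k : ℝ) + 1)) (1 / ((m : ℝ) + 1)) x ν} := by
    ext x
    simp only [Set.mem_iInter, Set.mem_iUnion]
    constructor
    · rintro ⟨ν, hν, h1, h2⟩ k
      obtain ⟨r, hr, H⟩ := h2 (1 / ((k : ℝ) + 1)) (by positivity)
      obtain ⟨m, hm⟩ := exists_nat_one_div_lt hr
      exact ⟨m, ν, ⟨hν, by simpa using h1⟩,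
        IsHalfSpaceUpTo.mono (show IsHalfSpaceUpTo Ω _ r x ν from H) le_rfl hm.le⟩
    · intro H
      choose m ν hν Hν using H
      obtain ⟨ν₀, hν₀, φ, hφ, hlim⟩ := hSc.tendsto_subseq hν
      refine ⟨ν₀, hν₀.1, by simpa using hν₀.2, fun ε hε => ?_⟩
      have h1 : ∀ᶠ i in atTop, ‖ν (φ i) - ν₀‖ < ε / 2 := by
        have := (tendsto_iff_norm_sub_tendsto_zero.mp hlim).eventually (gt_mem_nhds (half_pos hε))
        simpa using this
      have h2 : ∀ᶠ i in atTop, 1 / ((φ i : ℝ) + 1) < ε / 2 :=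
        (tendsto_one_div_add_atTop_nhds_zero_nat.comp hφ.tendsto_atTop).eventually
          (gt_mem_nhds (half_pos hε))
      obtain ⟨i, hi1, hi2⟩ := (h1.and h2).exists
      refine ⟨1 / ((m (φ i) : ℝ) + 1), by positivity, fun y hy => ?_⟩
      have h3 := Hν (φ i) y hy
      have h4 : |⟪y - x, ν (φ i)⟫ - ⟪y - x, ν₀⟫| ≤ ‖y - x‖ * (ε / 2) := by
        rw [← inner_sub_right]
        exact (abs_real_inner_le_norm _ _).trans (by gcongr)
      have h5 : 1 / ((φ i : ℝ) + 1) * ‖y - x‖ ≤ ε / 2 * ‖y - x‖ := by gcongr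
      have h6 := abs_le.mp h4
      exact ⟨fun h => h3.1 (by linarith), fun h => h3.2 (by linarith)⟩
  rw [this]
  exact MeasurableSet.iInter fun k => MeasurableSet.iUnion fun m =>
    (isClosed_exists_isHalfSpaceUpTo Ω _ _ hSc).measurableSet

/-- The second piece of the preimage accounts for the value 0 taken where there is no normal.
Measurability is what puts the normal component of the trace in `L²`. -/
lemma measurable_exteriorNormal (Ω : Set (Vec d)) : Measurable (exteriorNormal Ω) := by
  refine measurable_of_isClosed fun C hC => ?_
  have h1 := measurableSet_exists_isExteriorNormal Ω hC
  have h2 := measurableSet_exists_isExteriorNormal Ω (isClosed_univ (X := Vec d))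
  have hpre : exteriorNormal Ω ⁻¹' C = {x | ∃ ν ∈ C, IsExteriorNormal Ω x ν} ∪
      ({x | ∃ ν ∈ (Set.univ : Set (Vec d)), IsExteriorNormal Ω x ν}ᶜ ∩ {_x | (0 : Vec d) ∈ C}) := by
    ext x
    by_cases h : ∃ ν, IsExteriorNormal Ω x ν
    · obtain ⟨ν, hν⟩ := h
      rw [Set.mem_preimage, exteriorNormal_eq hν]
      constructor
      · exact fun hC => Or.inl ⟨ν, hC, hν⟩
      · rintro (⟨ν', hν', h'⟩ | ⟨h', -⟩)
        · exact hν.unique h' ▸ hν'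
        · exact absurd ⟨ν, Set.mem_univ _, hν⟩ h'
    · rw [Set.mem_preimage, exteriorNormal, dif_neg h]
      constructor
      · exact fun hC => Or.inr ⟨fun ⟨ν, _, hν⟩ => h ⟨ν, hν⟩, hC⟩
      · rintro (⟨ν', _, h'⟩ | ⟨-, h'⟩)
        · exact absurd ⟨ν', h'⟩ h
        · exact h'
  rw [hpre]
  exact h1.union (h2.compl.inter (MeasurableSet.const _))

end Normal

/-! ### Cauchy–Schwarz inequalities -/

section CauchySchwarz

/-- No measurability of `b` is required: domination by an integrable function suffices to bound its
Bochner integral. -/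
lemma abs_integral_le_sqrt_mul_sqrt {α : Type*} [MeasurableSpace α] {μ : Measure α} {b F G : α → ℝ}
    (hF : MemLp F 2 μ) (hG : MemLp G 2 μ) (hb : ∀ x, |b x| ≤ |F x| * |G x|) :
    |∫ x, b x ∂μ| ≤ √(∫ x, F x ^ 2 ∂μ) * √(∫ x, G x ^ 2 ∂μ) := by
  have h1 : Integrable (fun x => |F x| * |G x|) μ := hF.abs.integrable_mul hG.abs
  have h2 : |∫ x, b x ∂μ| ≤ ∫ x, |F x| * |G x| ∂μ :=
    norm_integral_le_of_norm_le (f := b) h1 (Eventually.of_forall hb)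
  refine h2.trans ?_
  have h3 := integral_mul_le_Lp_mul_Lq_of_nonneg (μ := μ) Real.HolderConjugate.two_two
    (f := fun x => |F x|) (g := fun x => |G x|)
    (Eventually.of_forall fun x => abs_nonneg _) (Eventually.of_forall fun x => abs_nonneg _)
    (by rw [ENNReal.ofReal_ofNat]; exact hF.abs) (by rw [ENNReal.ofReal_ofNat]; exact hG.abs)
  simpa [Real.sqrt_eq_rpow] using h3

lemma abs_sum_le_sqrt_mul_sqrt {ι : Type*} (s : Finset ι) {x a b : ι → ℝ}
    (ha : ∀ i ∈ s, 0 ≤ a i) (hb : ∀ i ∈ s, 0 ≤ b i) (h : ∀ i ∈ s, |x i| ≤ √(a i) * √(b i)) :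
    |∑ i ∈ s, x i| ≤ √(∑ i ∈ s, a i) * √(∑ i ∈ s, b i) := by
  refine (Finset.abs_sum_le_sum_abs _ _).trans ((Finset.sum_le_sum h).trans ?_)
  have := Finset.sum_mul_sq_le_sq_mul_sq s (fun i => √(a i)) (fun i => √(b i))
  rw [Finset.sum_congr rfl fun i hi => Real.sq_sqrt (ha i hi),
    Finset.sum_congr rfl fun i hi => Real.sq_sqrt (hb i hi)] at this
  rw [← Real.sqrt_mul (Finset.sum_nonneg ha)]
  exact Real.le_sqrt_of_sq_le this

variable {d : ℕ}

lemma frob_self_nonneg (A : Matrix (Fin d) (Fin d) ℝ) : 0 ≤ frob A A :=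
  Finset.sum_nonneg fun _ _ => Finset.sum_nonneg fun _ _ => mul_self_nonneg _

lemma abs_frob_le (A B : Matrix (Fin d) (Fin d) ℝ) :
    |frob A B| ≤ √(frob A A) * √(frob B B) := by
  refine abs_sum_le_sqrt_mul_sqrt _ (fun _ _ => Finset.sum_nonneg fun _ _ => mul_self_nonneg _)
    (fun _ _ => Finset.sum_nonneg fun _ _ => mul_self_nonneg _) fun i _ => ?_
  refine abs_sum_le_sqrt_mul_sqrt _ (fun j _ => mul_self_nonneg _) (fun j _ => mul_self_nonneg _)
    fun j _ => ?_
  rw [Real.sqrt_mul_self_eq_abs, Real.sqrt_mul_self_eq_abs, abs_mul]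

/-- The sum is the Frobenius product of `A` with the rank-one matrix `w ⊗ n`, whose Frobenius norm
is `‖n‖ ‖w‖`. -/
lemma abs_sum_mul_mul_le (A : Matrix (Fin d) (Fin d) ℝ) (n w : Vec d) (hn : ‖n‖ ≤ 1) :
    |∑ i, ∑ j, A i j * n j * w i| ≤ √(frob A A) * ‖w‖ := by
  have h1 := abs_frob_le A (Matrix.of fun i j => n j * w i)
  have h2 : frob (Matrix.of fun i j => n j * w i) (Matrix.of fun i j => n j * w i) =
      ‖n‖ ^ 2 * ‖w‖ ^ 2 := by
    simp only [frob, Matrix.of_apply, EuclideanSpace.norm_sq_eq, Real.norm_eq_abs, sq_abs,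
      Finset.sum_mul_sum]
    rw [Finset.sum_comm]
    exact Finset.sum_congr rfl fun i _ => Finset.sum_congr rfl fun j _ => by ring
  rw [h2, ← mul_pow, Real.sqrt_sq (by positivity)] at h1
  have h3 : ∑ i, ∑ j, A i j * n j * w i = frob A (Matrix.of fun i j => n j * w i) := by
    simp only [frob, Matrix.of_apply, mul_assoc]
  rw [h3]
  refine h1.trans ?_
  gcongr
  exact mul_le_of_le_one_left (norm_nonneg _) hn

lemma memLp_sqrt_frob {α : Type*} [MeasurableSpace α] {μ : Measure α}
    {A : α → Matrix (Fin d) (Fin d) ℝ} (hA : ∀ i j, MemLp (fun x => A x i j) 2 μ) :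
    MemLp (fun x => √(frob (A x) (A x))) 2 μ := by
  have h1 : MemLp (fun x => ∑ i, ∑ j, |A x i j|) 2 μ :=
    memLp_finsetSum _ fun i _ => memLp_finsetSum _ fun j _ => (hA i j).abs
  refine h1.of_le ?_ (Eventually.of_forall fun x => ?_)
  · refine Real.continuous_sqrt.comp_aestronglyMeasurable ?_
    simp only [frob]
    refine Finset.aestronglyMeasurable_fun_sum _ fun i _ =>
      Finset.aestronglyMeasurable_fun_sum _ fun j _ => ?_
    exact (hA i j).1.mul (hA i j).1
  · rw [Real.norm_eq_abs, Real.norm_eq_abs, abs_of_nonneg (Real.sqrt_nonneg _), abs_of_nonneg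
      (Finset.sum_nonneg fun i _ => Finset.sum_nonneg fun j _ => abs_nonneg _)]
    refine Real.sqrt_le_iff.mpr ⟨Finset.sum_nonneg fun i _ => Finset.sum_nonneg fun j _ =>
      abs_nonneg _, ?_⟩
    simp only [frob, ← Finset.sum_product', ← abs_mul_abs_self (A x _ _), ← sq]
    exact Finset.sum_sq_le_sq_sum_of_nonneg fun i _ => abs_nonneg _

lemma memLp_apply {α : Type*} [MeasurableSpace α] {μ : Measure α} {f : α → Vec d}
    (hf : MemLp f 2 μ) (i : Fin d) : MemLp (fun x => f x i) 2 μ :=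
  (EuclideanSpace.proj i : Vec d →L[ℝ] ℝ).comp_memLp' hf

lemma memLp_strain {α : Type*} [MeasurableSpace α] {μ : Measure α} {G : α → Fin d → Vec d}
    (hG : ∀ j, MemLp (fun x => G x j) 2 μ) (i j : Fin d) :
    MemLp (fun x => strain (G x) i j) 2 μ := by
  simp only [strain, Matrix.of_apply]
  exact ((memLp_apply (hG j) i).add (memLp_apply (hG i) j)).const_mul (1 / 2 : ℝ)

lemma memLp_trace_strain {α : Type*} [MeasurableSpace α] {μ : Measure α} {G : α → Fin d → Vec d}
    (hG : ∀ j, MemLp (fun x => G x j) 2 μ) : MemLp (fun x => (strain (G x)).trace) 2 μ := by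
  simp only [Matrix.trace, Matrix.diag]
  exact memLp_finsetSum _ fun i _ => memLp_strain hG i i

lemma memLp_stress {α : Type*} [MeasurableSpace α] {μ : Measure α} {G : α → Fin d → Vec d}
    (mu lam : ℝ) (hG : ∀ j, MemLp (fun x => G x j) 2 μ) (i j : Fin d) :
    MemLp (fun x => stress mu lam (G x) i j) 2 μ := by
  simp only [stress, Matrix.add_apply, Matrix.smul_apply, smul_eq_mul]
  exact ((memLp_strain hG i j).const_mul _).add
    (((memLp_trace_strain hG).const_mul lam).mul_const _)

end CauchySchwarz

/-! ### Continuity -/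

section Continuity

variable {d p : ℕ} {Ω ΓD : Set (Vec d)} {M : Mesh d} {mu lam γ h : ℝ} {v w : Vec d → Vec d}

lemma IsStabilized.symm {K L : Set (Vec d)} (h : IsStabilized Ω K L) : IsStabilized Ω L K :=
  ⟨h.2.1, h.1, ⟨h.2.2.1.1.symm, by rw [Set.inter_comm]; exact h.2.2.1.2⟩, h.2.2.2.symm⟩

/-- The trace from the side of `L` comes from the reversed pair `(L, K)`, for which the face, and
hence the chosen normal, is the same. -/
lemma memLp_normalJump (hv : v ∈ contSpace p Ω ΓD M) {K L : Set (Vec d)} (hK : K ∈ M.elements)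
    (hL : L ∈ M.elements) (hKL : IsStabilized Ω K L) {l : ℕ} (hl : l ∈ Finset.Icc 1 p) :
    MemLp (normalJump K L l v) 2 (surfaceMeasure (K ∩ L)) := by
  have h1 := (hv.2.2.2.2 K hK L hL hKL l hl).2.2.2
  have h2 := (hv.2.2.2.2 L hL K hK hKL.symm l hl).2.2.2
  rw [Set.inter_comm L K] at h2
  exact h1.sub h2

lemma memLp_gradIn (hv : v ∈ contSpace p Ω ΓD M) (j : Fin d) :
    MemLp (fun x => gradIn Ω v x j) 2 (volume.restrict Ω) := (hv.2.1 j).2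

lemma memLp_gradTrace (hv : v ∈ contSpace p Ω ΓD M) (j : Fin d) :
    MemLp (fun x => gradTrace Ω v x j) 2 (surfaceMeasure ΓD) := (hv.2.2.2.1 j).2

/-- The contribution of a pair of elements to the stabilization form. -/
def faceForm (p : ℕ) (h : ℝ) (K L : Set (Vec d)) (v w : Vec d → Vec d) : ℝ :=
  ∑ l ∈ Finset.Icc 1 p, h ^ (2 * l + 1) *
    ∫ x, ⟪normalJump K L l v x, normalJump K L l w x⟫ ∂(surfaceMeasure (K ∩ L))

lemma integral_inner_self_nonneg {α : Type*} [MeasurableSpace α] (μ : Measure α)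
    (f : α → Vec d) : 0 ≤ ∫ x, ⟪f x, f x⟫ ∂μ :=
  integral_nonneg fun _ => real_inner_self_nonneg

lemma faceForm_self_nonneg (hh : 0 < h) (K L : Set (Vec d)) (v : Vec d → Vec d) :
    0 ≤ faceForm p h K L v v :=
  Finset.sum_nonneg fun l _ => mul_nonneg (by positivity) (integral_inner_self_nonneg _ _)

lemma abs_integral_inner_le {α : Type*} [MeasurableSpace α] {μ : Measure α} {f g : α → Vec d}
    (hf : MemLp f 2 μ) (hg : MemLp g 2 μ) :
    |∫ x, ⟪f x, g x⟫ ∂μ| ≤ √(∫ x, ⟪f x, f x⟫ ∂μ) * √(∫ x, ⟪g x, g x⟫ ∂μ) := by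
  have := abs_integral_le_sqrt_mul_sqrt (b := fun x => ⟪f x, g x⟫) hf.norm hg.norm fun x => by
    rw [abs_norm, abs_norm]
    exact abs_real_inner_le_norm _ _
  simpa only [real_inner_self_eq_norm_sq] using this

lemma abs_faceForm_le (hh : 0 < h) (hv : v ∈ contSpace p Ω ΓD M) (hw : w ∈ contSpace p Ω ΓD M)
    {K L : Set (Vec d)} (hK : K ∈ M.elements) (hL : L ∈ M.elements) (hKL : IsStabilized Ω K L) :
    |faceForm p h K L v w| ≤ √(faceForm p h K L v v) * √(faceForm p h K L w w) := by
  refine abs_sum_le_sqrt_mul_sqrt _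
    (fun l _ => mul_nonneg (by positivity) (integral_inner_self_nonneg _ _))
    (fun l _ => mul_nonneg (by positivity) (integral_inner_self_nonneg _ _)) fun l hl => ?_
  have h1 := abs_integral_inner_le (memLp_normalJump hv hK hL hKL hl)
    (memLp_normalJump hw hK hL hKL hl)
  have hp : 0 ≤ h ^ (2 * l + 1) := by positivity
  rw [abs_mul, abs_of_nonneg hp, Real.sqrt_mul hp, Real.sqrt_mul hp]
  calc _ ≤ h ^ (2 * l + 1) * _ := mul_le_mul_of_nonneg_left h1 hp
    _ = (√(h ^ (2 * l + 1)) * √(h ^ (2 * l + 1))) * _ := by rw [Real.mul_self_sqrt hp]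
    _ = _ := by ring

open Classical in
lemma jForm_eq (p : ℕ) (Ω : Set (Vec d)) (M : Mesh d) (h : ℝ) (v w : Vec d → Vec d) :
    jForm p Ω M h v w = (1 / 2) * ∑ K ∈ M.elements, ∑ L ∈ M.elements,
      if IsStabilized Ω K L then faceForm p h K L v w else 0 := rfl

lemma jForm_self_nonneg (hh : 0 < h) (v : Vec d → Vec d) : 0 ≤ jForm p Ω M h v v := by
  rw [jForm_eq]
  refine mul_nonneg (by norm_num) (Finset.sum_nonneg fun K _ => Finset.sum_nonneg fun L _ => ?_)
  split_ifs
  · exact faceForm_self_nonneg hh _ _ _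
  · exact le_rfl

lemma abs_jForm_le (hh : 0 < h) (hv : v ∈ contSpace p Ω ΓD M) (hw : w ∈ contSpace p Ω ΓD M) :
    |jForm p Ω M h v w| ≤ √(jForm p Ω M h v v) * √(jForm p Ω M h w w) := by
  classical
  have hnn : ∀ (u : Vec d → Vec d) (K L : Set (Vec d)),
      0 ≤ if IsStabilized Ω K L then faceForm p h K L u u else 0 := by
    intro u K L
    split_ifs
    · exact faceForm_self_nonneg hh _ _ _
    · exact le_rfl
  simp only [jForm_eq]
  rw [abs_mul, Real.sqrt_mul (by norm_num), Real.sqrt_mul (by norm_num), abs_of_nonneg (by norm_num),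
    mul_mul_mul_comm, Real.mul_self_sqrt (by norm_num)]
  refine mul_le_mul_of_nonneg_left ?_ (by norm_num)
  refine abs_sum_le_sqrt_mul_sqrt _ (fun K _ => Finset.sum_nonneg fun L _ => hnn v K L)
    (fun K _ => Finset.sum_nonneg fun L _ => hnn w K L) fun K hK => ?_
  refine abs_sum_le_sqrt_mul_sqrt _ (fun L _ => hnn v K L) (fun L _ => hnn w K L) fun L hL => ?_
  split_ifs with hKL
  · exact abs_faceForm_le hh hv hw hK hL hKL
  · simp

/-- The square of the energy norm. -/
def energySq (mu lam γ : ℝ) (p : ℕ) (Ω ΓD : Set (Vec d)) (M : Mesh d) (h : ℝ)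
    (v : Vec d → Vec d) : ℝ :=
  ahForm mu lam γ p Ω M h v v
    + h * (∫ x, frob (stress mu lam (gradTrace Ω v x)) (stress mu lam (gradTrace Ω v x))
        ∂(surfaceMeasure ΓD))
    + h⁻¹ * bForm mu lam Ω ΓD v v

/-- The square of the energy norm is the sum of these six nonnegative terms. -/
lemma energySq_terms (hmu : 0 < mu) (hlam : 0 ≤ lam) (hγ : 0 < γ) (hh : 0 < h)
    (v : Vec d → Vec d) :
    0 ≤ 2 * mu * (∫ x in Ω, frob (strain (gradIn Ω v x)) (strain (gradIn Ω v x))) ∧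
    0 ≤ lam * (∫ x in Ω, (strain (gradIn Ω v x)).trace * (strain (gradIn Ω v x)).trace) ∧
    0 ≤ γ * (h ^ 2)⁻¹ * jForm p Ω M h v v ∧
    0 ≤ h * (∫ x, frob (stress mu lam (gradTrace Ω v x)) (stress mu lam (gradTrace Ω v x))
        ∂(surfaceMeasure ΓD)) ∧
    0 ≤ h⁻¹ * (2 * mu * ∫ x, ⟪trace Ω v x, trace Ω v x⟫ ∂(surfaceMeasure ΓD)) ∧
    0 ≤ h⁻¹ * (lam * ∫ x, ⟪trace Ω v x, exteriorNormal Ω x⟫ * ⟪trace Ω v x, exteriorNormal Ω x⟫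
        ∂(surfaceMeasure ΓD)) := by
  refine ⟨mul_nonneg (by positivity) (integral_nonneg fun _ => frob_self_nonneg _),
    mul_nonneg hlam (integral_nonneg fun _ => mul_self_nonneg _),
    mul_nonneg (by positivity) (jForm_self_nonneg hh v),
    mul_nonneg hh.le (integral_nonneg fun _ => frob_self_nonneg _),
    mul_nonneg (by positivity) (mul_nonneg (by positivity) (integral_inner_self_nonneg _ _)),
    mul_nonneg (by positivity) (mul_nonneg hlam (integral_nonneg fun _ => mul_self_nonneg _))⟩

lemma energySq_nonneg (hmu : 0 < mu) (hlam : 0 ≤ lam) (hγ : 0 < γ) (hh : 0 < h)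
    (v : Vec d → Vec d) : 0 ≤ energySq mu lam γ p Ω ΓD M h v := by
  obtain ⟨h1, h2, h3, h4, h5, h6⟩ :=
    energySq_terms (p := p) (Ω := Ω) (ΓD := ΓD) (M := M) hmu hlam hγ hh v
  rw [energySq, ahForm, aForm, bForm, mul_add h⁻¹]
  linarith

lemma abs_mul_integral_frob_le {α : Type*} [MeasurableSpace α] {μ : Measure α}
    {A B : α → Matrix (Fin d) (Fin d) ℝ} (hA : ∀ i j, MemLp (fun x => A x i j) 2 μ)
    (hB : ∀ i j, MemLp (fun x => B x i j) 2 μ) :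
    |∫ x, frob (A x) (B x) ∂μ| ≤ √(∫ x, frob (A x) (A x) ∂μ) * √(∫ x, frob (B x) (B x) ∂μ) := by
  have := abs_integral_le_sqrt_mul_sqrt (b := fun x => frob (A x) (B x)) (memLp_sqrt_frob hA)
    (memLp_sqrt_frob hB) fun x => by
      rw [abs_of_nonneg (Real.sqrt_nonneg _), abs_of_nonneg (Real.sqrt_nonneg _)]
      exact abs_frob_le _ _
  simpa only [Real.sq_sqrt (frob_self_nonneg _)] using this

lemma abs_tractionForm_le
    (hv : v ∈ contSpace p Ω ΓD M) (hw : w ∈ contSpace p Ω ΓD M) :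
    |tractionForm mu lam Ω ΓD v w| ≤
      √(∫ x, frob (stress mu lam (gradTrace Ω v x)) (stress mu lam (gradTrace Ω v x))
        ∂(surfaceMeasure ΓD)) * √(∫ x, ⟪trace Ω w x, trace Ω w x⟫ ∂(surfaceMeasure ΓD)) := by
  have := abs_integral_le_sqrt_mul_sqrt (μ := surfaceMeasure ΓD)
    (b := fun x => ∑ i, ∑ j, stress mu lam (gradTrace Ω v x) i j * exteriorNormal Ω x j
      * trace Ω w x i)
    (memLp_sqrt_frob (memLp_stress mu lam (memLp_gradTrace hv))) hw.2.2.1.2.norm fun x => by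
      rw [abs_of_nonneg (Real.sqrt_nonneg _), abs_norm]
      exact abs_sum_mul_mul_le _ _ _ (norm_exteriorNormal_le _ _)
  simp only [Real.sq_sqrt (frob_self_nonneg _), ← real_inner_self_eq_norm_sq] at this
  exact this

lemma memLp_inner_exteriorNormal (hv : v ∈ contSpace p Ω ΓD M) :
    MemLp (fun x => ⟪trace Ω v x, exteriorNormal Ω x⟫) 2 (surfaceMeasure ΓD) := by
  refine hv.2.2.1.2.norm.of_le (hv.2.2.1.2.1.inner
    (measurable_exteriorNormal Ω).aestronglyMeasurable) (Eventually.of_forall fun x => ?_)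
  rw [norm_norm]
  exact (norm_inner_le_norm _ _).trans
    (mul_le_of_le_one_right (norm_nonneg _) (norm_exteriorNormal_le _ _))

lemma abs_mul_le_of_abs_le_sqrt {c x a b S T : ℝ} (hc : 0 ≤ c) (hx : |x| ≤ √a * √b)
    (ha : c * a ≤ S) (hb : c * b ≤ T) : |c * x| ≤ √S * √T := by
  rw [abs_mul, abs_of_nonneg hc]
  calc c * |x| ≤ c * (√a * √b) := by gcongr
    _ = √(c * a) * √(c * b) := by
        rw [Real.sqrt_mul hc, Real.sqrt_mul hc, mul_mul_mul_comm, Real.mul_self_sqrt hc]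
    _ ≤ √S * √T := by gcongr

/-- Each summand is at most a constant times `√S √T`. The constant 3 counts the two bulk terms and
the stabilization, `2 (√(2 mu))⁻¹` the two consistency terms, and `2 β` the two parts of `b_h`. -/
theorem abs_nitscheForm_le (hmu : 0 < mu) (hlam : 0 ≤ lam) (hγ : 0 < γ) {β : ℝ} (hβ : 0 < β)
    (hh : 0 < h) (hv : v ∈ contSpace p Ω ΓD M) (hw : w ∈ contSpace p Ω ΓD M) :
    |nitscheForm mu lam γ β p Ω ΓD M h v w| ≤
      (3 + 2 * (√(2 * mu))⁻¹ + 2 * β) * energyNorm mu lam γ p Ω ΓD M h v *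
        energyNorm mu lam γ p Ω ΓD M h w := by
  have hE : ∀ u, energyNorm mu lam γ p Ω ΓD M h u = √(energySq mu lam γ p Ω ΓD M h u) :=
    fun _ => rfl
  have hsum : ∀ u, energySq mu lam γ p Ω ΓD M h u =
      2 * mu * (∫ x in Ω, frob (strain (gradIn Ω u x)) (strain (gradIn Ω u x))) +
      lam * (∫ x in Ω, (strain (gradIn Ω u x)).trace * (strain (gradIn Ω u x)).trace) +
      γ * (h ^ 2)⁻¹ * jForm p Ω M h u u +
      h * (∫ x, frob (stress mu lam (gradTrace Ω u x)) (stress mu lam (gradTrace Ω u x))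
        ∂(surfaceMeasure ΓD)) +
      h⁻¹ * (2 * mu * ∫ x, ⟪trace Ω u x, trace Ω u x⟫ ∂(surfaceMeasure ΓD)) +
      h⁻¹ * (lam * ∫ x, ⟪trace Ω u x, exteriorNormal Ω x⟫ * ⟪trace Ω u x, exteriorNormal Ω x⟫
        ∂(surfaceMeasure ΓD)) := by
    intro u
    rw [energySq, ahForm, aForm, bForm]
    ring
  have hterms := fun u => energySq_terms (p := p) (Ω := Ω) (ΓD := ΓD) (M := M) hmu hlam hγ hh u
  rw [hE, hE]
  set S := energySq mu lam γ p Ω ΓD M h v with hS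
  set T := energySq mu lam γ p Ω ΓD M h w with hT
  obtain ⟨v1, v2, v3, v4, v5, v6⟩ := hterms v
  obtain ⟨w1, w2, w3, w4, w5, w6⟩ := hterms w
  have hSe := hsum v
  have hTe := hsum w
  rw [← hS] at hSe
  rw [← hT] at hTe
  have b1 := abs_mul_le_of_abs_le_sqrt (S := S) (T := T) (by positivity : 0 ≤ 2 * mu)
    (abs_mul_integral_frob_le (memLp_strain (memLp_gradIn hv)) (memLp_strain (memLp_gradIn hw)))
    (by linarith) (by linarith)
  have b2 : |lam * ∫ x in Ω, (strain (gradIn Ω v x)).trace * (strain (gradIn Ω w x)).trace|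
      ≤ √S * √T := by
    refine abs_mul_le_of_abs_le_sqrt hlam (abs_integral_le_sqrt_mul_sqrt
      (memLp_trace_strain (memLp_gradIn hv)) (memLp_trace_strain (memLp_gradIn hw))
      fun x => (abs_mul _ _).le) ?_ ?_
    · simp only [sq]; linarith
    · simp only [sq]; linarith
  have b3 := abs_mul_le_of_abs_le_sqrt (S := S) (T := T) (by positivity : 0 ≤ γ * (h ^ 2)⁻¹)
    (abs_jForm_le hh hv hw) (by linarith) (by linarith)
  have b5 : |h⁻¹ * bForm mu lam Ω ΓD v w| ≤ 2 * (√S * √T) := by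
    rw [bForm, mul_add, two_mul (√S * √T)]
    refine (abs_add_le _ _).trans (add_le_add ?_ ?_)
    · rw [← mul_assoc]
      refine abs_mul_le_of_abs_le_sqrt (by positivity)
        (abs_integral_inner_le hv.2.2.1.2 hw.2.2.1.2) ?_ ?_
      · rw [mul_assoc]; linarith
      · rw [mul_assoc]; linarith
    · rw [← mul_assoc]
      refine abs_mul_le_of_abs_le_sqrt (by positivity) (abs_integral_le_sqrt_mul_sqrt
        (memLp_inner_exteriorNormal hv) (memLp_inner_exteriorNormal hw)
        fun x => (abs_mul _ _).le) ?_ ?_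
      · simp only [sq]; rw [mul_assoc]; linarith
      · simp only [sq]; rw [mul_assoc]; linarith
  -- For the consistency terms the factors `√h` and `√h⁻¹` cancel; the `L²` norm of the trace is
  -- recovered from the `2 mu` part of `b_h`.
  have key : ∀ {x a b P Q : ℝ}, |x| ≤ √a * √b → h * a ≤ P → h⁻¹ * (2 * mu * b) ≤ Q →
      |x| ≤ (√(2 * mu))⁻¹ * (√P * √Q) := by
    intro x a b P Q hx ha hb
    have h1 : √a ≤ √(h⁻¹) * √P := by
      rw [← Real.sqrt_mul (by positivity)]
      apply Real.sqrt_le_sqrt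
      calc a = h⁻¹ * (h * a) := by field_simp
        _ ≤ h⁻¹ * P := by gcongr
    have h2 : √b ≤ √h * ((√(2 * mu))⁻¹ * √Q) := by
      rw [← Real.sqrt_inv, ← Real.sqrt_mul (by positivity), ← Real.sqrt_mul hh.le]
      apply Real.sqrt_le_sqrt
      calc b = h * ((2 * mu)⁻¹ * (h⁻¹ * (2 * mu * b))) := by field_simp
        _ ≤ h * ((2 * mu)⁻¹ * Q) := by gcongr
    calc |x| ≤ √a * √b := hx
      _ ≤ (√(h⁻¹) * √P) * (√h * ((√(2 * mu))⁻¹ * √Q)) := by gcongr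
      _ = (√(h⁻¹) * √h) * ((√(2 * mu))⁻¹ * (√P * √Q)) := by ring
      _ = _ := by rw [← Real.sqrt_mul (by positivity), inv_mul_cancel₀ hh.ne', Real.sqrt_one, one_mul]
  have b4 := key (abs_tractionForm_le (mu := mu) (lam := lam) hv hw) (P := S) (Q := T)
    (by linarith) (by linarith)
  have b4' := key (abs_tractionForm_le (mu := mu) (lam := lam) hw hv) (P := T) (Q := S)
    (by linarith) (by linarith)
  have b5' : |β * (h⁻¹ * bForm mu lam Ω ΓD v w)| ≤ β * (2 * (√S * √T)) := by
    rw [abs_mul, abs_of_pos hβ]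
    gcongr
  rw [mul_comm (√T)] at b4'
  rw [nitscheForm, ahForm, aForm, mul_assoc β]
  rw [abs_le] at *
  constructor <;> linarith [b1.1, b1.2, b2.1, b2.2, b3.1, b3.2, b4.1, b4.2, b4'.1, b4'.2, b5'.1, b5'.2]

end Continuity

/-! ### Geometry of meshes -/

section MeshGeometry

variable {d : ℕ} {M : Mesh d} {K L : Set (Vec d)}

lemma Mesh.convex (hK : K ∈ M.elements) : Convex ℝ K := by
  obtain ⟨s, rfl⟩ := M.polytope K hK
  exact convex_convexHull ℝ _

lemma Mesh.isCompact (hK : K ∈ M.elements) : IsCompact K := by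
  obtain ⟨s, rfl⟩ := M.polytope K hK
  exact s.finite_toSet.isCompact_convexHull ℝ

lemma Mesh.isClosed (hK : K ∈ M.elements) : IsClosed K := (M.isCompact hK).isClosed

lemma Mesh.closure_interior (hK : K ∈ M.elements) : closure (interior K) = K := by
  rw [(M.convex hK).closure_interior_eq_closure_of_nonempty_interior (M.nondegenerate K hK),
    (M.isClosed hK).closure_eq]

lemma Mesh.interior_inter_nonempty (hK : K ∈ M.elements) {U : Set (Vec d)} (hU : IsOpen U)
    (h : (K ∩ U).Nonempty) : (interior K ∩ U).Nonempty := by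
  obtain ⟨x, hxK, hxU⟩ := h
  rw [← M.closure_interior hK] at hxK
  obtain ⟨y, hyU, hyK⟩ := mem_closure_iff.mp hxK U hU hxU
  exact ⟨y, hyK, hyU⟩

/-- A linear functional maximal over `K` at an interior point is zero, and then the face it exposes
is all of `K`. -/
lemma subset_of_isExposed_of_mem_interior {z : Vec d} (h : IsExposed ℝ K (K ∩ L))
    (hzK : z ∈ interior K) (hzL : z ∈ L) : K ⊆ L := by
  obtain ⟨l, hl⟩ := h ⟨z, interior_subset hzK, hzL⟩
  have hz : z ∈ {x ∈ K | ∀ y ∈ K, l y ≤ l x} := hl ▸ ⟨interior_subset hzK, hzL⟩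
  have hmax : IsLocalMax l z := by
    filter_upwards [mem_interior_iff_mem_nhds.mp hzK] with y hy using hz.2 y hy
  have h0 : (l : Vec d →L[ℝ] ℝ) = 0 := hmax.hasFDerivAt_eq_zero l.hasFDerivAt
  intro x hx
  have : x ∈ K ∩ L := by
    rw [hl]
    exact ⟨hx, fun y _ => by rw [h0]; simp⟩
  exact this.2

lemma Mesh.eq_of_mem_interior (hK : K ∈ M.elements) (hL : L ∈ M.elements) {z : Vec d}
    (hzK : z ∈ interior K) (hzL : z ∈ interior L) : K = L :=
  Set.Subset.antisymm
    (subset_of_isExposed_of_mem_interior (M.conforming K hK L hL) hzK (interior_subset hzL))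
    (subset_of_isExposed_of_mem_interior (M.conforming L hL K hK) hzL (interior_subset hzK))

lemma Mesh.disjoint_interior (hK : K ∈ M.elements) (hL : L ∈ M.elements) (hne : K ≠ L) :
    Disjoint (interior K) (interior L) :=
  Set.disjoint_left.mpr fun _ h1 h2 => hne (M.eq_of_mem_interior hK hL h1 h2)

/-- If the convex set `K ∩ L` had full dimension, it would have an interior point, interior to both
elements, and these would coincide. -/
lemma Mesh.finrank_vectorSpan_inter_lt (hd : 0 < d) (hK : K ∈ M.elements) (hL : L ∈ M.elements)
    (hne : K ≠ L) : Module.finrank ℝ (vectorSpan ℝ (K ∩ L)) < d := by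
  have hle := Submodule.finrank_le (vectorSpan ℝ (K ∩ L))
  rw [finrank_euclideanSpace_fin] at hle
  refine lt_of_le_of_ne hle fun heq => hne ?_
  have htop : vectorSpan ℝ (K ∩ L) = ⊤ :=
    Submodule.eq_top_of_finrank_eq (by rw [heq, finrank_euclideanSpace_fin])
  have hnonempty : (K ∩ L).Nonempty := by
    by_contra h
    rw [Set.not_nonempty_iff_eq_empty] at h
    rw [h, vectorSpan_empty, finrank_bot] at heq
    omega
  have hint : (interior (K ∩ L)).Nonempty := by
    rw [((M.convex hK).inter (M.convex hL)).interior_nonempty_iff_affineSpan_eq_top,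
      AffineSubspace.affineSpan_eq_top_iff_vectorSpan_eq_top_of_nonempty ℝ _ _ hnonempty, htop]
  rw [interior_inter] at hint
  obtain ⟨z, hz⟩ := hint
  exact M.eq_of_mem_interior hK hL hz.1 hz.2

lemma volume_affineSpan_eq_zero {s : Set (Vec d)} (h : Module.finrank ℝ (vectorSpan ℝ s) < d) :
    volume (affineSpan ℝ s : Set (Vec d)) = 0 := by
  refine Measure.addHaar_affineSubspace _ _ fun htop => ?_
  have : vectorSpan ℝ s = ⊤ := by rw [← direction_affineSpan, htop, AffineSubspace.direction_top]
  rw [this, finrank_top, finrank_euclideanSpace_fin] at h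
  exact lt_irrefl _ h

/-- The elements that meet `U`. -/
def Mesh.meeting (M : Mesh d) (U : Set (Vec d)) : Finset (Set (Vec d)) :=
  open Classical in M.elements.filter fun K => (K ∩ U).Nonempty

lemma Mesh.mem_meeting {U : Set (Vec d)} :
    K ∈ M.meeting U ↔ K ∈ M.elements ∧ (K ∩ U).Nonempty := by
  simp [Mesh.meeting]

/-- General position: countably many proper affine subspaces form a null set, which cannot contain a
nonempty open set. -/
lemma exists_mem_notMem_affineSpan {ι : Type*} {U : Set (Vec d)} (hU : IsOpen U) (hne : U.Nonempty)
    (I : Set ι) (hI : I.Countable) (s : ι → Set (Vec d))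
    (h : ∀ i ∈ I, Module.finrank ℝ (vectorSpan ℝ (s i)) < d) :
    ∃ a ∈ U, ∀ i ∈ I, a ∉ affineSpan ℝ (s i) := by
  by_contra! hcon
  have h0 : volume (⋃ i ∈ I, (affineSpan ℝ (s i) : Set (Vec d))) = 0 :=
    (measure_biUnion_null_iff hI).mpr fun i hi => volume_affineSpan_eq_zero (h i hi)
  refine (hU.measure_pos volume hne).ne' (measure_mono_null (fun a ha => ?_) h0)
  obtain ⟨i, hi, hai⟩ := hcon a ha
  exact Set.mem_biUnion hi hai

/-- Inside a convex open set covered by a mesh, there is no way to split the elements into two classes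
such that no element of the first class is a neighbour of one of the second. -/
lemma Mesh.exists_areNeighbours (hd : 0 < d) {U : Set (Vec d)} (hU : IsOpen U) (hUc : Convex ℝ U)
    (hcov : U ⊆ M.domain) (A : Set (Set (Vec d))) (hK : K ∈ M.meeting U) (hL : L ∈ M.meeting U)
    (hKA : K ∈ A) (hLA : L ∉ A) :
    ∃ K' ∈ M.meeting U, ∃ L' ∈ M.meeting U, K' ∈ A ∧ L' ∉ A ∧ AreNeighbours K' L' := by
  by_contra! hcon
  let I : Set (Set (Vec d) × Set (Vec d)) :=
    {z | z.1 ∈ M.meeting U ∧ z.2 ∈ M.meeting U ∧ z.1 ∈ A ∧ z.2 ∉ A}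
  have hI : I.Countable := by
    refine (((M.meeting U) ×ˢ (M.meeting U)).countable_toSet).mono fun z hz => ?_
    simp only [Finset.coe_product, Set.mem_prod, Finset.mem_coe]
    exact ⟨hz.1, hz.2.1⟩
  have hdim : ∀ z ∈ I, Module.finrank ℝ (vectorSpan ℝ (z.1 ∩ z.2)) + 1 < d := by
    rintro ⟨K', L'⟩ ⟨h1, h2, h3, h4⟩
    have hne : K' ≠ L' := fun h => h4 (by simpa [← h] using h3)
    have h5 := M.finrank_vectorSpan_inter_lt hd (Mesh.mem_meeting.mp h1).1
      (Mesh.mem_meeting.mp h2).1 hne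
    exact lt_of_le_of_ne h5 fun h6 => hcon K' h1 L' h2 h3 h4 ⟨hne, h6⟩
  have hKm := Mesh.mem_meeting.mp hK
  have hLm := Mesh.mem_meeting.mp hL
  -- Without neighbours across the two classes, every intersection across them has dimension at most
  -- `d - 2`. Its span with a point `a` is still proper, so `b` can be chosen such that the segment
  -- from `a` to `b` misses all these intersections.
  obtain ⟨a, ⟨haK, haU⟩, ha⟩ := exists_mem_notMem_affineSpan (isOpen_interior.inter hU)
    (M.interior_inter_nonempty hKm.1 hU hKm.2) I hI (fun z => z.1 ∩ z.2)
    fun z hz => by have := hdim z hz; omega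
  obtain ⟨b, ⟨hbL, hbU⟩, hb⟩ := exists_mem_notMem_affineSpan (isOpen_interior.inter hU)
    (M.interior_inter_nonempty hLm.1 hU hLm.2) I hI (fun z => insert a (z.1 ∩ z.2))
    fun z hz => (finrank_vectorSpan_insert_le_set ℝ (z.1 ∩ z.2) a).trans_lt (hdim z hz)
  have hseg : segment ℝ a b ⊆ U := hUc.segment_subset haU hbU
  have hpre : IsPreconnected (segment ℝ a b) := (convex_segment a b).isPreconnected
  have hclosed : ∀ P : Set (Vec d) → Prop,
      IsClosed (⋃ K' ∈ {K' | K' ∈ M.meeting U ∧ P K'}, K') := fun P => by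
    refine Set.Finite.isClosed_biUnion
      ((M.meeting U).finite_toSet.subset fun K' hK' => hK'.1) fun K' hK' => ?_
    exact M.isClosed (Mesh.mem_meeting.mp hK'.1).1
  -- The two classes give closed sets covering the connected segment and both meeting it, so they
  -- share a point `z` of the segment.
  obtain ⟨z, hz, hzA, hzB⟩ := isPreconnected_closed_iff.mp hpre _ _ (hclosed (· ∈ A))
    (hclosed (· ∉ A)) (fun z hz => by
      obtain ⟨K', hK', hzK'⟩ := Set.mem_iUnion₂.mp (hcov (hseg hz))
      have hm : K' ∈ M.meeting U := Mesh.mem_meeting.mpr ⟨hK', z, hzK', hseg hz⟩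
      by_cases h : K' ∈ A
      · exact Or.inl (Set.mem_biUnion (⟨hm, h⟩ : K' ∈ {K' | K' ∈ M.meeting U ∧ K' ∈ A}) hzK')
      · exact Or.inr (Set.mem_biUnion (⟨hm, h⟩ : K' ∈ {K' | K' ∈ M.meeting U ∧ K' ∉ A}) hzK'))
    ⟨a, left_mem_segment ℝ a b, Set.mem_biUnion
      (⟨hK, hKA⟩ : K ∈ {K' | K' ∈ M.meeting U ∧ K' ∈ A}) (interior_subset haK)⟩
    ⟨b, right_mem_segment ℝ a b, Set.mem_biUnion
      (⟨hL, hLA⟩ : L ∈ {K' | K' ∈ M.meeting U ∧ K' ∉ A}) (interior_subset hbL)⟩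
  obtain ⟨K', ⟨hK'm, hK'A⟩, hzK'⟩ := Set.mem_iUnion₂.mp hzA
  obtain ⟨L', ⟨hL'm, hL'A⟩, hzL'⟩ := Set.mem_iUnion₂.mp hzB
  have hI' : (K', L') ∈ I := ⟨hK'm, hL'm, hK'A, hL'A⟩
  have haz := ha _ hI'
  have hbz := hb _ hI'
  apply hbz
  obtain ⟨t, ht, rfl⟩ := (segment_eq_image_lineMap ℝ a b ▸ hz :
    z ∈ AffineMap.lineMap a b '' Set.Icc (0 : ℝ) 1)
  -- As `z ≠ a`, the endpoint `b` lies on the line through `a` and `z`, hence in the span that was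
  -- avoided.
  have ht0 : t ≠ 0 := by
    rintro rfl
    rw [AffineMap.lineMap_apply_zero] at hzK' hzL'
    exact haz (subset_affineSpan ℝ _ ⟨hzK', hzL'⟩)
  have h1 : AffineMap.lineMap a b t ∈ affineSpan ℝ (insert a (K' ∩ L')) :=
    subset_affineSpan ℝ _ (Set.mem_insert_of_mem _ ⟨hzK', hzL'⟩)
  have h2 : a ∈ affineSpan ℝ (insert a (K' ∩ L')) := subset_affineSpan ℝ _ (Set.mem_insert _ _)
  have h3 : AffineMap.lineMap a (AffineMap.lineMap a b t) t⁻¹ = b := by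
    simp [AffineMap.lineMap_apply, smul_smul, ht0]
  rw [← h3]
  exact AffineMap.lineMap_mem _ h2 h1

/-- Inside a convex open set covered by a mesh, any two elements are linked by a short chain of
neighbours; stated as an induction principle along the chain. -/
lemma Mesh.exists_chain (hd : 0 < d) {U : Set (Vec d)} (hU : IsOpen U) (hUc : Convex ℝ U)
    (hcov : U ⊆ M.domain) (hK : K ∈ M.meeting U) (hL : L ∈ M.meeting U) :
    ∃ k < (M.meeting U).card, ∀ P : ℕ → Set (Vec d) → Prop, P 0 L →
      (∀ j, ∀ K' ∈ M.meeting U, ∀ L' ∈ M.meeting U, AreNeighbours K' L' → P j L' → P (j + 1) K') →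
      P k K := by
  classical
  -- In the neighbour graph, a connected component that is not everything would split the elements
  -- with no neighbours across. A path visits no vertex twice, which bounds the length of the chain.
  let G : SimpleGraph (M.meeting U) :=
    { Adj := fun a b => AreNeighbours (a : Set (Vec d)) b
      symm := ⟨fun a b h => ⟨h.1.symm, by rw [Set.inter_comm]; exact h.2⟩⟩
      loopless := ⟨fun a h => h.1 rfl⟩ }
  have hreach : G.Reachable ⟨K, hK⟩ ⟨L, hL⟩ := by
    by_contra hnot
    let A : Set (Set (Vec d)) := {K' | ∃ h : K' ∈ M.meeting U, G.Reachable ⟨K, hK⟩ ⟨K', h⟩}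
    obtain ⟨K', hK', L', hL', ⟨_, hA⟩, hB, hnb⟩ := M.exists_areNeighbours hd hU hUc hcov A hK hL
      ⟨hK, SimpleGraph.Reachable.refl _⟩ fun ⟨_, h⟩ => hnot h
    refine hB ⟨hL', hA.trans (SimpleGraph.Adj.reachable ?_)⟩
    exact hnb
  obtain ⟨w⟩ := hreach
  refine ⟨(w.toPath : G.Walk ⟨K, hK⟩ ⟨L, hL⟩).length, ?_, fun P h0 hstep => ?_⟩
  · have := w.toPath.2.length_lt
    rwa [Fintype.card_coe] at this
  · have : ∀ {a b : M.meeting U} (w : G.Walk a b), P 0 b → P w.length a := by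
      intro a b w
      induction w with
      | nil => exact id
      | cons h w ih => exact fun h0 => hstep _ _ (Subtype.prop _) _ (Subtype.prop _) h (ih h0)
    exact this _ h0

lemma Mesh.IsQuasiUniform.subset_closedBall {ρ h R : ℝ} (hM : M.IsQuasiUniform ρ h)
    (hK : K ∈ M.elements) {y : Vec d} (hy : (K ∩ Metric.closedBall y (R * h)).Nonempty) :
    K ⊆ Metric.closedBall y ((R + ρ⁻¹) * h) := by
  obtain ⟨z, hzK, hzy⟩ := hy
  intro x hx
  have h1 := Metric.dist_le_diam_of_mem (M.isCompact hK).isBounded hx hzK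
  have h2 := (hM.1 K hK).1
  rw [Metric.mem_closedBall] at hzy ⊢
  calc dist x y ≤ dist x z + dist z y := dist_triangle _ _ _
    _ ≤ (R + ρ⁻¹) * h := by linarith

/-- The number of elements near a point is bounded. -/
lemma exists_card_meeting_le (hd : 0 < d) {ρ : ℝ} (hρ : 0 < ρ) {R : ℝ} (hR : 0 ≤ R) :
    ∃ N : ℕ, 0 < N ∧ ∀ h : ℝ, 0 < h → ∀ M : Mesh d, M.IsQuasiUniform ρ h → ∀ y : Vec d,
      (M.meeting (Metric.closedBall y (R * h))).card ≤ N := by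
  have : Nonempty (Fin d) := ⟨⟨0, hd⟩⟩
  -- Volume packing: the interiors are disjoint, each contains a ball of radius `ρ h`, and all lie
  -- in a ball of radius `(R + ρ⁻¹) h`.
  refine ⟨⌈((R + ρ⁻¹) / ρ) ^ d⌉₊ + 1, by omega, fun h hh M hM y => ?_⟩
  set T := M.meeting (Metric.closedBall y (R * h)) with hT
  set V₁ := volume.real (Metric.ball (0 : Vec d) 1) with hvol
  have hvol0 : 0 < V₁ := ENNReal.toReal_pos (Metric.measure_ball_pos _ _ one_pos).ne'
    measure_ball_lt_top.ne
  have h1 : ∀ K ∈ T, (ρ * h) ^ d * V₁ ≤ volume.real (interior K) := by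
    intro K hK
    have hK' := (Mesh.mem_meeting.mp hK).1
    obtain ⟨x, hx⟩ := (hM.1 K hK').2
    have h2 : Metric.ball x (ρ * h) ⊆ interior K :=
      interior_maximal (Metric.ball_subset_closedBall.trans hx) Metric.isOpen_ball
    have h3 : volume.real (Metric.ball x (ρ * h)) = (ρ * h) ^ d * V₁ := by
      rw [measureReal_def, Measure.addHaar_ball _ _ (by positivity), ENNReal.toReal_mul,
        ENNReal.toReal_ofReal (by positivity), finrank_euclideanSpace_fin]
      rfl
    rw [← h3]
    exact measureReal_mono h2
      ((measure_mono interior_subset).trans_lt (M.isCompact hK').measure_lt_top).ne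
  have h4 : ∑ K ∈ T, volume.real (interior K) ≤ volume.real (Metric.closedBall y ((R + ρ⁻¹) * h)) := by
    rw [← measureReal_biUnion_finset (fun K hK L hL hne => M.disjoint_interior
      (Mesh.mem_meeting.mp hK).1 (Mesh.mem_meeting.mp hL).1 hne)
      (fun K _ => isOpen_interior.measurableSet)
      (fun K hK => ((measure_mono interior_subset).trans_lt
        (M.isCompact (Mesh.mem_meeting.mp hK).1).measure_lt_top).ne)]
    refine measureReal_mono (Set.iUnion₂_subset fun K hK => interior_subset.trans ?_)
      (isCompact_closedBall _ _).measure_lt_top.ne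
    exact hM.subset_closedBall (Mesh.mem_meeting.mp hK).1 (Mesh.mem_meeting.mp hK).2
  have h5 : volume.real (Metric.closedBall y ((R + ρ⁻¹) * h)) = ((R + ρ⁻¹) * h) ^ d * V₁ := by
    rw [measureReal_def, Measure.addHaar_closedBall _ _ (by positivity), ENNReal.toReal_mul,
      ENNReal.toReal_ofReal (by positivity), finrank_euclideanSpace_fin]
    rfl
  have h6 : (T.card : ℝ) * ((ρ * h) ^ d * V₁) ≤ ((R + ρ⁻¹) * h) ^ d * V₁ := by
    rw [← h5, ← nsmul_eq_mul, ← Finset.sum_const]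
    exact (Finset.sum_le_sum h1).trans h4
  have h7 : (T.card : ℝ) ≤ ((R + ρ⁻¹) / ρ) ^ d := by
    rw [div_pow, le_div_iff₀ (by positivity)]
    rw [mul_pow, mul_pow] at h6
    have : (T.card * ρ ^ d) * (h ^ d * V₁) ≤ (R + ρ⁻¹) ^ d * (h ^ d * V₁) := by linarith
    exact le_of_mul_le_mul_right this (by positivity)
  have h8 : T.card ≤ ⌈((R + ρ⁻¹) / ρ) ^ d⌉₊ := by exact_mod_cast h7.trans (Nat.le_ceil _)
  omega

end MeshGeometry

/-! ### Hyperplanes -/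

/-- Isometric coordinates on the hyperplane orthogonal to a unit vector. -/
lemma exists_isometry_orthogonal {d : ℕ} {e : Vec d} (he : ‖e‖ = 1) :
    ∃ A : Vec (d - 1) →ₗᵢ[ℝ] Vec d, (∀ y, ⟪A y, e⟫ = 0) ∧ ∀ w, ∃ y, w = A y + ⟪w, e⟫ • e := by
  have he0 : e ≠ 0 := by
    rintro rfl
    simp at he
  have hd : 0 < d := by
    rcases Nat.eq_zero_or_pos d with rfl | h
    · exact absurd (Subsingleton.elim e 0) he0
    · exact h
  have hfin : Module.finrank ℝ ((ℝ ∙ e)ᗮ : Submodule ℝ (Vec d)) = d - 1 := by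
    have : Fact (Module.finrank ℝ (Vec d) = (d - 1) + 1) :=
      ⟨by rw [finrank_euclideanSpace_fin]; omega⟩
    exact Submodule.finrank_orthogonal_span_singleton he0
  let b := (stdOrthonormalBasis ℝ ((ℝ ∙ e)ᗮ : Submodule ℝ (Vec d))).reindex (finCongr hfin)
  refine ⟨(ℝ ∙ e)ᗮ.subtypeₗᵢ.comp b.repr.symm.toLinearIsometry, fun y => ?_, fun w => ?_⟩
  · have := (b.repr.symm y).2
    rw [Submodule.mem_orthogonal_singleton_iff_inner_left] at this
    exact this
  · have hmem : w - ⟪w, e⟫ • e ∈ (ℝ ∙ e)ᗮ := by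
      rw [Submodule.mem_orthogonal_singleton_iff_inner_left, inner_sub_left, inner_smul_left,
        real_inner_self_eq_norm_sq, he]
      simp
    refine ⟨b.repr ⟨_, hmem⟩, ?_⟩
    simp

/-! ### The uniform cone property -/

/-- Within `B(x, r)`, the set `Ω` is stable under translation by the vectors of a cone of axis `e`. -/
def ConeProp {d : ℕ} (Ω : Set (Vec d)) (x e : Vec d) (r κ : ℝ) : Prop :=
  ∀ y ∈ Ω, y ∈ Metric.ball x r → ∀ z ∈ Metric.ball x r, κ * ‖z - y‖ ≤ ⟪z - y, e⟫ → z ∈ Ω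

/-- The cone property holds at all boundary points, with the same parameters. -/
def UniformCone {d : ℕ} (Ω : Set (Vec d)) (r κ : ℝ) : Prop :=
  0 < r ∧ 0 < κ ∧ κ < 1 ∧ ∀ x ∈ frontier Ω, ∃ e : Vec d, ‖e‖ = 1 ∧ ConeProp Ω x e r κ

section Cone

variable {d : ℕ} {Ω : Set (Vec d)} {x e y z : Vec d} {r κ : ℝ}

lemma ConeProp.mono {x' : Vec d} {r' κ' : ℝ} (h : ConeProp Ω x e r κ)
    (hr : Metric.ball x' r' ⊆ Metric.ball x r) (hκ : κ ≤ κ') : ConeProp Ω x' e r' κ' :=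
  fun y hyΩ hy z hz hle => h y hyΩ (hr hy) z (hr hz)
    ((mul_le_mul_of_nonneg_right hκ (norm_nonneg _)).trans hle)

lemma norm_sub_inner_smul_sq (he : ‖e‖ = 1) (w : Vec d) :
    ‖w - ⟪w, e⟫ • e‖ ^ 2 = ‖w‖ ^ 2 - ⟪w, e⟫ ^ 2 := by
  rw [norm_sub_sq_real, norm_smul, inner_smul_right, he, Real.norm_eq_abs, mul_one, sq_abs]
  ring

/-- The strict epigraph of an `L`-Lipschitz function is stable under steps whose axial part is at
least `L` times the tangential part. With `κ = L' / √(1 + L'²)` the cone condition is the inequality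
`L' ‖w - t e‖ ≤ t`; taking `L' = L + 1` keeps `κ` positive when `L = 0`. -/
lemma HasLipschitzBoundary.exists_coneProp (hΩ : HasLipschitzBoundary Ω) (hx : x ∈ frontier Ω) :
    ∃ (e : Vec d) (r κ : ℝ), ‖e‖ = 1 ∧ 0 < r ∧ 0 < κ ∧ κ < 1 ∧ ConeProp Ω x e r κ := by
  obtain ⟨e, r, L, g, he, hr, hL, hg, H⟩ := hΩ x hx
  set L' : ℝ := L + 1 with hL'
  have hL'0 : 0 < L' := by positivity
  have hs : 0 < √(1 + L' ^ 2) := by positivity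
  refine ⟨e, r, L' / √(1 + L' ^ 2), he, hr, by positivity, ?_, fun y hyΩ hy z hz hle => ?_⟩
  · rw [div_lt_one hs]
    exact Real.lt_sqrt_of_sq_lt (by linarith)
  · set w := z - y with hw
    set t := ⟪w, e⟫ with ht
    have ht0 : 0 ≤ t := le_trans (by positivity) hle
    have h1 : L' * ‖w - t • e‖ ≤ t := by
      have h2 : L' ^ 2 * ‖w‖ ^ 2 ≤ (1 + L' ^ 2) * t ^ 2 := by
        have h3 : (L' / √(1 + L' ^ 2) * ‖w‖) ^ 2 ≤ t ^ 2 := by gcongr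
        rw [mul_pow, div_pow, Real.sq_sqrt (by positivity), div_mul_eq_mul_div,
          div_le_iff₀ (by positivity)] at h3
        linarith
      have h4 : (L' * ‖w - t • e‖) ^ 2 ≤ t ^ 2 := by
        rw [mul_pow, norm_sub_inner_smul_sq he]
        nlinarith
      exact (pow_le_pow_iff_left₀ (by positivity) ht0 two_ne_zero).mp h4
    have h5 : g z = g (y + (w - t • e)) := by
      rw [← hg (y + (w - t • e)) t]
      congr 1
      rw [hw]; abel
    have h6 : g z ≤ g y + L * ‖w - t • e‖ := by
      rw [h5]
      have := hL.dist_le_mul (y + (w - t • e)) y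
      rw [Real.dist_eq, dist_eq_norm, add_sub_cancel_left] at this
      linarith [le_abs_self (g (y + (w - t • e)) - g y)]
    have h7 : L * ‖w - t • e‖ ≤ t := by
      refine le_trans ?_ h1
      gcongr
      simp [hL']
    have h8 := (H y hy).mp hyΩ
    rw [H z hz]
    have h9 : ⟪z, e⟫ = ⟪y, e⟫ + t := by rw [ht, hw, inner_sub_left]; ring
    linarith

lemma isCompact_frontier (hb : Bornology.IsBounded Ω) : IsCompact (frontier Ω) :=
  hb.isCompact_closure.of_isClosed_subset isClosed_frontier frontier_subset_closure

/-- A cone valid on `B(x, r)` is valid on `B(x', r / 2)` for all `x'` within `r / 2` of `x`.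
Compactness of the boundary leaves finitely many pairs, of which the smallest `r` and the largest
`κ` are taken. -/
lemma HasLipschitzBoundary.exists_uniformCone (hΩ : HasLipschitzBoundary Ω)
    (hb : Bornology.IsBounded Ω) : ∃ r κ : ℝ, UniformCone Ω r κ := by
  suffices h : ∃ r κ : ℝ, 0 < r ∧ 0 < κ ∧ κ < 1 ∧
      ∀ x ∈ frontier Ω, ∃ e : Vec d, ‖e‖ = 1 ∧ ConeProp Ω x e r κ from h
  refine (isCompact_frontier hb).induction_on (p := fun s => ∃ r κ : ℝ, 0 < r ∧ 0 < κ ∧ κ < 1 ∧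
      ∀ x ∈ s, ∃ e : Vec d, ‖e‖ = 1 ∧ ConeProp Ω x e r κ) ?_ ?_ ?_ ?_
  · exact ⟨1, 1 / 2, one_pos, by norm_num, by norm_num, by simp⟩
  · rintro s t hst ⟨r, κ, h1, h2, h3, H⟩
    exact ⟨r, κ, h1, h2, h3, fun x hx => H x (hst hx)⟩
  · rintro s t ⟨r, κ, h1, h2, h3, H⟩ ⟨r', κ', h1', h2', h3', H'⟩
    refine ⟨min r r', max κ κ', lt_min h1 h1', lt_max_of_lt_left h2, max_lt h3 h3', fun x hx => ?_⟩
    rcases hx with hx | hx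
    · obtain ⟨e, he, h⟩ := H x hx
      exact ⟨e, he, h.mono (Metric.ball_subset_ball (min_le_left _ _)) (le_max_left _ _)⟩
    · obtain ⟨e, he, h⟩ := H' x hx
      exact ⟨e, he, h.mono (Metric.ball_subset_ball (min_le_right _ _)) (le_max_right _ _)⟩
  · intro x hx
    obtain ⟨e, r, κ, he, h1, h2, h3, h⟩ := hΩ.exists_coneProp hx
    refine ⟨Metric.ball x (r / 2), mem_nhdsWithin_of_mem_nhds (Metric.ball_mem_nhds _ (half_pos h1)),
      r / 2, κ, half_pos h1, h2, h3, fun x' hx' => ⟨e, he, h.mono ?_ le_rfl⟩⟩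
    exact Metric.ball_subset_ball' (by rw [Metric.mem_ball] at hx'; linarith)

/-- The strict inequality is open in `y`, which can therefore be moved into `Ω`. -/
lemma ConeProp.mem_of_mem_closure (h : ConeProp Ω x e r κ) (hy : y ∈ closure Ω)
    (hyx : y ∈ Metric.ball x r) (hz : z ∈ Metric.ball x r) (hlt : κ * ‖z - y‖ < ⟪z - y, e⟫) :
    z ∈ Ω := by
  have hop : IsOpen (Metric.ball x r ∩ {y | κ * ‖z - y‖ < ⟪z - y, e⟫}) :=
    Metric.isOpen_ball.inter (isOpen_lt (by fun_prop) (by fun_prop))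
  obtain ⟨y', ⟨h1, h2⟩, h3⟩ := mem_closure_iff.mp hy _ hop ⟨hyx, hlt⟩
  exact h y' h3 h1 z hz (le_of_lt h2)

lemma ConeProp.notMem_of_mem_frontier (h : ConeProp Ω x e r κ) (hΩ : IsOpen Ω)
    (hz : z ∈ frontier Ω) (hzx : z ∈ Metric.ball x r) (hy : y ∈ Metric.ball x r)
    (hle : κ * ‖z - y‖ ≤ ⟪z - y, e⟫) : y ∉ Ω := by
  intro hyΩ
  rw [hΩ.frontier_eq] at hz
  exact hz.2 (h y hyΩ hy z hzx hle)

/-- No boundary point lies in the open cone at another one, since it would then belong to `Ω`. Hence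
the boundary is locally a Lipschitz graph over the hyperplane orthogonal to `e`. -/
lemma ConeProp.abs_inner_le (h : ConeProp Ω x e r κ) (hΩ : IsOpen Ω) (hy : y ∈ frontier Ω)
    (hyx : y ∈ Metric.ball x r) (hz : z ∈ frontier Ω) (hzx : z ∈ Metric.ball x r) :
    |⟪z - y, e⟫| ≤ κ * ‖z - y‖ := by
  by_contra! hlt
  rcases lt_abs.mp hlt with h1 | h1
  · rw [hΩ.frontier_eq] at hz
    exact hz.2 (h.mem_of_mem_closure (frontier_subset_closure hy) hyx hzx h1)
  · rw [hΩ.frontier_eq] at hy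
    refine hy.2 (h.mem_of_mem_closure (frontier_subset_closure hz) hzx hyx ?_)
    rw [← neg_sub z y, norm_neg, inner_neg_left]
    exact h1

/-- The open truncated cone with apex `a`, axis `e` and height `s`. -/
def truncatedCone (a e : Vec d) (κ s : ℝ) : Set (Vec d) :=
  {z | κ * ‖z - a‖ < ⟪z - a, e⟫} ∩ Metric.ball a s

lemma isOpen_truncatedCone (a e : Vec d) (κ s : ℝ) : IsOpen (truncatedCone a e κ s) :=
  (isOpen_lt (by fun_prop) (by fun_prop)).inter Metric.isOpen_ball

lemma convex_truncatedCone (a e : Vec d) (hκ : 0 < κ) (s : ℝ) :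
    Convex ℝ (truncatedCone a e κ s) := by
  refine Convex.inter ?_ (convex_ball a s)
  intro u hu v hv α β hα hβ hαβ
  have h1 : α • u + β • v - a = α • (u - a) + β • (v - a) := by
    have : a = α • a + β • a := by rw [← add_smul, hαβ, one_smul]
    conv_lhs => rw [this]
    simp only [smul_sub]
    abel
  have hu' : κ * ‖u - a‖ < ⟪u - a, e⟫ := hu
  have hv' : κ * ‖v - a‖ < ⟪v - a, e⟫ := hv
  show κ * ‖α • u + β • v - a‖ < ⟪α • u + β • v - a, e⟫
  rw [h1, inner_add_left, real_inner_smul_left, real_inner_smul_left]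
  have h2 : ‖α • (u - a) + β • (v - a)‖ ≤ α * ‖u - a‖ + β * ‖v - a‖ := by
    refine (norm_add_le _ _).trans ?_
    rw [norm_smul, norm_smul, Real.norm_eq_abs, Real.norm_eq_abs, abs_of_nonneg hα, abs_of_nonneg hβ]
  have h3 := mul_le_mul_of_nonneg_left h2 hκ.le
  rcases hα.eq_or_lt with rfl | hα'
  · have : β = 1 := by linarith
    subst this
    linarith
  · nlinarith [mul_lt_mul_of_pos_left hu' hα', mul_le_mul_of_nonneg_left hv'.le hβ]

lemma ball_subset_truncatedCone (a : Vec d) (he : ‖e‖ = 1) (hκ : 0 < κ) (hκ1 : κ < 1) {s : ℝ}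
    (hs : 0 < s) :
    Metric.ball (a + (s / 2) • e) ((1 - κ) / 8 * s) ⊆ truncatedCone a e κ s := by
  intro z hz
  set w := z - (a + (s / 2) • e) with hw
  have hwn : ‖w‖ < (1 - κ) / 8 * s := by rwa [Metric.mem_ball, dist_eq_norm] at hz
  have hza : z - a = (s / 2) • e + w := by rw [hw]; abel
  have h1 : ‖z - a‖ ≤ s / 2 + ‖w‖ := by
    rw [hza]
    refine (norm_add_le _ _).trans ?_
    rw [norm_smul, he, Real.norm_eq_abs, abs_of_pos (by positivity), mul_one]
  have h2 : s / 2 - ‖w‖ ≤ ⟪z - a, e⟫ := by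
    rw [hza, inner_add_left, real_inner_smul_left, real_inner_self_eq_norm_sq, he]
    have := (abs_le.mp (abs_real_inner_le_norm w e)).1
    rw [he] at this
    linarith
  constructor
  · show κ * ‖z - a‖ < ⟪z - a, e⟫
    have : κ * ‖z - a‖ ≤ κ * (s / 2 + ‖w‖) := by gcongr
    nlinarith [norm_nonneg w]
  · rw [Metric.mem_ball, dist_eq_norm]
    nlinarith [norm_nonneg w]

lemma ConeProp.truncatedCone_subset (h : ConeProp Ω x e r κ) {a : Vec d} (ha : a ∈ closure Ω) {s : ℝ}
    (has : dist a x + s ≤ r) (hs : 0 < s) : truncatedCone a e κ s ⊆ Ω := by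
  intro z hz
  refine h.mem_of_mem_closure ha ?_ ?_ hz.1
  · rw [Metric.mem_ball]; linarith
  · have h1 := hz.2
    rw [Metric.mem_ball] at h1 ⊢
    linarith [dist_triangle z a x]

/-- A convex set that meets both `Ω` and its boundary meets a convex open part of `Ω` which has a
size proportional to `h`. -/
lemma UniformCone.exists_convex_subset (hU : UniformCone Ω r κ) (hΩ : IsOpen Ω) {h₀ : ℝ}
    (hh₀ : 0 < h₀) : ∃ c : ℝ, 0 < c ∧ ∀ h : ℝ, 0 < h → h ≤ h₀ → ∀ K : Set (Vec d), Convex ℝ K →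
      (K ∩ Ω).Nonempty → (K ∩ frontier Ω).Nonempty →
      ∃ (y z : Vec d) (U : Set (Vec d)), y ∈ K ∧ y ∈ U ∧ IsOpen U ∧ Convex ℝ U ∧ U ⊆ Ω ∧
        U ⊆ Metric.closedBall y (2 * h) ∧ Metric.ball z (c * h) ⊆ U := by
  obtain ⟨hr, hκ, hκ1, H⟩ := hU
  -- The height `s = τ h` of the cone is at most `r / 4` for all `h ≤ h₀`, so the cone stays where
  -- the cone property holds even if `h₀` is large compared with `r`.
  set τ := min 1 (r / (4 * h₀)) with hτ
  have hτ0 : 0 < τ := lt_min one_pos (by positivity)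
  refine ⟨(1 - κ) / 8 * τ, by have := sub_pos.mpr hκ1; positivity, fun h hh hhh₀ K hK hKΩ hKf => ?_⟩
  set s := τ * h with hs
  have hs0 : 0 < s := by positivity
  have hsh : s ≤ h := mul_le_of_le_one_left hh.le (min_le_left _ _)
  have hsr : s ≤ r / 4 := by
    calc s ≤ r / (4 * h₀) * h₀ := by
          rw [hs]
          gcongr
          exact min_le_right _ _
      _ = r / 4 := by field_simp
  -- `K` is connected and meets both `Ω` and `∂Ω`. It is covered by `Ω` and the open set `V` formed
  -- by the exterior and a neighbourhood of `K ∩ ∂Ω`, so these two overlap in `K`.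
  obtain ⟨y, hyK, hyΩ, x, ⟨hxK, hxf⟩, hyx⟩ : ∃ y ∈ K, y ∈ Ω ∧ ∃ x ∈ K ∩ frontier Ω,
      dist y x < r / 4 := by
    let V : Set (Vec d) := (⋃ x ∈ K ∩ frontier Ω, Metric.ball x (r / 4)) ∪ (closure Ω)ᶜ
    have hV : IsOpen V := (isOpen_biUnion fun _ _ => Metric.isOpen_ball).union
      isClosed_closure.isOpen_compl
    obtain ⟨x₀, hx₀K, hx₀⟩ := hKf
    obtain ⟨y, hyK, hyΩ, hyV⟩ := hK.isPreconnected Ω V hΩ hV (fun y hy => by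
      by_cases h1 : y ∈ Ω
      · exact Or.inl h1
      · refine Or.inr ?_
        by_cases h2 : y ∈ closure Ω
        · exact Or.inl (Set.mem_biUnion (⟨hy, by rw [hΩ.frontier_eq]; exact ⟨h2, h1⟩⟩ :
            y ∈ K ∩ frontier Ω) (Metric.mem_ball_self (by positivity)))
        · exact Or.inr h2) hKΩ
      ⟨x₀, hx₀K, Or.inl (Set.mem_biUnion (⟨hx₀K, hx₀⟩ : x₀ ∈ K ∩ frontier Ω)
        (Metric.mem_ball_self (by positivity)))⟩
    rcases hyV with hyV | hyV
    · obtain ⟨x, hx, hyx⟩ := Set.mem_iUnion₂.mp hyV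
      exact ⟨y, hyK, hyΩ, x, hx, hyx⟩
    · exact absurd (subset_closure hyΩ) hyV
  obtain ⟨e, he, hc⟩ := H x hxf
  obtain ⟨δ₀, hδ₀, hball⟩ := Metric.isOpen_iff.mp hΩ y hyΩ
  set δ := min (s / 2) (δ₀ / 2) with hδ
  have hδ0 : 0 < δ := lt_min (by positivity) (by positivity)
  have hδs : δ ≤ s / 2 := min_le_left _ _
  have hδδ : δ ≤ δ₀ / 2 := min_le_right _ _
  -- The apex is pulled back slightly inside `Ω`, so that `y` itself belongs to the open cone.
  set a := y - δ • e with ha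
  have hay : dist a y = δ := by
    rw [dist_eq_norm, ha, sub_sub_cancel_left, norm_neg, norm_smul, he, Real.norm_eq_abs,
      abs_of_pos hδ0, mul_one]
  have haΩ : a ∈ Ω := hball (by rw [Metric.mem_ball, hay]; linarith)
  refine ⟨y, a + (s / 2) • e, truncatedCone a e κ s, hyK, ⟨?_, ?_⟩, isOpen_truncatedCone _ _ _ _,
    convex_truncatedCone _ _ hκ _, hc.truncatedCone_subset (subset_closure haΩ) ?_ hs0, ?_, ?_⟩
  · show κ * ‖y - a‖ < ⟪y - a, e⟫
    rw [ha, sub_sub_cancel, norm_smul, he, real_inner_smul_left, real_inner_self_eq_norm_sq, he,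
      Real.norm_eq_abs, abs_of_pos hδ0]
    nlinarith
  · rw [Metric.mem_ball, dist_comm, hay]; linarith
  · linarith [dist_triangle a y x]
  · intro z hz
    have h1 := hz.2
    rw [Metric.mem_ball] at h1
    rw [Metric.mem_closedBall]
    linarith [dist_triangle z a y]
  · rw [mul_assoc]
    exact ball_subset_truncatedCone a he hκ hκ1 hs0

/-! ### The surface measure of the boundary -/

/-- On `S` the map `f` has a `c`-Lipschitz inverse, and Hausdorff measure in dimension `k` grows by
at most `c ^ k` under it. -/
lemma euclideanHausdorffMeasure_le_of_antilipschitz {k : ℕ} {S : Set (Vec d)} {f : Vec d → Vec k}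
    {c : NNReal} (hf : ∀ y ∈ S, ∀ z ∈ S, dist y z ≤ c * dist (f y) (f z)) :
    (μHE[k] : Measure (Vec d)) S ≤ (c : ENNReal) ^ k * volume (f '' S) := by
  have hanti : AntilipschitzWith c (fun y : S => f y) :=
    AntilipschitzWith.of_le_mul_dist fun y z => hf y y.2 z z.2
  have h1 := hanti.hausdorffMeasure_preimage_le (d := (k : ℝ)) (by positivity) (f '' S)
  have h2 : (fun y : S => f y) ⁻¹' (f '' S) = Set.univ :=
    Set.eq_univ_of_forall fun y => ⟨y, y.2, rfl⟩
  rw [h2, ← (isometry_subtype_coe (s := S)).hausdorffMeasure_image (Or.inl (by positivity)),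
    Set.image_univ, Subtype.range_coe, ENNReal.rpow_natCast] at h1
  rw [← EuclideanSpace.euclideanHausdorffMeasure_eq_volume, Measure.euclideanHausdorffMeasure_def,
    Measure.euclideanHausdorffMeasure_def, Measure.smul_apply, Measure.smul_apply, mul_smul_comm]
  gcongr

/-- Boundary points satisfy `|⟪y - z, e⟫| ≤ κ ‖y - z‖`, so orthogonal projection along the cone axis
shrinks distances by at most `√(1 - κ²)`. The projection of the boundary in a ball of radius `s`
lies in a `(d-1)`-dimensional ball of radius `s`. -/
lemma UniformCone.surface_ball_le (hU : UniformCone Ω r κ) (hΩ : IsOpen Ω) :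
    ∃ C : ℝ, 0 < C ∧ ∀ x ∈ frontier Ω, ∀ s : ℝ, 0 < s → s ≤ r →
      (μHE[d - 1] : Measure (Vec d)) (frontier Ω ∩ Metric.ball x s) ≤
        ENNReal.ofReal (C * s ^ (d - 1)) := by
  obtain ⟨hr, hκ, hκ1, H⟩ := hU
  have hκ2 : 0 < 1 - κ ^ 2 := by nlinarith
  set c : NNReal := Real.toNNReal (√(1 - κ ^ 2))⁻¹ with hc
  have hcr : (c : ℝ) = (√(1 - κ ^ 2))⁻¹ := Real.coe_toNNReal _ (by positivity)
  have hcpos : 0 < (c : ℝ) := by rw [hcr]; positivity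
  set V₁ := volume.real (Metric.ball (0 : Vec (d - 1)) 1) with hV₁
  have hV₁0 : 0 < V₁ := ENNReal.toReal_pos (Metric.measure_ball_pos _ _ one_pos).ne'
    measure_ball_lt_top.ne
  refine ⟨c ^ (d - 1) * V₁, by positivity, fun x hx s hs hsr => ?_⟩
  obtain ⟨e, he, hcone⟩ := H x hx
  obtain ⟨A, hA, hdec⟩ := exists_isometry_orthogonal he
  choose f hf using hdec
  have hdist : ∀ y z, dist (f y) (f z) ^ 2 = ‖y - z‖ ^ 2 - ⟪y - z, e⟫ ^ 2 := by
    intro y z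
    rw [← norm_sub_inner_smul_sq he, ← A.dist_map, dist_eq_norm]
    congr 2
    have h1 : A (f y) = y - ⟪y, e⟫ • e := eq_sub_of_add_eq (hf y).symm
    have h2 : A (f z) = z - ⟪z, e⟫ • e := eq_sub_of_add_eq (hf z).symm
    rw [h1, h2, inner_sub_left, sub_smul]
    abel
  have hball : f '' (frontier Ω ∩ Metric.ball x s) ⊆ Metric.ball (f x) s := by
    rintro _ ⟨y, ⟨-, hy⟩, rfl⟩
    rw [Metric.mem_ball, dist_eq_norm] at hy
    rw [Metric.mem_ball]
    refine lt_of_le_of_lt ?_ hy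
    refine (pow_le_pow_iff_left₀ dist_nonneg (norm_nonneg _) two_ne_zero).mp ?_
    rw [hdist]
    nlinarith [sq_nonneg ⟪y - x, e⟫]
  have hanti : ∀ y ∈ frontier Ω ∩ Metric.ball x s, ∀ z ∈ frontier Ω ∩ Metric.ball x s,
      dist y z ≤ c * dist (f y) (f z) := by
    rintro y ⟨hyf, hyb⟩ z ⟨hzf, hzb⟩
    have h1 := hcone.abs_inner_le hΩ hzf (Metric.ball_subset_ball hsr hzb) hyf
      (Metric.ball_subset_ball hsr hyb)
    have h2 : ⟪y - z, e⟫ ^ 2 ≤ κ ^ 2 * ‖y - z‖ ^ 2 := by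
      rw [← sq_abs, ← mul_pow]
      gcongr
    refine (pow_le_pow_iff_left₀ dist_nonneg (by positivity) two_ne_zero).mp ?_
    rw [mul_pow, hdist, hcr, inv_pow, Real.sq_sqrt hκ2.le, dist_eq_norm, inv_mul_eq_div,
      le_div_iff₀ hκ2]
    linarith
  refine (euclideanHausdorffMeasure_le_of_antilipschitz hanti).trans ?_
  rw [mul_assoc, ENNReal.ofReal_mul (by positivity), ENNReal.ofReal_pow hcpos.le,
    ENNReal.ofReal_coe_nnreal]
  gcongr
  refine (measure_mono hball).trans ?_
  rw [Measure.addHaar_ball_of_pos _ _ hs, finrank_euclideanSpace_fin, mul_comm V₁,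
    ENNReal.ofReal_mul (by positivity), hV₁, measureReal_def,
    ENNReal.ofReal_toReal measure_ball_lt_top.ne]

/-- The boundary of a bounded Lipschitz domain has finite surface measure, and the surface measure of its
part in a ball is at most proportional to the `(d-1)`-st power of the radius. -/
lemma UniformCone.surface_le (hU : UniformCone Ω r κ) (hΩ : IsOpen Ω)
    (hb : Bornology.IsBounded Ω) : ∃ C : ℝ, 0 < C ∧ ∀ x ∈ frontier Ω, ∀ s : ℝ, 0 < s →
      (μHE[d - 1] : Measure (Vec d)) (frontier Ω ∩ Metric.ball x s) ≤
        ENNReal.ofReal (C * s ^ (d - 1)) := by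
  obtain ⟨C, hC, H⟩ := hU.surface_ball_le hΩ
  have hr := hU.1
  -- For radii above `r` a fixed finite cover by balls of radius `r` suffices, because `r ^ (d - 1)
  -- ≤ s ^ (d - 1)`.
  obtain ⟨t, ht, hcov⟩ := (isCompact_frontier hb).elim_nhds_subcover (fun x => Metric.ball x r)
    fun x _ => Metric.ball_mem_nhds x hr
  refine ⟨(t.card + 1) * C, by positivity, fun x hx s hs => ?_⟩
  rcases le_or_gt s r with hsr | hsr
  · refine (H x hx s hs hsr).trans (ENNReal.ofReal_le_ofReal ?_)
    have : 0 ≤ (t.card : ℝ) * (C * s ^ (d - 1)) := by positivity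
    linarith
  · calc (μHE[d - 1] : Measure (Vec d)) (frontier Ω ∩ Metric.ball x s)
        ≤ (μHE[d - 1] : Measure (Vec d)) (⋃ y ∈ t, frontier Ω ∩ Metric.ball y r) := by
          refine measure_mono fun z hz => ?_
          obtain ⟨y, hy, hzy⟩ := Set.mem_iUnion₂.mp (hcov hz.1)
          exact Set.mem_biUnion hy ⟨hz.1, hzy⟩
      _ ≤ ∑ y ∈ t, (μHE[d - 1] : Measure (Vec d)) (frontier Ω ∩ Metric.ball y r) :=
          measure_biUnion_finset_le _ _
      _ ≤ ∑ y ∈ t, ENNReal.ofReal (C * r ^ (d - 1)) :=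
          Finset.sum_le_sum fun y hy => H y (ht y hy) r hr le_rfl
      _ = ENNReal.ofReal (t.card * (C * r ^ (d - 1))) := by
          rw [Finset.sum_const, nsmul_eq_mul, ← ENNReal.ofReal_natCast,
            ← ENNReal.ofReal_mul (by positivity)]
      _ ≤ ENNReal.ofReal ((t.card + 1) * C * s ^ (d - 1)) := by
          apply ENNReal.ofReal_le_ofReal
          have h1 : r ^ (d - 1) ≤ s ^ (d - 1) := by gcongr
          have h2 : (t.card : ℝ) * (C * r ^ (d - 1)) ≤ t.card * (C * s ^ (d - 1)) := by gcongr
          have h3 : 0 ≤ C * s ^ (d - 1) := by positivity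
          linarith

lemma UniformCone.surface_frontier_lt_top (hU : UniformCone Ω r κ) (hΩ : IsOpen Ω)
    (hb : Bornology.IsBounded Ω) : (μHE[d - 1] : Measure (Vec d)) (frontier Ω) < ⊤ := by
  obtain ⟨C, hC, H⟩ := hU.surface_le hΩ hb
  rcases (frontier Ω).eq_empty_or_nonempty with h | ⟨x, hx⟩
  · simp [h]
  obtain ⟨s, hs⟩ := (isCompact_frontier hb).isBounded.subset_ball x
  have h1 := H x hx (max s 1) (lt_max_of_lt_right one_pos)
  rw [Set.inter_eq_left.mpr (hs.trans (Metric.ball_subset_ball (le_max_left _ _)))] at h1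
  exact h1.trans_lt ENNReal.ofReal_lt_top

end Cone

/-! ### Polynomial fields -/

section PolyField

variable {d p : ℕ} {q : Vec d → Vec d}

/-- A vector field with polynomial components of degree at most `p`. -/
def PolyField (p : ℕ) (q : Vec d → Vec d) : Prop := ∀ i, PolyFun p (fun x => q x i)

lemma PolyField.contDiff (hq : PolyField p q) : ContDiff ℝ ∞ q :=
  contDiff_euclidean.mpr fun i => (hq i).contDiff

lemma PolyField.continuous (hq : PolyField p q) : Continuous q := hq.contDiff.continuous

lemma dirDeriv_apply {q : Vec d → Vec d} (hq : Differentiable ℝ q) (n x : Vec d) (i : Fin d) :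
    dirDeriv n q x i = dirDeriv n (fun y => q y i) x := by
  have h := (EuclideanSpace.proj i : Vec d →L[ℝ] ℝ).hasFDerivAt.comp x (hq x).hasFDerivAt
  have h2 : fderiv ℝ (fun y => q y i) x = _ := h.fderiv
  rw [dirDeriv, dirDeriv, h2]
  rfl

lemma PolyField.dirDeriv (hq : PolyField p q) (n : Vec d) : PolyField p (dirDeriv n q) := by
  intro i
  have h : (fun x => CutFEM.dirDeriv n q x i) = CutFEM.dirDeriv n (fun x => q x i) :=
    funext fun x => dirDeriv_apply (hq.contDiff.differentiable (by simp)) n x i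
  rw [h]
  exact (hq i).dirDeriv n

lemma PolyField.iterate_dirDeriv (hq : PolyField p q) (n : Vec d) (l : ℕ) :
    PolyField p ((CutFEM.dirDeriv n)^[l] q) := by
  induction l generalizing q with
  | zero => exact hq
  | succ l ih => exact ih (hq.dirDeriv n)

lemma PolyField.iterate_dirDeriv_apply (hq : PolyField p q) (n x : Vec d) (l : ℕ) (i : Fin d) :
    (CutFEM.dirDeriv n)^[l] q x i = (CutFEM.dirDeriv n)^[l] (fun y => q y i) x := by
  induction l generalizing q with
  | zero => rfl
  | succ l ih =>
    rw [Function.iterate_succ_apply, ih (hq.dirDeriv n), Function.iterate_succ_apply]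
    have h : (fun y => CutFEM.dirDeriv n q y i) = CutFEM.dirDeriv n (fun y => q y i) :=
      funext fun y => dirDeriv_apply (hq.contDiff.differentiable (by simp)) n y i
    rw [h]

end PolyField

/-! ### Weak derivatives of smooth fields -/

lemma contDiff_dirDeriv {d : ℕ} {F : Type*} [NormedAddCommGroup F] [NormedSpace ℝ F]
    {q : Vec d → F} (hq : ContDiff ℝ ∞ q) (n : Vec d) : ContDiff ℝ ∞ (dirDeriv n q) :=
  (hq.fderiv_right (by simp)).clm_apply contDiff_const

lemma iteratedFDeriv_succ_apply_const {d l : ℕ} {φ : Vec d → ℝ} (hφ : ContDiff ℝ ∞ φ)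
    (n x : Vec d) : iteratedFDeriv ℝ (l + 1) φ x (fun _ => n) =
      fderiv ℝ (fun y => iteratedFDeriv ℝ l φ y (fun _ => n)) x n := by
  have hd : DifferentiableAt ℝ (iteratedFDeriv ℝ l φ) x :=
    (hφ.differentiable_iteratedFDeriv (by exact_mod_cast WithTop.coe_lt_top _)) x
  rw [iteratedFDeriv_succ_apply_left]
  have h := (ContinuousMultilinearMap.apply ℝ (fun _ : Fin l => Vec d) ℝ (fun _ => n)).hasFDerivAt.comp
    x hd.hasFDerivAt
  have h2 : fderiv ℝ (fun y => iteratedFDeriv ℝ l φ y (fun _ => n)) x = _ := h.fderiv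
  rw [h2]
  rfl

/-- Integration by parts moves one derivative at a time from `φ` to `q`; the compact support of `φ`
removes boundary terms. -/
lemma integral_iteratedFDeriv_smul {d : ℕ} {q : Vec d → Vec d} (hq : ContDiff ℝ ∞ q) (n : Vec d)
    (l : ℕ) {φ : Vec d → ℝ} (hφ : ContDiff ℝ ∞ φ) (hc : HasCompactSupport φ) :
    ∫ x, iteratedFDeriv ℝ l φ x (fun _ => n) • q x =
      (-1 : ℝ) ^ l • ∫ x, φ x • (dirDeriv n)^[l] q x := by
  induction l generalizing q with
  | zero => simp
  | succ l ih =>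
    set f : Vec d → ℝ := fun x => iteratedFDeriv ℝ l φ x (fun _ => n) with hf
    have hfs : ContDiff ℝ ∞ f := contDiff_iteratedFDeriv_apply hφ l n
    have hfc : HasCompactSupport f := hasCompactSupport_iteratedFDeriv_apply hc l n
    have hq' := contDiff_dirDeriv hq n
    have hf' : Continuous fun x => fderiv ℝ f x n := (contDiff_dirDeriv hfs n).continuous
    have h1 := integral_smul_fderiv_eq_neg_fderiv_smul_of_integrable (μ := volume) (f := f) (g := q)
      (v := n) ((hf'.smul hq.continuous).integrable_of_hasCompactSupport
        ((hfc.fderiv_apply (𝕜 := ℝ) n).smul_right))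
      ((hfs.continuous.smul hq'.continuous).integrable_of_hasCompactSupport hfc.smul_right)
      ((hfs.continuous.smul hq.continuous).integrable_of_hasCompactSupport hfc.smul_right)
      (fun x _ => hfs.differentiable (by simp) x) (fun x _ => hq.differentiable (by simp) x)
    simp only [iteratedFDeriv_succ_apply_const hφ]
    rw [Function.iterate_succ_apply, pow_succ, mul_comm, mul_smul, ← ih hq', neg_one_smul]
    rw [show (∫ x, f x • dirDeriv n q x) = _ from h1, neg_neg]

lemma hasWeakDeriv_of_contDiff {d : ℕ} {U : Set (Vec d)} {q : Vec d → Vec d}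
    (hq : ContDiff ℝ ∞ q) (n : Vec d) (l : ℕ) : HasWeakDeriv U n l q ((dirDeriv n)^[l] q) := by
  have hit : ContDiff ℝ ∞ ((dirDeriv n)^[l] q) := by
    induction l generalizing q with
    | zero => exact hq
    | succ l ih => exact ih (contDiff_dirDeriv hq n)
  refine ⟨hq.continuous.locallyIntegrable.locallyIntegrableOn _,
    hit.continuous.locallyIntegrable.locallyIntegrableOn _, fun φ h1 h2 h3 => ?_⟩
  rw [setIntegral_smul_eq_integral h3,
    setIntegral_smul_eq_integral ((tsupport_iteratedFDeriv_apply_subset φ l n).trans h3)]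
  exact integral_iteratedFDeriv_smul hq n l h1 h2

/-! ### Piecewise polynomial fields -/

/-- The field `v` is continuous on the active mesh and coincides with `P K` on each active element. -/
structure IsPiecewise {d : ℕ} (p : ℕ) (Ω : Set (Vec d)) (M : Mesh d) (v : Vec d → Vec d)
    (P : Set (Vec d) → Vec d → Vec d) : Prop where
  poly : ∀ K, PolyField p (P K)
  eqOn : ∀ K ∈ M.elements, IsActive Ω K → Set.EqOn v (P K) K
  continuousOn : ContinuousOn v (activeDomain Ω M)

section Piecewise

variable {d p : ℕ} {Ω : Set (Vec d)} {M : Mesh d} {v : Vec d → Vec d}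
  {P : Set (Vec d) → Vec d → Vec d} {K : Set (Vec d)}

lemma exists_isPiecewise (hv : v ∈ feSpace p Ω M) : ∃ P, IsPiecewise p Ω M v P := by
  classical
  obtain ⟨v₀, ⟨hc, hp⟩, heq⟩ := hv
  choose! Q hQ using hp
  refine ⟨fun K => if K ∈ M.elements then
    fun x => WithLp.toLp 2 fun i => MvPolynomial.eval (fun j => x j) (Q K i) else 0, ?_, ?_, ?_⟩
  · intro K i
    by_cases hK : K ∈ M.elements
    · simp only [hK, if_true]
      exact ⟨Q K i, (hQ K hK i).1, fun _ => rfl⟩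
    · simp only [hK, if_false]
      exact PolyFun.const 0
  · intro K hK hKa x hx
    simp only [hK, if_true]
    rw [heq (Set.mem_biUnion (⟨hK, hKa⟩ : K ∈ {K | K ∈ M.elements ∧ IsActive Ω K}) hx)]
    ext i
    exact (hQ K hK i).2 x hx
  · refine (hc.mono fun x hx => ?_).congr heq
    obtain ⟨K, hK, hxK⟩ := Set.mem_iUnion₂.mp hx
    exact Set.mem_biUnion hK.1 hxK

lemma subset_activeDomain (hcov : Ω ⊆ M.domain) : Ω ⊆ activeDomain Ω M := by
  intro x hx
  obtain ⟨K, hK, hxK⟩ := Set.mem_iUnion₂.mp (hcov hx)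
  exact Set.mem_biUnion (⟨hK, x, hxK, hx⟩ : K ∈ {K | K ∈ M.elements ∧ IsActive Ω K}) hxK

lemma isClosed_activeDomain (Ω : Set (Vec d)) (M : Mesh d) : IsClosed (activeDomain Ω M) :=
  Set.Finite.isClosed_biUnion (M.elements.finite_toSet.subset fun _ h => h.1)
    fun _ hK => M.isClosed hK.1

lemma closure_subset_activeDomain (hcov : Ω ⊆ M.domain) : closure Ω ⊆ activeDomain Ω M :=
  closure_minimal (subset_activeDomain hcov) (isClosed_activeDomain Ω M)

/-- The piecewise derivative in the direction `n`. -/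
def pwDeriv (M : Mesh d) (P : Set (Vec d) → Vec d → Vec d) (n : Vec d) (x : Vec d) : Vec d :=
  ∑ K ∈ M.elements, (interior K).indicator (dirDeriv n (P K)) x

lemma pwDeriv_of_mem_interior (hK : K ∈ M.elements) {x : Vec d} (hx : x ∈ interior K) (n : Vec d) :
    pwDeriv M P n x = dirDeriv n (P K) x := by
  rw [pwDeriv, Finset.sum_eq_single_of_mem K hK, Set.indicator_of_mem hx]
  intro L hL hne
  exact Set.indicator_of_notMem (fun h => hne (M.eq_of_mem_interior hL hK h hx)) _

lemma ae_exists_mem_interior (hcov : Ω ⊆ M.domain) :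
    ∀ᵐ x : Vec d, x ∈ Ω → ∃ K ∈ M.elements, x ∈ interior K := by
  have h : ∀ᵐ x : Vec d, ∀ K ∈ M.elements, x ∉ frontier K := by
    rw [Filter.eventually_all_finset]
    intro K hK
    exact measure_eq_zero_iff_ae_notMem.mp ((M.convex hK).addHaar_frontier volume)
  filter_upwards [h] with x hx hxΩ
  obtain ⟨K, hK, hxK⟩ := Set.mem_iUnion₂.mp (hcov hxΩ)
  refine ⟨K, hK, ?_⟩
  by_contra hni
  exact hx K hK ⟨subset_closure hxK, hni⟩

lemma exists_bound_pwDeriv (hP : IsPiecewise p Ω M v P) (n : Vec d) :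
    ∃ B : ℝ, 0 ≤ B ∧ ∀ K ∈ M.elements, ∀ x ∈ K, ‖dirDeriv n (P K) x‖ ≤ B := by
  have h : ∀ K ∈ M.elements, ∃ B : ℝ, ∀ x ∈ K, ‖dirDeriv n (P K) x‖ ≤ B := fun K hK =>
    (M.isCompact hK).exists_bound_of_continuousOn ((hP.poly K).dirDeriv n).continuous.continuousOn
  choose! B hB using h
  refine ⟨∑ K ∈ M.elements, |B K|, Finset.sum_nonneg fun _ _ => abs_nonneg _, fun K hK x hx => ?_⟩
  exact ((hB K hK x hx).trans (le_abs_self _)).trans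
    (Finset.single_le_sum (f := fun K => |B K|) (fun _ _ => abs_nonneg _) hK)

lemma stronglyMeasurable_pwDeriv (hP : IsPiecewise p Ω M v P) (n : Vec d) :
    StronglyMeasurable (pwDeriv M P n) :=
  Finset.stronglyMeasurable_fun_sum _ fun K _ =>
    (((hP.poly K).dirDeriv n).continuous.stronglyMeasurable).indicator isOpen_interior.measurableSet

lemma exists_bound_norm_pwDeriv (hP : IsPiecewise p Ω M v P) (n : Vec d) :
    ∃ B : ℝ, 0 ≤ B ∧ ∀ x, ‖pwDeriv M P n x‖ ≤ B := by
  obtain ⟨B, hB0, hB⟩ := exists_bound_pwDeriv hP n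
  refine ⟨B, hB0, fun x => ?_⟩
  by_cases h : ∃ K ∈ M.elements, x ∈ interior K
  · obtain ⟨K, hK, hx⟩ := h
    rw [pwDeriv_of_mem_interior hK hx]
    exact hB K hK x (interior_subset hx)
  · push Not at h
    rw [pwDeriv, Finset.sum_eq_zero fun K hK => Set.indicator_of_notMem (h K hK) _, norm_zero]
    exact hB0

/-! ### Lipschitz regularity and weak gradient of finite element fields -/

/-- A continuous function which is Lipschitz on each of finitely many closed sets covering a segment is
Lipschitz along the segment. -/
lemma norm_sub_le_of_segment_covered {E F : Type*} [NormedAddCommGroup E] [NormedSpace ℝ E]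
    [NormedAddCommGroup F] [NormedSpace ℝ F] {f : E → F} {a b : E} {S : Finset (Set E)} {L : ℝ}
    (hL : 0 ≤ L) (hf : ContinuousOn f (segment ℝ a b)) (hS : ∀ K ∈ S, IsClosed K)
    (hcov : segment ℝ a b ⊆ ⋃ K ∈ S, K)
    (hLip : ∀ K ∈ S, ∀ x ∈ K ∩ segment ℝ a b, ∀ y ∈ K ∩ segment ℝ a b,
      ‖f x - f y‖ ≤ L * ‖x - y‖) :
    ‖f b - f a‖ ≤ L * ‖b - a‖ := by
  let γ : ℝ → E := AffineMap.lineMap a b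
  have hγ : Continuous γ := AffineMap.lineMap_continuous
  have hγs : ∀ t ∈ Set.Icc (0 : ℝ) 1, γ t ∈ segment ℝ a b := fun t ht => by
    rw [segment_eq_image_lineMap]
    exact ⟨t, ht, rfl⟩
  have hγd : ∀ s t : ℝ, ‖γ s - γ t‖ = |s - t| * ‖b - a‖ := by
    intro s t
    have : γ s - γ t = (s - t) • (b - a) := by
      simp only [γ, AffineMap.lineMap_apply, vsub_eq_sub, vadd_eq_add, sub_smul]
      abel
    rw [this, norm_smul, Real.norm_eq_abs]
  set C := L * ‖b - a‖ with hC
  have hC0 : 0 ≤ C := by positivity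
  -- A mean value inequality that needs small slopes only along some points tending to `t` from the
  -- right. This fits a segment that may switch between sets infinitely often.
  have key := image_le_of_liminf_slope_right_le_deriv_boundary
    (f := fun t => ‖f (γ t) - f a‖) (a := 0) (b := 1) (B := fun t => C * t) (B' := fun _ => C)
    (((hf.comp hγ.continuousOn hγs).sub continuousOn_const).norm) (by simp [γ])
    (by fun_prop) (fun t _ => by simpa using ((hasDerivAt_id t).const_mul C).hasDerivWithinAt)
    (fun t ht r hr => by
      have hIoo : ∀ᶠ z in 𝓝[>] t, z ∈ Set.Ioo t 1 := Ioo_mem_nhdsGT ht.2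
      -- There are finitely many sets, so one of them is visited arbitrarily close to `t` on the
      -- right; being closed, it also contains `γ t`.
      obtain ⟨K, hK, hfr⟩ : ∃ K ∈ S, ∃ᶠ z in 𝓝[>] t, γ z ∈ K := by
        by_contra! hcon
        have h1 : ∀ᶠ z in 𝓝[>] t, ∀ K ∈ S, γ z ∉ K :=
          (Filter.eventually_all_finset S).mpr fun K hK => hcon K hK
        obtain ⟨z, hz, hzI⟩ := (h1.and hIoo).exists
        obtain ⟨K, hK, hzK⟩ := Set.mem_iUnion₂.mp
          (hcov (hγs z ⟨ht.1.trans hzI.1.le, hzI.2.le⟩))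
        exact hz K hK hzK
      have htK : γ t ∈ K := by
        refine (hS K hK).mem_of_frequently_of_tendsto hfr ?_
        exact (hγ.tendsto t).mono_left nhdsWithin_le_nhds
      refine (hfr.and_eventually hIoo).mono fun z ⟨hzK, hzI⟩ => ?_
      have hzt : 0 < z - t := sub_pos.mpr hzI.1
      have h1 := hLip K hK (γ z) ⟨hzK, hγs z ⟨ht.1.trans hzI.1.le, hzI.2.le⟩⟩ (γ t)
        ⟨htK, hγs t ⟨ht.1, ht.2.le⟩⟩
      have h2 := norm_sub_norm_le (f (γ z) - f a) (f (γ t) - f a)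
      rw [sub_sub_sub_cancel_right] at h2
      rw [hγd, abs_of_pos hzt] at h1
      refine lt_of_le_of_lt ?_ hr
      rw [slope_def_field, div_le_iff₀ hzt]
      calc _ ≤ _ := h2
        _ ≤ _ := h1
        _ = C * (z - t) := by rw [hC]; ring)
  have h1 := key (Set.right_mem_Icc.mpr zero_le_one)
  simpa [γ] using h1

lemma exists_lipschitz_on_elements (hP : IsPiecewise p Ω M v P) :
    ∃ L : ℝ, 0 ≤ L ∧ ∀ K ∈ M.elements, ∀ x ∈ K, ∀ y ∈ K, ‖P K x - P K y‖ ≤ L * ‖x - y‖ := by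
  have h : ∀ K ∈ M.elements, ∃ L : ℝ, ∀ x ∈ K, ‖fderiv ℝ (P K) x‖ ≤ L := fun K hK =>
    (M.isCompact hK).exists_bound_of_continuousOn
      ((hP.poly K).contDiff.continuous_fderiv (by simp)).continuousOn
  choose! L hL using h
  refine ⟨∑ K ∈ M.elements, |L K|, Finset.sum_nonneg fun _ _ => abs_nonneg _,
    fun K hK x hx y hy => ?_⟩
  refine (M.convex hK).norm_image_sub_le_of_norm_fderiv_le
    (fun z _ => (hP.poly K).contDiff.differentiable (by simp) z) (fun z hz => ?_) hy hx
  exact ((hL K hK z hz).trans (le_abs_self _)).trans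
    (Finset.single_le_sum (f := fun K => |L K|) (fun _ _ => abs_nonneg _) hK)

/-- An element met by a segment in `Ω` is active, so `v` is given there by its polynomial. The
constant depends on the field, but only qualitative regularity is needed. -/
lemma exists_lipschitz_on_segments (hP : IsPiecewise p Ω M v P) (hcov : Ω ⊆ M.domain) :
    ∃ L : ℝ, 0 ≤ L ∧ ∀ x y : Vec d, segment ℝ x y ⊆ Ω → ‖v y - v x‖ ≤ L * ‖y - x‖ := by
  classical
  obtain ⟨L, hL0, hL⟩ := exists_lipschitz_on_elements hP
  refine ⟨L, hL0, fun x y hxy => ?_⟩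
  refine norm_sub_le_of_segment_covered (S := M.elements) hL0
    (hP.continuousOn.mono (hxy.trans (subset_activeDomain hcov))) (fun K hK => M.isClosed hK)
    (hxy.trans hcov) fun K hK z hz w hw => ?_
  have hKa : IsActive Ω K := ⟨z, hz.1, hxy hz.2⟩
  rw [hP.eqOn K hK hKa hz.1, hP.eqOn K hK hKa hw.1]
  exact hL K hK z hz.1 w hw.1

/-- On compact subsets of `Ω`, the field `v` coincides with a Lipschitz function. -/
lemma exists_lipschitz_extension (hP : IsPiecewise p Ω M v P) (hcov : Ω ⊆ M.domain)
    (hΩ : IsOpen Ω) {T : Set (Vec d)} (hT : IsCompact T) (hTΩ : T ⊆ Ω) (i : Fin d) :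
    ∃ (C : NNReal) (f : Vec d → ℝ), LipschitzWith C f ∧ ∃ W, IsOpen W ∧ T ⊆ W ∧ W ⊆ Ω ∧
      Set.EqOn f (fun x => v x i) W := by
  obtain ⟨L, hL0, hL⟩ := exists_lipschitz_on_segments hP hcov
  obtain ⟨δ, hδ, hδΩ⟩ := hT.exists_cthickening_subset_open hΩ hTΩ
  set W := Metric.thickening (δ / 2) T with hW
  have hWΩ : W ⊆ Ω := (Metric.thickening_subset_cthickening_of_le (by linarith) T).trans hδΩ
  have hWc : W ⊆ Metric.cthickening δ T :=
    Metric.thickening_subset_cthickening_of_le (by linarith) T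
  obtain ⟨B, hB⟩ := (hT.cthickening (r := δ)).exists_bound_of_continuousOn
    (hP.continuousOn.mono (hδΩ.trans (subset_activeDomain hcov)))
  set C := L + 4 * |B| / δ with hC
  have hC0 : 0 ≤ C := by positivity
  have hLip : LipschitzOnWith (Real.toNNReal C) (fun x => v x i) W := by
    refine LipschitzOnWith.of_dist_le_mul fun x hx y hy => ?_
    rw [Real.coe_toNNReal _ hC0]
    have h1 : dist (v x i) (v y i) ≤ ‖v x - v y‖ := by
      rw [Real.dist_eq, ← Real.norm_eq_abs]
      exact PiLp.norm_apply_le (v x - v y) i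
    refine h1.trans ?_
    -- Nearby points are joined by a segment inside `Ω`. Since `Ω` need not be convex, distant
    -- points are handled by boundedness, which accounts for `4 * |B| / δ` in the constant.
    rcases lt_or_ge (dist x y) (δ / 2) with hlt | hge
    · obtain ⟨t, ht, hyt⟩ := Metric.mem_thickening_iff.mp hy
      have hseg : segment ℝ y x ⊆ Ω := by
        refine subset_trans ?_ hδΩ
        have hball : segment ℝ y x ⊆ Metric.ball y (δ / 2) :=
          (convex_ball y _).segment_subset (Metric.mem_ball_self (by positivity)) hlt
        intro z hz
        refine Metric.mem_cthickening_of_dist_le z t δ T ht ?_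
        have := hball hz
        rw [Metric.mem_ball] at this
        linarith [dist_triangle z y t]
      refine (hL y x hseg).trans ?_
      rw [dist_eq_norm]
      gcongr
      rw [hC]
      exact le_add_of_nonneg_right (by positivity)
    · have h2 : ‖v x - v y‖ ≤ 2 * |B| := by
        refine (norm_sub_le _ _).trans ?_
        have := hB x (hWc hx)
        have := hB y (hWc hy)
        linarith [le_abs_self B]
      calc ‖v x - v y‖ ≤ 2 * |B| := h2
        _ = 4 * |B| / δ * (δ / 2) := by field_simp; ring
        _ ≤ C * dist x y := by
            gcongr
            rw [hC]
            exact le_add_of_nonneg_left hL0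
  obtain ⟨f, hf, hfe⟩ := hLip.extend_real
  exact ⟨_, f, hf, W, Metric.isOpen_thickening, Metric.self_subset_thickening (by positivity) T,
    hWΩ, hfe.symm⟩

/-- The weak derivative of a continuous piecewise polynomial field is its piecewise derivative. -/
lemma IsPiecewise.hasWeakDeriv (hP : IsPiecewise p Ω M v P) (hcov : Ω ⊆ M.domain)
    (hΩ : IsOpen Ω) (n : Vec d) : HasWeakDeriv Ω n 1 v (pwDeriv M P n) := by
  obtain ⟨B, hB0, hB⟩ := exists_bound_norm_pwDeriv hP n
  have hvl : LocallyIntegrableOn v Ω :=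
    (hP.continuousOn.mono (subset_activeDomain hcov)).locallyIntegrableOn hΩ.measurableSet
  have hgl : LocallyIntegrableOn (pwDeriv M P n) Ω := by
    refine LocallyIntegrable.locallyIntegrableOn (fun x => ?_) _
    refine ⟨Metric.ball x 1, Metric.ball_mem_nhds x one_pos, ?_⟩
    exact Measure.integrableOn_of_bounded measure_ball_lt_top.ne
      (stronglyMeasurable_pwDeriv hP n).aestronglyMeasurable (M := B)
      (Eventually.of_forall hB)
  refine ⟨hvl, hgl, fun φ h1 h2 h3 => ?_⟩
  have h1' : ContDiff ℝ 1 φ := h1.of_le (by exact_mod_cast le_top)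
  have e1 := (contDiff_iteratedFDeriv_apply h1 1 n).continuous
  have e2 := hasCompactSupport_iteratedFDeriv_apply h2 1 n
  have e3 := (tsupport_iteratedFDeriv_apply_subset φ 1 n).trans h3
  rw [setIntegral_smul_eq_integral h3, setIntegral_smul_eq_integral e3]
  have i1 := integrable_smul_of_locallyIntegrableOn e1 e2 e3 hvl
  have i2 := integrable_smul_of_locallyIntegrableOn h1.continuous h2 h3 hgl
  ext i
  have p1 : ∫ x, iteratedFDeriv ℝ 1 φ x (fun _ => n) * v x i =
      (∫ x, iteratedFDeriv ℝ 1 φ x (fun _ => n) • v x) i :=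
    (EuclideanSpace.proj i : Vec d →L[ℝ] ℝ).integral_comp_comm i1
  have p2 : ∫ x, φ x * pwDeriv M P n x i = (∫ x, φ x • pwDeriv M P n x) i :=
    (EuclideanSpace.proj i : Vec d →L[ℝ] ℝ).integral_comp_comm i2
  rw [← p1, PiLp.smul_apply, ← p2]
  obtain ⟨C, f, hf, W, hWo, hTW, hWΩ, hfv⟩ :=
    exists_lipschitz_extension hP hcov hΩ h2.isCompact h3 i
  obtain ⟨D, hD⟩ := h1'.lipschitzWith_of_hasCompactSupport h2 (by simp)
  -- Integration by parts for Lipschitz functions; the direction `-n` on the test function carries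
  -- the sign of the weak derivative.
  have key := hf.integral_lineDeriv_mul_eq (μ := volume) hD h2 n
  have hφ : ∀ x, iteratedFDeriv ℝ 1 φ x (fun _ => n) = fderiv ℝ φ x n := fun x =>
    iteratedFDeriv_one_apply _
  have hl : ∀ x, iteratedFDeriv ℝ 1 φ x (fun _ => n) * v x i = -(lineDeriv ℝ φ x (-n) * f x) := by
    intro x
    rw [hφ, ((h1.differentiable (by simp)) x).lineDeriv_eq_fderiv, map_neg, neg_mul, neg_neg]
    by_cases hx : x ∈ tsupport φ
    · rw [hfv (hTW hx)]
    · have : fderiv ℝ φ x = 0 := by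
        have h4 : x ∉ tsupport (fderiv ℝ φ) := fun h => hx (tsupport_fderiv_subset ℝ h)
        exact image_eq_zero_of_notMem_tsupport h4
      simp [this]
  -- Almost every point of `Ω` is interior to an element, and near it the Lipschitz extension is a
  -- component of the polynomial of that element.
  have hr : ∀ᵐ x, φ x * pwDeriv M P n x i = lineDeriv ℝ f x n * φ x := by
    filter_upwards [ae_exists_mem_interior hcov] with x hx
    by_cases hxT : x ∈ tsupport φ
    · obtain ⟨K, hK, hxK⟩ := hx (h3 hxT)
      have hKa : IsActive Ω K := ⟨x, interior_subset hxK, h3 hxT⟩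
      have heq : f =ᶠ[𝓝 x] fun y => P K y i := by
        filter_upwards [hWo.mem_nhds (hTW hxT), isOpen_interior.mem_nhds hxK] with y hyW hyK
        rw [hfv hyW]
        simp only
        rw [hP.eqOn K hK hKa (interior_subset hyK)]
      have hPd := ((hP.poly K) i).differentiable x
      rw [heq.lineDeriv_eq, hPd.lineDeriv_eq_fderiv, pwDeriv_of_mem_interior hK hxK,
        dirDeriv_apply ((hP.poly K).contDiff.differentiable (by simp)), mul_comm]
      rfl
    · rw [image_eq_zero_of_notMem_tsupport hxT]
      ring
  simp only [hl, integral_neg]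
  rw [integral_congr_ae hr, key]
  simp

end Piecewise

/-! ### Existence of traces -/

section TraceExistence

variable {d : ℕ} {U : Set (Vec d)} {f : Vec d → Vec d} {x a : Vec d}

lemma volume_real_ball_inter_pos (hU : IsOpen U) (hx : x ∈ closure U) {r : ℝ} (hr : 0 < r) :
    0 < volume.real (Metric.ball x r ∩ U) := by
  obtain ⟨y, hy, hyU⟩ := mem_closure_iff.mp hx _ Metric.isOpen_ball (Metric.mem_ball_self hr)
  refine ENNReal.toReal_pos ((Metric.isOpen_ball.inter hU).measure_pos volume ⟨y, hy, hyU⟩).ne' ?_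
  exact ((measure_mono Set.inter_subset_left).trans_lt measure_ball_lt_top).ne

lemma hasTrace_of_integral_norm_sub_le (hU : IsOpen U) (hx : x ∈ closure U)
    (h : ∀ ε : ℝ, 0 < ε → ∀ᶠ r in 𝓝[>] (0 : ℝ), IntegrableOn f (Metric.ball x r ∩ U) ∧
      ∫ y in Metric.ball x r ∩ U, ‖f y - a‖ ≤ ε * volume.real (Metric.ball x r ∩ U)) :
    HasTrace U f x a := by
  rw [HasTrace, Metric.tendsto_nhds]
  intro ε hε
  filter_upwards [h (ε / 2) (half_pos hε), self_mem_nhdsWithin] with r ⟨hint, hr⟩ hr0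
  have hpos := volume_real_ball_inter_pos hU hx hr0
  have hfin : volume (Metric.ball x r ∩ U) ≠ ⊤ :=
    ((measure_mono Set.inter_subset_left).trans_lt measure_ball_lt_top).ne
  have h1 : (⨍ y in Metric.ball x r ∩ U, f y) - a =
      (volume.real (Metric.ball x r ∩ U))⁻¹ • ∫ y in Metric.ball x r ∩ U, (f y - a) := by
    rw [integral_sub hint (integrableOn_const hfin), setAverage_eq, smul_sub, setIntegral_const,
      smul_smul, inv_mul_cancel₀ hpos.ne', one_smul]
  rw [dist_eq_norm, h1, norm_smul, norm_inv, Real.norm_eq_abs, abs_of_pos hpos]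
  calc _ ≤ (volume.real (Metric.ball x r ∩ U))⁻¹ * ∫ y in Metric.ball x r ∩ U, ‖f y - a‖ := by
        gcongr
        exact norm_integral_le_integral_norm _
    _ ≤ (volume.real (Metric.ball x r ∩ U))⁻¹ *
        (ε / 2 * volume.real (Metric.ball x r ∩ U)) := by gcongr
    _ = ε / 2 := by field_simp
    _ < ε := half_lt_self hε

lemma hasTrace_of_tendsto (hU : IsOpen U) (hx : x ∈ closure U)
    (hf : AEStronglyMeasurable f (volume.restrict U)) (h : Tendsto f (𝓝[U] x) (𝓝 a)) :
    HasTrace U f x a := by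
  refine hasTrace_of_integral_norm_sub_le hU hx fun ε hε => ?_
  rw [Metric.tendsto_nhdsWithin_nhds] at h
  obtain ⟨δ, hδ, H⟩ := h ε hε
  filter_upwards [Ioo_mem_nhdsGT hδ] with r hr
  have hfin : volume (Metric.ball x r ∩ U) < ⊤ :=
    (measure_mono Set.inter_subset_left).trans_lt measure_ball_lt_top
  have hms : MeasurableSet (Metric.ball x r ∩ U) :=
    (Metric.isOpen_ball.inter hU).measurableSet
  have hle : ∀ y ∈ Metric.ball x r ∩ U, ‖f y - a‖ ≤ ε := fun y hy => by
    rw [← dist_eq_norm]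
    exact (H hy.2 (lt_trans hy.1 hr.2)).le
  have hint : IntegrableOn f (Metric.ball x r ∩ U) := by
    have hm : AEStronglyMeasurable f (volume.restrict (Metric.ball x r ∩ U)) :=
      hf.mono_measure (Measure.restrict_mono Set.inter_subset_right le_rfl)
    have : IsFiniteMeasure (volume.restrict (Metric.ball x r ∩ U)) := ⟨by simpa using hfin⟩
    refine Integrable.of_bound hm (ε + ‖a‖) (ae_restrict_of_forall_mem hms fun y hy => ?_)
    have h1 := hle y hy
    have h2 := norm_sub_norm_le (f y) a
    linarith
  refine ⟨hint, ?_⟩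
  calc _ ≤ ∫ y in Metric.ball x r ∩ U, ε := by
        refine setIntegral_mono_on ((hint.sub (integrableOn_const hfin.ne)).norm)
          (integrableOn_const hfin.ne) hms hle
    _ = _ := by simp [mul_comm]

/-- If `f` is bounded and is given by a continuous field `G` on a set `K` which fills almost all of `U`
close to `x`, then `G x` is the trace of `f` at `x`. -/
lemma hasTrace_of_density (hU : IsOpen U) (hx : x ∈ closure U) {K : Set (Vec d)}
    (hK : MeasurableSet K) {G : Vec d → Vec d} {B c : ℝ} (hc : 0 < c)
    (hf : StronglyMeasurable f) (hfB : ∀ y, ‖f y‖ ≤ B) (hG : Continuous G)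
    (hfG : ∀ᵐ y, y ∈ K → f y = G y)
    (hlow : ∀ᶠ r in 𝓝[>] (0 : ℝ), c * r ^ d ≤ volume.real (Metric.ball x r ∩ U))
    (hdens : ∀ η : ℝ, 0 < η → ∀ᶠ r in 𝓝[>] (0 : ℝ),
      volume.real ((Metric.ball x r ∩ U) \ K) ≤ η * r ^ d) : HasTrace U f x (G x) := by
  refine hasTrace_of_integral_norm_sub_le hU hx fun ε hε => ?_
  have hB0 : 0 ≤ B := (norm_nonneg _).trans (hfB x)
  set D := B + ‖G x‖ + 1 with hD
  have hD0 : 0 < D := by positivity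
  obtain ⟨δ, hδ, H⟩ := Metric.tendsto_nhds_nhds.mp (hG.tendsto x) (ε / 2) (half_pos hε)
  -- The density tolerance makes the part outside `K`, where the integrand is at most `D`,
  -- contribute no more than half of the permitted error.
  filter_upwards [Ioo_mem_nhdsGT hδ, hlow, hdens (ε * c / (2 * D)) (by positivity)] with r hr h1 h2
  set S := Metric.ball x r ∩ U with hS
  have hfin : volume S < ⊤ := (measure_mono Set.inter_subset_left).trans_lt measure_ball_lt_top
  have hms : MeasurableSet S := (Metric.isOpen_ball.inter hU).measurableSet
  have hint : IntegrableOn f S :=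
    Measure.integrableOn_of_bounded hfin.ne hf.aestronglyMeasurable (Eventually.of_forall hfB)
  refine ⟨hint, ?_⟩
  have hKfin : volume (S \ K) < ⊤ := (measure_mono Set.sdiff_subset).trans_lt hfin
  have hle : ∀ᵐ y ∂(volume.restrict S), ‖f y - G x‖ ≤ ε / 2 + (S \ K).indicator (fun _ => D) y := by
    rw [ae_restrict_iff' hms]
    filter_upwards [hfG] with y hy hyS
    by_cases hyK : y ∈ K
    · rw [hy hyK, Set.indicator_of_notMem (fun h => h.2 hyK), add_zero, ← dist_eq_norm]
      exact (H (lt_trans hyS.1 hr.2)).le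
    · have hm : y ∈ S \ K := ⟨hyS, hyK⟩
      rw [Set.indicator_of_mem hm]
      have := norm_sub_le (f y) (G x)
      have := hfB y
      linarith
  have hind : Integrable ((S \ K).indicator fun _ => D) (volume.restrict S) :=
    (integrable_indicator_iff (hms.diff hK)).mpr (integrableOn_const
      (((Measure.restrict_apply_le _ _).trans_lt hKfin).ne))
  have hc1 : Integrable (fun _ : Vec d => ε / 2) (volume.restrict S) := integrableOn_const hfin.ne
  calc ∫ y in S, ‖f y - G x‖ ≤ ∫ y in S, (ε / 2 + (S \ K).indicator (fun _ => D) y) :=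
        integral_mono_ae ((hint.sub (integrableOn_const hfin.ne)).norm)
          (hc1.add hind) hle
    _ = ε / 2 * volume.real S + D * volume.real (S \ K) := by
        rw [integral_add hc1 hind, setIntegral_const,
          setIntegral_indicator (hms.diff hK), Set.inter_eq_self_of_subset_right Set.sdiff_subset,
          setIntegral_const, smul_eq_mul, smul_eq_mul, mul_comm, mul_comm D]
    _ ≤ ε / 2 * volume.real S + D * (ε * c / (2 * D) * r ^ d) := by gcongr
    _ = ε / 2 * volume.real S + ε / 2 * (c * r ^ d) := by field_simp
    _ ≤ ε / 2 * volume.real S + ε / 2 * volume.real S := by gcongr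
    _ = ε * volume.real S := by ring

/-- A trace that exists almost everywhere is measurable. -/
lemma aestronglyMeasurable_trace (hU : IsOpen U) (hf : AEStronglyMeasurable f (volume.restrict U))
    {ν : Measure (Vec d)} (h : ∀ᵐ x ∂ν, ∃ a, HasTrace U f x a) :
    AEStronglyMeasurable (trace U f) ν := by
  set g := hf.mk f with hg
  have hgm : StronglyMeasurable g := hf.stronglyMeasurable_mk
  have hfg : f =ᵐ[volume.restrict U] g := hf.ae_eq_mk
  have hset : ∀ r : ℝ, MeasurableSet {z : Vec d × Vec d | z.2 ∈ Metric.ball z.1 r ∩ U} := fun r =>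
    ((isOpen_lt (continuous_snd.dist continuous_fst) continuous_const).inter
      (hU.preimage continuous_snd)).measurableSet
  -- Integrals over `B(x, r) ∩ U` are measurable in the centre `x` as parametric integrals. The
  -- trace is the almost everywhere limit of the means along the radii `1 / (n + 1)`.
  have hind : ∀ (E : Type) [NormedAddCommGroup E] [NormedSpace ℝ E] (u : Vec d → E),
      StronglyMeasurable u → ∀ r : ℝ,
      StronglyMeasurable fun x => ∫ y in Metric.ball x r ∩ U, u y := by
    intro E _ _ u hu r
    have h1 : StronglyMeasurable fun z : Vec d × Vec d =>
        {z : Vec d × Vec d | z.2 ∈ Metric.ball z.1 r ∩ U}.indicator (fun z => u z.2) z :=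
      (hu.comp_measurable measurable_snd).indicator (hset r)
    have h2 := h1.integral_prod_right' (ν := volume)
    convert h2 using 1
    funext x
    rw [← integral_indicator (Metric.isOpen_ball.inter hU).measurableSet]
    rfl
  have havg : ∀ r : ℝ, StronglyMeasurable fun x => ⨍ y in Metric.ball x r ∩ U, f y := by
    intro r
    have h1 : (fun x => ⨍ y in Metric.ball x r ∩ U, f y) = fun x =>
        (∫ y in Metric.ball x r ∩ U, (1 : ℝ))⁻¹ • ∫ y in Metric.ball x r ∩ U, g y := by
      funext x
      rw [setAverage_eq, integral_congr_ae (ae_mono (Measure.restrict_mono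
        Set.inter_subset_right le_rfl) hfg), setIntegral_const, smul_eq_mul, mul_one]
    rw [h1]
    exact (hind ℝ _ stronglyMeasurable_const r).inv₀.smul (hind _ g hgm r)
  have hlim : Tendsto (fun n : ℕ => 1 / ((n : ℝ) + 1)) atTop (𝓝[>] 0) :=
    tendsto_nhdsWithin_iff.mpr ⟨tendsto_one_div_add_atTop_nhds_zero_nat,
      Eventually.of_forall fun n => by
        show (0 : ℝ) < 1 / ((n : ℝ) + 1)
        positivity⟩
  refine aestronglyMeasurable_of_tendsto_ae atTop
    (f := fun (n : ℕ) x => ⨍ y in Metric.ball x (1 / ((n : ℝ) + 1)) ∩ U, f y)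
    (fun n => (havg _).aestronglyMeasurable) ?_
  filter_upwards [h] with x hx
  exact (hasTrace_trace hx).comp hlim

end TraceExistence

/-! ### Density points -/

/-- Close to a density point of `W`, every point is close to `W`. -/
lemma exists_dist_le_of_density {k : ℕ} {W : Set (Vec k)} {y : Vec k} (hyW : y ∈ W)
    (h : Tendsto (fun r => volume (W ∩ Metric.closedBall y r) / volume (Metric.closedBall y r))
      (𝓝[>] 0) (𝓝 1)) {ε : ℝ} (hε : 0 < ε) :
    ∃ r₀ : ℝ, 0 < r₀ ∧ ∀ z, dist z y < r₀ → ∃ y' ∈ W, dist z y' ≤ ε * dist z y := by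
  wlog hε1 : ε ≤ 1 generalizing ε
  · obtain ⟨r₀, hr₀, H⟩ := this one_pos le_rfl
    refine ⟨r₀, hr₀, fun z hz => ?_⟩
    obtain ⟨y', hy', hle⟩ := H z hz
    exact ⟨y', hy', hle.trans (mul_le_mul_of_nonneg_right (le_of_not_ge hε1) dist_nonneg)⟩
  -- `θ` is the volume fraction of `B(z, ε D)` in `B(y, 2 D)`. If `W` missed the smaller ball, its
  -- share of the larger one would be at most `1 - θ`, against density one at `y`.
  set θ := (ε / 2) ^ k with hθ
  have hθ0 : 0 < θ := by positivity
  have h1 : ENNReal.ofReal (1 - θ) < 1 := by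
    rw [ENNReal.ofReal_lt_one]; linarith
  obtain ⟨r₁, hr₁, H⟩ := (nhdsGT_basis (0 : ℝ)).eventually_iff.mp (h.eventually (lt_mem_nhds h1))
  refine ⟨r₁ / 2, by positivity, fun z hz => ?_⟩
  by_contra! hcon
  have hD : 0 < dist z y := by
    rcases eq_or_ne z y with rfl | hne
    · have := hcon z hyW
      simp at this
    · exact dist_pos.mpr hne
  set D := dist z y with hDd
  have hratio := H (⟨by positivity, by linarith⟩ : 2 * D ∈ Set.Ioo 0 r₁)
  set V₁ := volume (Metric.closedBall (0 : Vec k) 1) with hV₁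
  have hV₁0 : V₁ ≠ 0 := (Metric.measure_closedBall_pos _ _ one_pos).ne'
  have hV₁t : V₁ ≠ ⊤ := (isCompact_closedBall _ _).measure_lt_top.ne
  have hvol : ∀ (w : Vec k) (s : ℝ), 0 ≤ s →
      volume (Metric.closedBall w s) = ENNReal.ofReal (s ^ k) * V₁ := by
    intro w s hs
    rw [Measure.addHaar_closedBall' _ _ hs, finrank_euclideanSpace_fin]
  have hsub : Metric.closedBall z (ε * D) ⊆ Metric.closedBall y (2 * D) := by
    refine Metric.closedBall_subset_closedBall' ?_
    nlinarith
  have hdisj : W ∩ Metric.closedBall y (2 * D) ⊆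
      Metric.closedBall y (2 * D) \ Metric.closedBall z (ε * D) := by
    intro w hw
    refine ⟨hw.2, fun h => ?_⟩
    have := hcon w hw.1
    rw [Metric.mem_closedBall, dist_comm] at h
    linarith
  have hle : volume (W ∩ Metric.closedBall y (2 * D)) ≤
      ENNReal.ofReal (1 - θ) * volume (Metric.closedBall y (2 * D)) := by
    refine (measure_mono hdisj).trans ?_
    rw [measure_sdiff hsub Metric.isClosed_closedBall.measurableSet.nullMeasurableSet
      (isCompact_closedBall _ _).measure_lt_top.ne, hvol _ _ (by positivity), hvol _ _ (by positivity),
      ← mul_assoc, ← ENNReal.sub_mul (fun _ _ => hV₁t), ← ENNReal.ofReal_sub _ (by positivity),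
      ← ENNReal.ofReal_mul' (by positivity)]
    gcongr
    have : (ε * D) ^ k = θ * (2 * D) ^ k := by
      rw [hθ, ← mul_pow]
      congr 1
      ring
    rw [this]
    linarith
  have hpos : volume (Metric.closedBall y (2 * D)) ≠ 0 :=
    (Metric.measure_closedBall_pos _ _ (by positivity)).ne'
  have htop : volume (Metric.closedBall y (2 * D)) ≠ ⊤ := (isCompact_closedBall _ _).measure_lt_top.ne
  have h2 := (ENNReal.div_le_iff hpos htop).mpr hle
  exact absurd hratio (not_lt.mpr h2)

/-- The volume of a thin slab in a ball is a small fraction of the volume of the ball. -/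
lemma exists_volume_slab_le {d : ℕ} {n : Vec d} (hn : ‖n‖ = 1) {η : ℝ} (hη : 0 < η) :
    ∃ ε : ℝ, 0 < ε ∧ ∀ (x : Vec d) (r : ℝ), 0 < r →
      volume.real (Metric.ball x r ∩ {y | -(ε * r) ≤ ⟪y - x, n⟫ ∧ ⟪y - x, n⟫ ≤ 0}) ≤ η * r ^ d := by
  -- In the unit ball the slabs decrease to a piece of a hyperplane, a null set, so a thin enough
  -- one has volume below `η`; scaling gives all radii.
  let S : ℕ → Set (Vec d) := fun m =>
    (Metric.ball 0 1 ∩ {w | -(1 / ((m : ℝ) + 1)) ≤ ⟪w, n⟫}) ∩ {w | ⟪w, n⟫ ≤ 0}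
  have hSm : ∀ m, MeasurableSet (S m) := fun m =>
    (Metric.isOpen_ball.measurableSet.inter
      (measurableSet_le measurable_const (by fun_prop))).inter
      (measurableSet_le (by fun_prop) measurable_const)
  have hanti : Antitone S := fun i j hij w hw => by
    have h1 : -(1 / ((j : ℝ) + 1)) ≤ ⟪w, n⟫ := hw.1.2
    have h2 : -(1 / ((i : ℝ) + 1)) ≤ -(1 / ((j : ℝ) + 1)) := neg_le_neg (Nat.one_div_le_one_div hij)
    exact ⟨⟨hw.1.1, h2.trans h1⟩, hw.2⟩
  have hlim := tendsto_measure_iInter_atTop (μ := volume) (fun m => (hSm m).nullMeasurableSet) hanti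
    ⟨0, ((measure_mono (Set.inter_subset_left.trans Set.inter_subset_left)).trans_lt
      measure_ball_lt_top).ne⟩
  have h0 : volume (⋂ m, S m) = 0 := by
    have hn0 : n ≠ 0 := by
      rintro rfl
      simp at hn
    have hne : (ℝ ∙ n)ᗮ ≠ ⊤ := by
      rw [Ne, Submodule.orthogonal_eq_top_iff, Submodule.span_singleton_eq_bot]
      exact hn0
    refine measure_mono_null (fun w hw => ?_) (Measure.addHaar_submodule volume _ hne)
    rw [Set.mem_iInter] at hw
    rw [SetLike.mem_coe, Submodule.mem_orthogonal_singleton_iff_inner_left]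
    refine le_antisymm (hw 0).2 ?_
    have := le_of_tendsto' (tendsto_one_div_add_atTop_nhds_zero_nat (𝕜 := ℝ)).neg
      fun m => (hw m).1.2
    simpa using this
  rw [h0] at hlim
  have hη' : (0 : ENNReal) < ENNReal.ofReal η := by simpa using hη
  obtain ⟨m, hm⟩ := (hlim.eventually (gt_mem_nhds hη')).exists
  refine ⟨1 / ((m : ℝ) + 1), by positivity, fun x r hr => ?_⟩
  refine ENNReal.toReal_le_of_le_ofReal (by positivity) ?_
  rw [volume_eq_volume_preimage x hr, mul_comm η, ENNReal.ofReal_mul (by positivity)]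
  gcongr
  refine (measure_mono fun w hw => ?_).trans hm.le
  obtain ⟨h1, h2, h3⟩ := hw
  simp only [Metric.mem_ball, dist_eq_norm, add_sub_cancel_left, norm_smul, Real.norm_eq_abs,
    abs_of_pos hr, real_inner_smul_left] at h1 h2 h3
  refine ⟨⟨by rw [mem_ball_zero_iff]; nlinarith, ?_⟩, ?_⟩
  · show -(1 / ((m : ℝ) + 1)) ≤ ⟪w, n⟫
    have : r * (-(1 / ((m : ℝ) + 1))) ≤ r * ⟪w, n⟫ := by linarith
    exact le_of_mul_le_mul_left this hr
  · show ⟪w, n⟫ ≤ 0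
    nlinarith

/-! ### Charts of hyperplanes -/

lemma exists_norm_eq_one_mem_orthogonal {d : ℕ} {F : Set (Vec d)}
    (hF : Module.finrank ℝ (vectorSpan ℝ F) < d) : ∃ n : Vec d, ‖n‖ = 1 ∧ n ∈ (vectorSpan ℝ F)ᗮ := by
  have hne : (vectorSpan ℝ F)ᗮ ≠ ⊥ := by
    rw [Ne, Submodule.orthogonal_eq_bot_iff]
    intro h
    rw [h, finrank_top, finrank_euclideanSpace_fin] at hF
    exact lt_irrefl _ hF
  obtain ⟨w, hw, hw0⟩ := Submodule.exists_mem_ne_zero_of_ne_bot hne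
  refine ⟨(‖w‖⁻¹ : ℝ) • w, ?_, Submodule.smul_mem _ _ hw⟩
  rw [norm_smul, norm_inv, norm_norm, inv_mul_cancel₀ (norm_ne_zero_iff.mpr hw0)]

lemma inner_sub_eq_zero_of_mem {d : ℕ} {F : Set (Vec d)} {n x y : Vec d}
    (hn : n ∈ (vectorSpan ℝ F)ᗮ) (hx : x ∈ F) (hy : y ∈ F) : ⟪y - x, n⟫ = 0 :=
  (Submodule.mem_orthogonal _ _).mp hn _ (vsub_mem_vectorSpan ℝ hy hx)

lemma isometry_chart {d k : ℕ} (A : Vec k →ₗᵢ[ℝ] Vec d) (x : Vec d) :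
    Isometry fun y => x + A y :=
  (IsometryEquiv.addLeft x).isometry.comp A.isometry

/-- The surface measure of the image of an isometric chart. -/
lemma hausdorff_image_chart {d k : ℕ} (A : Vec k →ₗᵢ[ℝ] Vec d) (x : Vec d) (N : Set (Vec k)) :
    (μHE[k] : Measure (Vec d)) ((fun y => x + A y) '' N) = volume N := by
  rw [(isometry_chart A x).euclideanHausdorffMeasure_image,
    EuclideanSpace.euclideanHausdorffMeasure_eq_volume]

/-! ### Tangent hyperplanes of the boundary -/

section Tangent

variable {d : ℕ} {Ω : Set (Vec d)} {x e n : Vec d} {r κ : ℝ}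

/-- The boundary of `Ω` is asymptotically dense in the hyperplane through `x` orthogonal to `n`. -/
def TangentApprox (Ω : Set (Vec d)) (x n : Vec d) : Prop :=
  ∀ ε : ℝ, 0 < ε → ∃ r₀ : ℝ, 0 < r₀ ∧ ∀ w, ⟪w, n⟫ = 0 → ‖w‖ < r₀ →
    ∃ w', x + w' ∈ frontier Ω ∧ ‖w - w'‖ ≤ ε * ‖w‖

lemma TangentApprox.neg (h : TangentApprox Ω x n) : TangentApprox Ω x (-n) := fun ε hε => by
  simpa using h ε hε

/-- If `e` were tangent, there would be boundary points almost exactly in the direction `e` from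
`x`, inside the cone at `x`, where no boundary point can lie. -/
lemma TangentApprox.inner_ne_zero (h : TangentApprox Ω x n) (hΩ : IsOpen Ω) (hx : x ∈ frontier Ω)
    (hr : 0 < r) (hκ : 0 < κ) (hκ1 : κ < 1) (he : ‖e‖ = 1) (hc : ConeProp Ω x e r κ) :
    ⟪e, n⟫ ≠ 0 := by
  intro h0
  set ε := (1 - κ) / 4 with hε
  have hε0 : 0 < ε := by linarith
  obtain ⟨r₀, hr₀, H⟩ := h ε hε0
  set t := min (r₀ / 2) (r / 3) with ht
  have ht0 : 0 < t := lt_min (by positivity) (by positivity)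
  have ht1 : t ≤ r₀ / 2 := min_le_left _ _
  have ht2 : t ≤ r / 3 := min_le_right _ _
  have hte : ‖t • e‖ = t := by rw [norm_smul, he, mul_one, Real.norm_eq_abs, abs_of_pos ht0]
  obtain ⟨w', hw', hle⟩ := H (t • e) (by rw [real_inner_smul_left, h0, mul_zero])
    (by rw [hte]; linarith)
  rw [hte] at hle
  have h1 : ‖w'‖ ≤ (1 + ε) * t := by
    have := norm_sub_norm_le w' (t • e)
    rw [norm_sub_rev, hte] at this
    linarith
  have h2 : (1 - ε) * t ≤ ⟪w', e⟫ := by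
    have h3 := (abs_le.mp (abs_real_inner_le_norm (t • e - w') e)).2
    rw [he, mul_one, inner_sub_left, real_inner_smul_left, real_inner_self_eq_norm_sq, he] at h3
    linarith
  have h4 := hc.abs_inner_le hΩ hx (Metric.mem_ball_self hr) hw' (by
    rw [Metric.mem_ball, dist_eq_norm, add_sub_cancel_left]
    nlinarith)
  rw [add_sub_cancel_left] at h4
  have h5 := (abs_le.mp h4).2
  have h6 : κ * ‖w'‖ ≤ κ * ((1 + ε) * t) := by gcongr
  have h7 : 1 - ε ≤ κ * (1 + ε) := le_of_mul_le_mul_right (by linarith) ht0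
  nlinarith

/-- A point of `Ω` well below the hyperplane is pushed up along `e` until it reaches the hyperplane.
A boundary point is close by, in the cone of the starting point, and the cone property would put it
into `Ω`. -/
lemma TangentApprox.neg_le_inner (h : TangentApprox Ω x n) (hΩ : IsOpen Ω) (hn : ‖n‖ = 1)
    (hr : 0 < r) (hκ : 0 < κ) (hκ1 : κ < 1) (he : ‖e‖ = 1) (hc : ConeProp Ω x e r κ)
    (hpos : 0 < ⟪e, n⟫) {ε : ℝ} (hε : 0 < ε) :
    ∃ r₀ : ℝ, 0 < r₀ ∧ ∀ w, ‖w‖ < r₀ → x + w ∈ Ω → -(ε * ‖w‖) ≤ ⟪w, n⟫ := by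
  set δ := ⟪e, n⟫ with hδ
  have hδ1 : δ ≤ 1 := by
    have := real_inner_le_norm e n
    rwa [he, hn, mul_one] at this
  set C := 1 + 1 / δ with hC
  have hC0 : 0 < C := by positivity
  have hC1 : 1 ≤ C := by rw [hC]; exact le_add_of_nonneg_right (by positivity)
  have hκ' : 0 < 1 - κ := by linarith
  -- With this tolerance the distance to the nearby boundary point is at most `(1 - κ) / 2` of the
  -- travelled length `τ`, which keeps that point inside the cone.
  set ε' := ε * (1 - κ) / (2 * C) with hε'
  have hε'0 : 0 < ε' := by positivity
  obtain ⟨r₀, hr₀, H⟩ := h ε' hε'0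
  refine ⟨min (r₀ / C) (r / ((1 + ε') * C)), lt_min (by positivity) (by positivity),
    fun w hw hwΩ => ?_⟩
  have hw1 : C * ‖w‖ < r₀ := by
    have := hw.trans_le (min_le_left _ _)
    rw [lt_div_iff₀ hC0] at this
    linarith
  have hw2 : (1 + ε') * (C * ‖w‖) < r := by
    have := hw.trans_le (min_le_right _ _)
    rw [lt_div_iff₀ (by positivity)] at this
    linarith
  by_contra! hlt
  have hw0 : 0 ≤ ‖w‖ := norm_nonneg w
  set τ := -⟪w, n⟫ / δ with hτ
  have hτδ : τ * δ = -⟪w, n⟫ := by rw [hτ]; field_simp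
  have hτ1 : ε * ‖w‖ ≤ τ := by
    rw [hτ, le_div_iff₀ hpos]
    have : ε * ‖w‖ * δ ≤ ε * ‖w‖ := mul_le_of_le_one_right (by positivity) hδ1
    linarith
  have hτ0 : 0 ≤ τ := le_trans (by positivity) hτ1
  have hτ2 : τ ≤ ‖w‖ / δ := by
    rw [hτ]
    gcongr
    have := (abs_le.mp (abs_real_inner_le_norm w n)).1
    rw [hn] at this
    linarith
  have hw0n : ‖w + τ • e‖ ≤ C * ‖w‖ := by
    refine (norm_add_le _ _).trans ?_
    rw [norm_smul, he, mul_one, Real.norm_eq_abs, abs_of_nonneg hτ0, hC, add_mul, one_mul,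
      one_div_mul_eq_div]
    linarith
  obtain ⟨w', hw', hle⟩ := H (w + τ • e)
    (by rw [inner_add_left, real_inner_smul_left, ← hδ, hτδ]; ring) (hw0n.trans_lt hw1)
  have hle' : ‖w + τ • e - w'‖ ≤ ε' * (C * ‖w‖) := hle.trans (by gcongr)
  have hεC : ε' * (C * ‖w‖) = (1 - κ) / 2 * (ε * ‖w‖) := by rw [hε']; field_simp
  have hw'n : ‖w'‖ < r := by
    have := norm_sub_norm_le w' (w + τ • e)
    rw [norm_sub_rev] at this
    nlinarith
  have hwr : ‖w‖ < r := by
    have : ‖w‖ ≤ C * ‖w‖ := le_mul_of_one_le_left hw0 hC1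
    have : C * ‖w‖ ≤ (1 + ε') * (C * ‖w‖) := le_mul_of_one_le_left (by positivity) (by linarith)
    linarith
  have hdiff : x + w' - (x + w) = τ • e - (w + τ • e - w') := by abel
  refine hc.notMem_of_mem_frontier hΩ hw' (y := x + w) ?_ ?_ ?_ hwΩ
  · rwa [Metric.mem_ball, dist_eq_norm, add_sub_cancel_left]
  · rwa [Metric.mem_ball, dist_eq_norm, add_sub_cancel_left]
  · rw [hdiff]
    set g := w + τ • e - w' with hg
    have h1 : ‖τ • e - g‖ ≤ τ + ‖g‖ := by
      refine (norm_sub_le _ _).trans ?_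
      rw [norm_smul, he, mul_one, Real.norm_eq_abs, abs_of_nonneg hτ0]
    have h2 : τ - ‖g‖ ≤ ⟪τ • e - g, e⟫ := by
      rw [inner_sub_left, real_inner_smul_left, real_inner_self_eq_norm_sq, he]
      have := (abs_le.mp (abs_real_inner_le_norm g e)).2
      rw [he] at this
      linarith
    have h3 : ‖g‖ ≤ (1 - κ) / 2 * τ := by
      rw [hεC] at hle'
      refine hle'.trans ?_
      gcongr
    have h4 : κ * ‖τ • e - g‖ ≤ κ * (τ + ‖g‖) := by gcongr
    nlinarith [norm_nonneg g]

/-- A convex set that contains a neighbourhood of `x` in a hyperplane, and a point on the positive side of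
this hyperplane, contains a half ball centred at `x`. -/
lemma exists_half_ball_subset {K : Set (Vec d)} (hK : Convex ℝ K) (hn : ‖n‖ = 1) {s : ℝ} (hs : 0 < s)
    (hF : ∀ w, ⟪w, n⟫ = 0 → ‖w‖ < s → x + w ∈ K) {k : Vec d} (hk : k ∈ K) (hkn : 0 < ⟪k - x, n⟫) :
    ∃ r₀ : ℝ, 0 < r₀ ∧ ∀ w, ‖w‖ < r₀ → 0 < ⟪w, n⟫ → x + w ∈ K := by
  set c := ⟪k - x, n⟫ with hc
  set D := ‖k - x‖ with hD
  have hD0 : 0 ≤ D := norm_nonneg _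
  refine ⟨min (c / 2) (s / (2 * (1 + D / c))), lt_min (by positivity) (by positivity),
    fun w hw hwn => ?_⟩
  have hw1 := hw.trans_le (min_le_left _ _)
  have hw2 := hw.trans_le (min_le_right _ _)
  rw [lt_div_iff₀ (by positivity)] at hw2
  set a := ⟪w, n⟫ / c with ha
  have ha0 : 0 < a := by positivity
  have hwle : ⟪w, n⟫ ≤ ‖w‖ := by
    have := real_inner_le_norm w n
    rwa [hn, mul_one] at this
  have ha1 : a ≤ ‖w‖ / c := by rw [ha]; gcongr
  have ha2 : a < 1 / 2 := by
    refine ha1.trans_lt ?_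
    rw [div_lt_iff₀ hkn]
    linarith
  have hb : 0 < 1 - a := by linarith
  -- The projection of `w` from `k - x` onto the hyperplane, so that `x + w` is a convex combination
  -- of `k` and the point `x + u` of `K`.
  set u := (1 - a)⁻¹ • (w - a • (k - x)) with hu
  have hun : ⟪u, n⟫ = 0 := by
    rw [hu, real_inner_smul_left, inner_sub_left, real_inner_smul_left, ← hc, ha,
      div_mul_cancel₀ _ hkn.ne', sub_self, mul_zero]
  have hus : ‖u‖ < s := by
    rw [hu, norm_smul, norm_inv, Real.norm_eq_abs, abs_of_pos hb, inv_mul_lt_iff₀ hb]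
    have h1 : ‖w - a • (k - x)‖ ≤ ‖w‖ + a * D := by
      refine (norm_sub_le _ _).trans ?_
      rw [norm_smul, Real.norm_eq_abs, abs_of_pos ha0]
    have h2 : a * D ≤ ‖w‖ / c * D := by gcongr
    have h3 : ‖w‖ / c * D = ‖w‖ * (D / c) := by ring
    nlinarith
  have key := hK hk (hF u hun hus) ha0.le hb.le (by ring)
  convert key using 1
  rw [smul_add, hu, smul_inv_smul₀ hb.ne', smul_sub, sub_smul, one_smul]
  abel

end Tangent

/-! ### The element which fills the domain near a boundary point -/

section Fills

variable {d : ℕ} {Ω : Set (Vec d)} {M : Mesh d} {K L : Set (Vec d)} {x : Vec d}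

/-- Up to a set of density zero at `x`, the domain `Ω` is contained in `K`. -/
def FillsNear (Ω K : Set (Vec d)) (x : Vec d) : Prop :=
  ∀ η : ℝ, 0 < η → ∀ᶠ r in 𝓝[>] (0 : ℝ), volume.real ((Metric.ball x r ∩ Ω) \ K) ≤ η * r ^ d

lemma Mesh.exists_half_ball (hK : K ∈ M.elements) {n : Vec d} (hn : ‖n‖ = 1) {s : ℝ} (hs : 0 < s)
    (hF : ∀ w, ⟪w, n⟫ = 0 → ‖w‖ < s → x + w ∈ K) :
    ∃ r₀ : ℝ, 0 < r₀ ∧ ((∀ w, ‖w‖ < r₀ → 0 < ⟪w, n⟫ → x + w ∈ K) ∨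
      ∀ w, ‖w‖ < r₀ → ⟪w, n⟫ < 0 → x + w ∈ K) := by
  obtain ⟨y, hy⟩ := M.nondegenerate K hK
  obtain ⟨t, ht, hball⟩ := Metric.isOpen_iff.mp isOpen_interior y hy
  obtain ⟨k, hkK, hk⟩ : ∃ k ∈ K, ⟪k - x, n⟫ ≠ 0 := by
    by_cases h : ⟪y - x, n⟫ = 0
    · refine ⟨y + (t / 2) • n, interior_subset (hball ?_), ?_⟩
      · rw [Metric.mem_ball, dist_eq_norm, add_sub_cancel_left, norm_smul, hn, mul_one,
          Real.norm_eq_abs, abs_of_pos (by positivity)]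
        linarith
      · rw [add_sub_right_comm, inner_add_left, h, real_inner_smul_left, real_inner_self_eq_norm_sq, hn]
        positivity
    · exact ⟨y, interior_subset hy, h⟩
  rcases lt_or_gt_of_ne hk with hneg | hpos
  · obtain ⟨r₀, hr₀, H⟩ := exists_half_ball_subset (n := -n) (M.convex hK) (by rwa [norm_neg]) hs
      (fun w hw => hF w (by simpa using hw)) hkK (by rw [inner_neg_right]; linarith)
    exact ⟨r₀, hr₀, Or.inr fun w hw hwn => H w hw (by rw [inner_neg_right]; linarith)⟩
  · obtain ⟨r₀, hr₀, H⟩ := exists_half_ball_subset (M.convex hK) hn hs hF hkK hpos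
    exact ⟨r₀, hr₀, Or.inl H⟩

/-- Near `x`, the points of `Ω` missing from `K` lie on or below the hyperplane but only by `ε`
times the radius, hence in a thin slab. -/
lemma fillsNear_of_half_ball {n : Vec d} (hn : ‖n‖ = 1) {s : ℝ} (hs : 0 < s)
    (hK : ∀ w, ‖w‖ < s → 0 < ⟪w, n⟫ → x + w ∈ K)
    (hΩ : ∀ ε : ℝ, 0 < ε → ∃ r₀ : ℝ, 0 < r₀ ∧ ∀ w, ‖w‖ < r₀ → x + w ∈ Ω → -(ε * ‖w‖) ≤ ⟪w, n⟫) :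
    FillsNear Ω K x := by
  intro η hη
  obtain ⟨ε, hε, H⟩ := exists_volume_slab_le hn hη
  obtain ⟨r₀, hr₀, H₀⟩ := hΩ ε hε
  filter_upwards [Ioo_mem_nhdsGT (lt_min hr₀ hs)] with r hr
  refine le_trans (measureReal_mono ?_ ?_) (H x r hr.1)
  · rintro y ⟨⟨hyr, hyΩ⟩, hyK⟩
    have hy : x + (y - x) = y := by abel
    have hyr' : ‖y - x‖ < r := by rwa [Metric.mem_ball, dist_eq_norm] at hyr
    have hyr₀ : ‖y - x‖ < min r₀ s := hyr'.trans hr.2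
    have h1 := H₀ (y - x) (hyr₀.trans_le (min_le_left _ _)) (by rwa [hy])
    have h2 : ⟪y - x, n⟫ ≤ 0 := by
      by_contra! h
      exact hyK (by simpa [hy] using hK (y - x) (hyr₀.trans_le (min_le_right _ _)) h)
    refine ⟨hyr, ?_, h2⟩
    have : ε * ‖y - x‖ ≤ ε * r := by gcongr
    linarith
  · exact ((measure_mono Set.inter_subset_left).trans_lt measure_ball_lt_top).ne

/-- The cone property puts `Ω`, up to a thin slab, on the side of the hyperplane to which `e`
points. Each of `K` and `L` contains a half ball at `x`; they cannot both lie on the opposite side,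
since the interiors would meet, so one of them fills `Ω`. -/
lemma Mesh.exists_fillsNear (hK : K ∈ M.elements) (hL : L ∈ M.elements) (hne : K ≠ L)
    (hΩ : IsOpen Ω) {r κ : ℝ} (hU : UniformCone Ω r κ) (hx : x ∈ frontier Ω) {n : Vec d}
    (hn : ‖n‖ = 1) (ht : TangentApprox Ω x n) {s : ℝ} (hs : 0 < s)
    (hF : ∀ w, ⟪w, n⟫ = 0 → ‖w‖ < s → x + w ∈ K ∩ L) : FillsNear Ω K x ∨ FillsNear Ω L x := by
  obtain ⟨hr, hκ, hκ1, H⟩ := hU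
  obtain ⟨e, he, hc⟩ := H x hx
  wlog hpos : 0 < ⟪e, n⟫ generalizing n
  · have h0 := ht.inner_ne_zero hΩ hx hr hκ hκ1 he hc
    refine this (n := -n) (by rwa [norm_neg]) ht.neg (fun w hw => hF w (by simpa using hw)) ?_
    rw [inner_neg_right]
    exact neg_pos.mpr (lt_of_le_of_ne (not_lt.mp hpos) h0)
  have hdown : ∀ ε : ℝ, 0 < ε → ∃ r₀ : ℝ, 0 < r₀ ∧ ∀ w, ‖w‖ < r₀ → x + w ∈ Ω →
      -(ε * ‖w‖) ≤ ⟪w, n⟫ := fun ε hε => ht.neg_le_inner hΩ hn hr hκ hκ1 he hc hpos hε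
  obtain ⟨r₁, hr₁, H₁⟩ := M.exists_half_ball hK hn hs fun w h1 h2 => (hF w h1 h2).1
  obtain ⟨r₂, hr₂, H₂⟩ := M.exists_half_ball hL hn hs fun w h1 h2 => (hF w h1 h2).2
  rcases H₁ with H₁ | H₁
  · exact Or.inl (fillsNear_of_half_ball hn hr₁ H₁ hdown)
  rcases H₂ with H₂ | H₂
  · exact Or.inr (fillsNear_of_half_ball hn hr₂ H₂ hdown)
  exfalso
  set V : Set (Vec d) := Metric.ball x (min r₁ r₂) ∩ {y | ⟪y - x, n⟫ < 0} with hV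
  have hVo : IsOpen V := Metric.isOpen_ball.inter (isOpen_lt (by fun_prop) (by fun_prop))
  have hsub : ∀ y ∈ V, y ∈ K ∧ y ∈ L := by
    intro y hy
    have h1 : ‖y - x‖ < min r₁ r₂ := by
      have := hy.1
      rwa [Metric.mem_ball, dist_eq_norm] at this
    have h2 : x + (y - x) = y := by abel
    have h3 : ⟪y - x, n⟫ < 0 := hy.2
    have h4 := H₁ (y - x) (h1.trans_le (min_le_left _ _)) h3
    have h5 := H₂ (y - x) (h1.trans_le (min_le_right _ _)) h3
    rw [h2] at h4 h5
    exact ⟨h4, h5⟩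
  have hmin : 0 < min r₁ r₂ := lt_min hr₁ hr₂
  have hy : x - (min r₁ r₂ / 2) • n ∈ V := by
    refine ⟨?_, ?_⟩
    · rw [Metric.mem_ball, dist_eq_norm, sub_sub_cancel_left, norm_neg, norm_smul, hn, mul_one,
        Real.norm_eq_abs, abs_of_pos (by positivity)]
      linarith
    · show ⟪x - (min r₁ r₂ / 2) • n - x, n⟫ < 0
      rw [sub_sub_cancel_left, inner_neg_left, real_inner_smul_left, real_inner_self_eq_norm_sq, hn]
      linarith
  exact hne (M.eq_of_mem_interior hK hL (interior_maximal (fun y hy => (hsub y hy).1) hVo hy)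
    (interior_maximal (fun y hy => (hsub y hy).2) hVo hy))

/-- In a flat chart of a hyperplane containing `K ∩ L`, almost every boundary point on the face is a
Lebesgue density point of such points, which gives `TangentApprox`, and is relatively interior to
the face, because convex sets have null frontier. Intersections of lower dimension need no separate
treatment, as their chart preimage is null for the same reason. -/
lemma Mesh.hausdorff_not_fillsNear_eq_zero (hd : 0 < d) (hK : K ∈ M.elements) (hL : L ∈ M.elements)
    (hne : K ≠ L) (hΩ : IsOpen Ω) {r κ : ℝ} (hU : UniformCone Ω r κ) :
    (μHE[d - 1] : Measure (Vec d))
      {x | x ∈ frontier Ω ∩ (K ∩ L) ∧ ¬(FillsNear Ω K x ∨ FillsNear Ω L x)} = 0 := by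
  rcases (K ∩ L).eq_empty_or_nonempty with h | ⟨x₁, hx₁⟩
  · simp [h]
  obtain ⟨n, hn, hno⟩ := exists_norm_eq_one_mem_orthogonal
    (M.finrank_vectorSpan_inter_lt hd hK hL hne)
  obtain ⟨A, hA, hdec⟩ := exists_isometry_orthogonal hn
  set ψ : Vec (d - 1) → Vec d := fun y => x₁ + A y with hψ
  have hψi : Isometry ψ := isometry_chart A x₁
  set W := ψ ⁻¹' (frontier Ω ∩ (K ∩ L)) with hW
  have hFc : Convex ℝ (ψ ⁻¹' (K ∩ L)) := by
    have h1 : Convex ℝ (K ∩ L) := (M.convex hK).inter (M.convex hL)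
    exact (h1.translate_preimage_right x₁).linear_preimage A.toLinearMap
  have hFcl : IsClosed (ψ ⁻¹' (K ∩ L)) :=
    ((M.isClosed hK).inter (M.isClosed hL)).preimage hψi.continuous
  have hWm : MeasurableSet W :=
    ((isClosed_frontier.inter ((M.isClosed hK).inter (M.isClosed hL))).preimage
      hψi.continuous).measurableSet
  have hae : ∀ᵐ y ∂(volume : Measure (Vec (d - 1))), y ∈ W →
      FillsNear Ω K (ψ y) ∨ FillsNear Ω L (ψ y) := by
    have h1 := (ae_restrict_iff' hWm).mp
      (Besicovitch.ae_tendsto_measure_inter_div (volume : Measure (Vec (d - 1))) W)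
    have h2 : ∀ᵐ y ∂(volume : Measure (Vec (d - 1))), y ∉ frontier (ψ ⁻¹' (K ∩ L)) :=
      measure_eq_zero_iff_ae_notMem.mp (hFc.addHaar_frontier volume)
    filter_upwards [h1, h2] with y hy1 hy2 hyW
    have hyint : y ∈ interior (ψ ⁻¹' (K ∩ L)) := by
      by_contra h
      exact hy2 ⟨subset_closure hyW.2, h⟩
    obtain ⟨s, hs, hball⟩ := Metric.isOpen_iff.mp isOpen_interior y hyint
    have hlift : ∀ w, ⟪w, n⟫ = 0 → ∃ u, w = A u ∧ ‖u‖ = ‖w‖ := by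
      intro w hw
      obtain ⟨u, hu⟩ := hdec w
      rw [hw, zero_smul, add_zero] at hu
      exact ⟨u, hu, by rw [hu, A.norm_map]⟩
    have hψa : ∀ u, ψ y + A u = ψ (y + u) := fun u => by
      simp only [hψ, map_add]
      abel
    refine M.exists_fillsNear hK hL hne hΩ hU hyW.1 hn ?_ hs ?_
    · intro ε hε
      obtain ⟨r₀, hr₀, H⟩ := exists_dist_le_of_density hyW (hy1 hyW) hε
      refine ⟨r₀, hr₀, fun w hw hwr => ?_⟩
      obtain ⟨u, rfl, hu⟩ := hlift w hw
      obtain ⟨y', hy', hle⟩ := H (y + u) (by rwa [dist_eq_norm, add_sub_cancel_left, hu])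
      refine ⟨A (y' - y), ?_, ?_⟩
      · rw [hψa, add_sub_cancel]
        exact hy'.1
      · rw [← map_sub, A.norm_map, A.norm_map]
        rw [dist_eq_norm, dist_eq_norm, add_sub_cancel_left] at hle
        convert hle using 2
        abel
    · intro w hw hws
      obtain ⟨u, rfl, hu⟩ := hlift w hw
      rw [hψa]
      have : y + u ∈ ψ ⁻¹' (K ∩ L) := interior_subset (hball (by
        rwa [Metric.mem_ball, dist_eq_norm, add_sub_cancel_left, hu]))
      exact this
  rw [ae_iff] at hae
  refine measure_mono_null (t := ψ '' {y | ¬(y ∈ W → FillsNear Ω K (ψ y) ∨ FillsNear Ω L (ψ y))})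
    ?_ ((hausdorff_image_chart A x₁ _).trans hae)
  rintro x ⟨hx, hbad⟩
  obtain ⟨y, hy⟩ := hdec (x - x₁)
  rw [inner_sub_eq_zero_of_mem hno hx₁ hx.2, zero_smul, add_zero] at hy
  have hxy : ψ y = x := by
    simp only [hψ, ← hy]
    abel
  refine ⟨y, ?_, hxy⟩
  show ¬(y ∈ W → FillsNear Ω K (ψ y) ∨ FillsNear Ω L (ψ y))
  rw [hxy]
  intro h
  exact hbad (h (by rw [hW, Set.mem_preimage, hxy]; exact hx))

lemma UniformCone.exists_le_volume {r κ : ℝ} (hU : UniformCone Ω r κ) (hx : x ∈ frontier Ω) :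
    ∃ c : ℝ, 0 < c ∧ ∀ᶠ s in 𝓝[>] (0 : ℝ), c * s ^ d ≤ volume.real (Metric.ball x s ∩ Ω) := by
  obtain ⟨hr, hκ, hκ1, H⟩ := hU
  obtain ⟨e, he, hc⟩ := H x hx
  have hκ' : 0 < (1 - κ) / 8 := by linarith
  have hV : 0 < volume.real (Metric.ball (0 : Vec d) 1) :=
    ENNReal.toReal_pos (Metric.measure_ball_pos _ _ one_pos).ne' measure_ball_lt_top.ne
  refine ⟨((1 - κ) / 8) ^ d * volume.real (Metric.ball (0 : Vec d) 1), by positivity, ?_⟩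
  filter_upwards [Ioc_mem_nhdsGT hr] with s hs
  have h1 : volume.real (Metric.ball (x + (s / 2) • e) ((1 - κ) / 8 * s)) =
      ((1 - κ) / 8 * s) ^ d * volume.real (Metric.ball (0 : Vec d) 1) := by
    have := mul_pos hκ' hs.1
    rw [measureReal_def, Measure.addHaar_ball_of_pos _ _ this, finrank_euclideanSpace_fin,
      ENNReal.toReal_mul, ENNReal.toReal_ofReal (by positivity), measureReal_def]
  have h2 : ((1 - κ) / 8) ^ d * volume.real (Metric.ball (0 : Vec d) 1) * s ^ d =
      ((1 - κ) / 8 * s) ^ d * volume.real (Metric.ball (0 : Vec d) 1) := by rw [mul_pow]; ring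
  rw [h2, ← h1]
  refine measureReal_mono ?_ ((measure_mono Set.inter_subset_left).trans_lt measure_ball_lt_top).ne
  refine (ball_subset_truncatedCone x he hκ hκ1 hs.1).trans (Set.subset_inter Set.inter_subset_right ?_)
  exact hc.truncatedCone_subset (frontier_subset_closure hx) (by rw [dist_self]; linarith [hs.2]) hs.1

/-- The interior cone at `x` has volume comparable to `s ^ d`, so a set filling `Ω` up to density
zero must meet `Ω`. -/
lemma FillsNear.isActive {r κ : ℝ} (h : FillsNear Ω K x) (hU : UniformCone Ω r κ)
    (hx : x ∈ frontier Ω) : IsActive Ω K := by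
  by_contra hne
  obtain ⟨c, hc, H⟩ := hU.exists_le_volume hx
  obtain ⟨s, ⟨h1, h2⟩, hs⟩ := ((H.and (h (c / 2) (half_pos hc))).and self_mem_nhdsWithin).exists
  have hs0 : 0 < s := hs
  have h3 : (Metric.ball x s ∩ Ω) \ K = Metric.ball x s ∩ Ω :=
    Set.Subset.antisymm Set.sdiff_subset fun y hy => ⟨hy, fun hyK => hne ⟨y, hyK, hy.2⟩⟩
  rw [h3] at h2
  have : 0 < c * s ^ d := by positivity
  linarith

/-- At almost every boundary point, `Ω` is filled by one active element. -/
lemma Mesh.ae_exists_fillsNear (M : Mesh d) (hd : 0 < d) (hΩ : IsOpen Ω) (hcov : Ω ⊆ M.domain)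
    {r κ : ℝ} (hU : UniformCone Ω r κ) :
    ∀ᵐ x ∂(surfaceMeasure (frontier Ω)), ∃ K ∈ M.elements, IsActive Ω K ∧ x ∈ K ∧ FillsNear Ω K x := by
  rw [surfaceMeasure, ae_restrict_iff' isClosed_frontier.measurableSet]
  have h : ∀ᵐ x ∂(μHE[d - 1] : Measure (Vec d)), ∀ K ∈ M.elements, ∀ L ∈ M.elements, K ≠ L →
      ¬(x ∈ frontier Ω ∩ (K ∩ L) ∧ ¬(FillsNear Ω K x ∨ FillsNear Ω L x)) := by
    rw [Filter.eventually_all_finset]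
    intro K hK
    rw [Filter.eventually_all_finset]
    intro L hL
    rw [Filter.eventually_imp_distrib_left]
    intro hne
    exact measure_eq_zero_iff_ae_notMem.mp (M.hausdorff_not_fillsNear_eq_zero hd hK hL hne hΩ hU)
  filter_upwards [h] with x hx hxf
  suffices h : ∃ K ∈ M.elements, x ∈ K ∧ FillsNear Ω K x by
    obtain ⟨K, hK, hxK, hfill⟩ := h
    exact ⟨K, hK, hfill.isActive hU hxf, hxK, hfill⟩
  obtain ⟨K, ⟨hK, -⟩, hxK⟩ := Set.mem_iUnion₂.mp
    (closure_subset_activeDomain hcov (frontier_subset_closure hxf))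
  -- On a second element the null exceptional sets decide. If `x` lies in `K` alone, the other
  -- closed elements stay away from `x`, so `Ω` is contained in `K` near `x`.
  by_cases hL : ∃ L ∈ M.elements, K ≠ L ∧ x ∈ L
  · obtain ⟨L, hL, hne, hxL⟩ := hL
    have h1 := hx K hK L hL hne
    rw [not_and_not_right] at h1
    rcases h1 ⟨hxf, hxK, hxL⟩ with h2 | h2
    · exact ⟨K, hK, hxK, h2⟩
    · exact ⟨L, hL, hxL, h2⟩
  · push Not at hL
    refine ⟨K, hK, hxK, fun η hη => ?_⟩
    have h1 : ∀ᶠ y in 𝓝 x, ∀ L ∈ M.elements, K ≠ L → y ∉ L := by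
      rw [Filter.eventually_all_finset]
      intro L hLm
      rw [Filter.eventually_imp_distrib_left]
      intro hne
      exact (M.isClosed hLm).isOpen_compl.mem_nhds (hL L hLm hne)
    obtain ⟨s, hs, H⟩ := Metric.eventually_nhds_iff_ball.mp h1
    filter_upwards [Ioo_mem_nhdsGT hs] with r hr
    have hempty : (Metric.ball x r ∩ Ω) \ K = ∅ := by
      refine Set.eq_empty_of_forall_notMem ?_
      rintro y ⟨⟨hyr, hyΩ⟩, hyK⟩
      obtain ⟨L, hLm, hyL⟩ := Set.mem_iUnion₂.mp (hcov hyΩ)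
      refine H y (Metric.ball_subset_ball hr.2.le hyr) L hLm ?_ hyL
      rintro rfl
      exact hyK hyL
    rw [hempty, measureReal_empty]
    have := hr.1
    positivity

end Fills

/-! ### Traces of finite element fields -/

section FiniteElement

variable {d p : ℕ} {Ω ΓD : Set (Vec d)} {M : Mesh d} {v : Vec d → Vec d}
  {P : Set (Vec d) → Vec d → Vec d} {K L : Set (Vec d)} {x : Vec d}

lemma Mesh.surface_inter_lt_top (hd : 0 < d) (hK : K ∈ M.elements) (hL : L ∈ M.elements)
    (hne : K ≠ L) : (μHE[d - 1] : Measure (Vec d)) (K ∩ L) < ⊤ := by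
  rcases (K ∩ L).eq_empty_or_nonempty with h | ⟨x₁, hx₁⟩
  · simp [h]
  obtain ⟨n, hn, hno⟩ := exists_norm_eq_one_mem_orthogonal
    (M.finrank_vectorSpan_inter_lt hd hK hL hne)
  obtain ⟨A, hA, hdec⟩ := exists_isometry_orthogonal hn
  have hsub : K ∩ L ⊆ (fun y => x₁ + A y) '' ((fun y => x₁ + A y) ⁻¹' (K ∩ L)) := by
    intro x hx
    obtain ⟨y, hy⟩ := hdec (x - x₁)
    rw [inner_sub_eq_zero_of_mem hno hx₁ hx, zero_smul, add_zero] at hy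
    have hxy : x₁ + A y = x := by rw [← hy]; abel
    exact ⟨y, by rw [Set.mem_preimage, hxy]; exact hx, hxy⟩
  refine (measure_mono hsub).trans_lt ?_
  rw [hausdorff_image_chart]
  exact ((isometry_chart A x₁).isClosedEmbedding.isCompact_preimage
    ((M.isCompact hK).inter (M.isCompact hL))).measure_lt_top

lemma surfaceMeasure_univ_lt_top (hfin : (μHE[d - 1] : Measure (Vec d)) (frontier Ω) < ⊤)
    (hΓ : ΓD ⊆ frontier Ω) : IsFiniteMeasure (surfaceMeasure ΓD) :=
  ⟨by rw [surfaceMeasure, Measure.restrict_apply_univ]; exact (measure_mono hΓ).trans_lt hfin⟩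

lemma ae_surfaceMeasure_mono {Γ Γ' : Set (Vec d)} (h : Γ ⊆ Γ') {q : Vec d → Prop}
    (hq : ∀ᵐ x ∂(surfaceMeasure Γ'), q x) : ∀ᵐ x ∂(surfaceMeasure Γ), q x :=
  ae_mono (Measure.restrict_mono h le_rfl) hq

lemma IsPiecewise.hasTrace (hP : IsPiecewise p Ω M v P) (hΩ : IsOpen Ω) (hcov : Ω ⊆ M.domain)
    (hx : x ∈ frontier Ω) : HasTrace Ω v x (v x) := by
  have hxc := frontier_subset_closure hx
  refine hasTrace_of_tendsto hΩ hxc ((hP.continuousOn.mono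
    (subset_activeDomain hcov)).aestronglyMeasurable hΩ.measurableSet) ?_
  exact (hP.continuousOn x (closure_subset_activeDomain hcov hxc)).mono_left
    (nhdsWithin_mono _ (subset_activeDomain hcov))

/-- The piecewise gradient may jump at `x`, but the other elements occupy a part of `Ω` of density
zero there and do not affect the mean values. -/
lemma IsPiecewise.hasTrace_pwDeriv (hP : IsPiecewise p Ω M v P) (hΩ : IsOpen Ω)
    {r κ : ℝ} (hU : UniformCone Ω r κ) (hx : x ∈ frontier Ω) (hK : K ∈ M.elements)
    (hfill : FillsNear Ω K x) (n : Vec d) :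
    HasTrace Ω (pwDeriv M P n) x (dirDeriv n (P K) x) := by
  obtain ⟨B, -, hB⟩ := exists_bound_norm_pwDeriv hP n
  obtain ⟨c, hc, hlow⟩ := hU.exists_le_volume hx
  refine hasTrace_of_density hΩ (frontier_subset_closure hx) (M.isClosed hK).measurableSet hc
    (stronglyMeasurable_pwDeriv hP n) hB ((hP.poly K).dirDeriv n).continuous ?_ hlow hfill
  have h : ∀ᵐ y : Vec d, y ∉ frontier K :=
    measure_eq_zero_iff_ae_notMem.mp ((M.convex hK).addHaar_frontier volume)
  filter_upwards [h] with y hy hyK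
  refine pwDeriv_of_mem_interior hK ?_ n
  by_contra hni
  exact hy ⟨subset_closure hyK, hni⟩

lemma IsPiecewise.weakPartial_ae_eq (hP : IsPiecewise p Ω M v P) (hΩ : IsOpen Ω)
    (hcov : Ω ⊆ M.domain) (j : Fin d) :
    weakPartial Ω j v =ᵐ[volume.restrict Ω] pwDeriv M P (EuclideanSpace.single j 1) :=
  (hP.hasWeakDeriv hcov hΩ _).weakDeriv_ae_eq hΩ

/-- On an element, the gradient of a piecewise polynomial field is that of the polynomial. -/
lemma IsPiecewise.ae_gradIn_eq (hP : IsPiecewise p Ω M v P) (hΩ : IsOpen Ω)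
    (hcov : Ω ⊆ M.domain) : ∀ᵐ x ∂(volume.restrict Ω), ∀ K ∈ M.elements, x ∈ interior K →
      gradIn Ω v x = fun j => dirDeriv (EuclideanSpace.single j 1) (P K) x := by
  have h : ∀ᵐ x ∂(volume.restrict Ω), ∀ j, weakPartial Ω j v x =
      pwDeriv M P (EuclideanSpace.single j 1) x :=
    ae_all_iff.mpr fun j => hP.weakPartial_ae_eq hΩ hcov j
  filter_upwards [h] with x hx K hK hxK
  funext j
  rw [gradIn, hx j, pwDeriv_of_mem_interior hK hxK]

/-- At almost every boundary point, the trace of the gradient is the gradient on one active element. -/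
lemma IsPiecewise.ae_gradTrace_eq (hP : IsPiecewise p Ω M v P) (hd : 0 < d) (hΩ : IsOpen Ω)
    (hcov : Ω ⊆ M.domain) {r κ : ℝ} (hU : UniformCone Ω r κ) :
    ∀ᵐ x ∂(surfaceMeasure (frontier Ω)), ∃ K ∈ M.elements, IsActive Ω K ∧ x ∈ K ∧
      ∀ j, HasTrace Ω (weakPartial Ω j v) x (dirDeriv (EuclideanSpace.single j 1) (P K) x) := by
  filter_upwards [M.ae_exists_fillsNear hd hΩ hcov hU,
    ae_restrict_mem isClosed_frontier.measurableSet] with x ⟨K, hK, hKa, hxK, hfill⟩ hxf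
  exact ⟨K, hK, hKa, hxK, fun j => (hasTrace_congr (hP.weakPartial_ae_eq hΩ hcov j)).mpr
    (hP.hasTrace_pwDeriv hΩ hU hxf hK hfill _)⟩

lemma IsPiecewise.hasWeakDeriv_element (hP : IsPiecewise p Ω M v P) (hK : K ∈ M.elements)
    (hKa : IsActive Ω K) (n : Vec d) (l : ℕ) :
    HasWeakDeriv (interior K) n l v ((dirDeriv n)^[l] (P K)) :=
  (hasWeakDeriv_of_contDiff (hP.poly K).contDiff n l).congr isOpen_interior
    ((hP.eqOn K hK hKa).mono interior_subset)

lemma IsPiecewise.hasTrace_element (hP : IsPiecewise p Ω M v P) (hK : K ∈ M.elements)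
    (hKa : IsActive Ω K) (n : Vec d) (l : ℕ) (hx : x ∈ K) :
    HasTrace (interior K) (weakDeriv (interior K) n l v) x ((dirDeriv n)^[l] (P K) x) := by
  have hc := ((hP.poly K).iterate_dirDeriv n l).continuous
  rw [hasTrace_congr ((hP.hasWeakDeriv_element hK hKa n l).weakDeriv_ae_eq isOpen_interior)]
  refine hasTrace_of_tendsto isOpen_interior (by rwa [M.closure_interior hK])
    hc.aestronglyMeasurable ((hc.tendsto x).mono_left nhdsWithin_le_nhds)

lemma IsPiecewise.normalJump_eq (hP : IsPiecewise p Ω M v P) (hK : K ∈ M.elements)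
    (hKa : IsActive Ω K) (hL : L ∈ M.elements) (hLa : IsActive Ω L) (l : ℕ) (hx : x ∈ K ∩ L) :
    normalJump K L l v x = (dirDeriv (faceNormal (K ∩ L)))^[l] (P K) x -
      (dirDeriv (faceNormal (K ∩ L)))^[l] (P L) x := by
  rw [normalJump, (hP.hasTrace_element hK hKa _ l hx.1).trace_eq,
    (hP.hasTrace_element hL hLa _ l hx.2).trace_eq]

lemma IsPiecewise.hasL2Trace_element (hP : IsPiecewise p Ω M v P) (hK : K ∈ M.elements)
    (hKa : IsActive Ω K) (n : Vec d) (l : ℕ) {F : Set (Vec d)} (hF : IsClosed F) (hFK : F ⊆ K)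
    (hfin : (μHE[d - 1] : Measure (Vec d)) F < ⊤) :
    HasL2Trace (interior K) (weakDeriv (interior K) n l v) F := by
  have hc := ((hP.poly K).iterate_dirDeriv n l).continuous
  obtain ⟨B, hB⟩ := (M.isCompact hK).exists_bound_of_continuousOn hc.continuousOn
  have hm := ae_restrict_mem (μ := (μHE[d - 1] : Measure (Vec d))) hF.measurableSet
  have : IsFiniteMeasure (surfaceMeasure F) :=
    ⟨by rw [surfaceMeasure, Measure.restrict_apply_univ]; exact hfin⟩
  refine ⟨?_, ?_⟩
  · filter_upwards [hm] with x hx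
    exact ⟨_, hP.hasTrace_element hK hKa n l (hFK hx)⟩
  · have h : MemLp ((dirDeriv n)^[l] (P K)) 2 (surfaceMeasure F) := by
      refine MemLp.of_bound hc.aestronglyMeasurable B ?_
      filter_upwards [hm] with x hx
      exact hB x (hFK hx)
    refine h.ae_eq ?_
    filter_upwards [hm] with x hx
    exact (hP.hasTrace_element hK hKa n l (hFK hx)).trace_eq.symm

/-- Finite element fields belong to the space on which the forms are defined. -/
theorem feSpace_subset_contSpace (hd : 0 < d) (hΩ : IsOpen Ω) (hb : Bornology.IsBounded Ω)
    {r κ : ℝ} (hU : UniformCone Ω r κ) (hΓ : ΓD ⊆ frontier Ω) (hΓm : MeasurableSet ΓD)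
    (hcov : Ω ⊆ M.domain) (hv : v ∈ feSpace p Ω M) : v ∈ contSpace p Ω ΓD M := by
  obtain ⟨P, hP⟩ := exists_isPiecewise hv
  have hfinΩ : IsFiniteMeasure (volume.restrict Ω) :=
    ⟨by rw [Measure.restrict_apply_univ]; exact hb.measure_lt_top⟩
  have hfinΓ : IsFiniteMeasure (surfaceMeasure ΓD) :=
    surfaceMeasure_univ_lt_top (hU.surface_frontier_lt_top hΩ hb) hΓ
  have hmΓ : ∀ᵐ x ∂(surfaceMeasure ΓD), x ∈ ΓD := ae_restrict_mem hΓm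
  obtain ⟨B, hB⟩ := hb.isCompact_closure.exists_bound_of_continuousOn
    (hP.continuousOn.mono (closure_subset_activeDomain hcov))
  have hvm : AEStronglyMeasurable v (volume.restrict Ω) :=
    (hP.continuousOn.mono (subset_activeDomain hcov)).aestronglyMeasurable hΩ.measurableSet
  have hLp : ∀ n, MemLp (pwDeriv M P n) 2 (volume.restrict Ω) := fun n => by
    obtain ⟨B', -, hB'⟩ := exists_bound_norm_pwDeriv hP n
    exact MemLp.of_bound (stronglyMeasurable_pwDeriv hP n).aestronglyMeasurable B'
      (Eventually.of_forall hB')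
  refine ⟨MemLp.of_bound hvm B ?_, fun j => ⟨⟨_, hP.hasWeakDeriv hcov hΩ _⟩, ?_⟩, ⟨?_, ?_⟩,
    fun j => ⟨?_, ?_⟩, fun K hK L hL hst l hl => ⟨⟨_, hP.hasWeakDeriv_element hK hst.1 _ l⟩, ?_, ?_⟩⟩
  · exact ae_restrict_of_forall_mem hΩ.measurableSet fun x hx => hB x (subset_closure hx)
  · exact (hLp _).ae_eq (hP.weakPartial_ae_eq hΩ hcov j).symm
  · filter_upwards [hmΓ] with x hx
    exact ⟨_, hP.hasTrace hΩ hcov (hΓ hx)⟩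
  · refine MemLp.of_bound (aestronglyMeasurable_trace hΩ hvm ?_) B ?_
    · filter_upwards [hmΓ] with x hx
      exact ⟨_, hP.hasTrace hΩ hcov (hΓ hx)⟩
    · filter_upwards [hmΓ] with x hx
      rw [(hP.hasTrace hΩ hcov (hΓ hx)).trace_eq]
      exact hB x (frontier_subset_closure (hΓ hx))
  · filter_upwards [ae_surfaceMeasure_mono hΓ (hP.ae_gradTrace_eq hd hΩ hcov hU)]
      with x ⟨K, _, _, _, h⟩
    exact ⟨_, h j⟩
  · obtain ⟨B', -, hB'⟩ := exists_bound_pwDeriv hP (EuclideanSpace.single j 1)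
    have hae := ae_surfaceMeasure_mono hΓ (hP.ae_gradTrace_eq hd hΩ hcov hU)
    refine MemLp.of_bound (aestronglyMeasurable_trace hΩ
      (((hLp _).ae_eq (hP.weakPartial_ae_eq hΩ hcov j).symm).aestronglyMeasurable) ?_) B' ?_
    · filter_upwards [hae] with x ⟨K, _, _, _, h⟩
      exact ⟨_, h j⟩
    · filter_upwards [hae] with x ⟨K, hK, _, hxK, h⟩
      rw [(h j).trace_eq]
      exact hB' K hK x hxK
  · have hc := ((hP.poly K).iterate_dirDeriv (faceNormal (K ∩ L)) l).continuous
    obtain ⟨B', hB'⟩ := (M.isCompact hK).exists_bound_of_continuousOn hc.continuousOn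
    have : IsFiniteMeasure (volume.restrict (interior K)) :=
      ⟨by rw [Measure.restrict_apply_univ]
          exact (measure_mono interior_subset).trans_lt (M.isCompact hK).measure_lt_top⟩
    refine MemLp.ae_eq ((hP.hasWeakDeriv_element hK hst.1 _ l).weakDeriv_ae_eq isOpen_interior).symm
      (MemLp.of_bound hc.aestronglyMeasurable B' ?_)
    exact ae_restrict_of_forall_mem isOpen_interior.measurableSet
      fun x hx => hB' x (interior_subset hx)
  · exact hP.hasL2Trace_element hK hst.1 _ l ((M.isClosed hK).inter (M.isClosed hL))
      Set.inter_subset_left (M.surface_inter_lt_top hd hK hL hst.2.2.1.1)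

end FiniteElement

/-! ### Polynomial estimates -/

section PolyEstimates

variable {d p : ℕ}

/-- The squared norm of the strain of `q`. -/
def strainSq (q : Vec d → Vec d) (x : Vec d) : ℝ :=
  frob (strain fun j => dirDeriv (EuclideanSpace.single j 1) q x)
    (strain fun j => dirDeriv (EuclideanSpace.single j 1) q x)

lemma strainSq_eq_sum (q : Vec d → Vec d) (x : Vec d) : strainSq q x = ∑ i, ∑ j,
    (strain (fun j => dirDeriv (EuclideanSpace.single j 1) q x) i j) ^ 2 := by
  simp only [strainSq, frob, sq]

lemma PolyField.strain {q : Vec d → Vec d} (hq : PolyField p q) (i j : Fin d) :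
    PolyFun p fun x => CutFEM.strain (fun j => CutFEM.dirDeriv (EuclideanSpace.single j 1) q x) i j :=
  (((hq.dirDeriv _) i).add ((hq.dirDeriv _) j)).const_mul _

lemma PolyField.sub {q q' : Vec d → Vec d} (hq : PolyField p q) (hq' : PolyField p q') :
    PolyField p (q - q') := fun i => (hq i).sub (hq' i)

lemma dirDeriv_sub {q q' : Vec d → Vec d} (hq : PolyField p q) (hq' : PolyField p q') (n : Vec d) :
    dirDeriv n (q - q') = dirDeriv n q - dirDeriv n q' := by
  funext x
  have h : fderiv ℝ (q - q') x = _ := fderiv_sub (hq.contDiff.differentiable (by simp) x)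
    (hq'.contDiff.differentiable (by simp) x)
  rw [dirDeriv, h]
  rfl

lemma iterate_dirDeriv_sub {q q' : Vec d → Vec d} (hq : PolyField p q) (hq' : PolyField p q')
    (n : Vec d) (l : ℕ) :
    (dirDeriv n)^[l] (q - q') = (dirDeriv n)^[l] q - (dirDeriv n)^[l] q' := by
  induction l generalizing q q' with
  | zero => rfl
  | succ l ih =>
    rw [Function.iterate_succ_apply, Function.iterate_succ_apply, Function.iterate_succ_apply,
      dirDeriv_sub hq hq', ih (hq.dirDeriv n) (hq'.dirDeriv n)]

lemma strainSq_le_two_mul_add {q q' : Vec d → Vec d} (hq : PolyField p q) (hq' : PolyField p q')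
    (x : Vec d) : strainSq q x ≤ 2 * strainSq q' x + 2 * strainSq (q - q') x := by
  rw [strainSq_eq_sum, strainSq_eq_sum, strainSq_eq_sum, Finset.mul_sum, Finset.mul_sum,
    ← Finset.sum_add_distrib]
  refine Finset.sum_le_sum fun i _ => ?_
  rw [Finset.mul_sum, Finset.mul_sum, ← Finset.sum_add_distrib]
  refine Finset.sum_le_sum fun j _ => ?_
  simp only [strain, Matrix.of_apply, dirDeriv_sub hq hq', Pi.sub_apply, PiLp.sub_apply]
  set a := dirDeriv (EuclideanSpace.single j 1) q x i
  set b := dirDeriv (EuclideanSpace.single i 1) q x j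
  set a' := dirDeriv (EuclideanSpace.single j 1) q' x i
  set b' := dirDeriv (EuclideanSpace.single i 1) q' x j
  nlinarith [sq_nonneg (a + b - 2 * (a' + b'))]

lemma strainSq_le_sum (q : Vec d → Vec d) (x : Vec d) :
    strainSq q x ≤ ∑ i, ∑ j, (dirDeriv (EuclideanSpace.single j 1) q x i) ^ 2 := by
  have h : ∀ i j, (strain (fun j => dirDeriv (EuclideanSpace.single j 1) q x) i j) ^ 2 ≤
      (1 / 2) * (dirDeriv (EuclideanSpace.single j 1) q x i) ^ 2 +
      (1 / 2) * (dirDeriv (EuclideanSpace.single i 1) q x j) ^ 2 := by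
    intro i j
    simp only [strain, Matrix.of_apply]
    nlinarith [sq_nonneg (dirDeriv (EuclideanSpace.single j 1) q x i -
      dirDeriv (EuclideanSpace.single i 1) q x j)]
  rw [strainSq_eq_sum]
  refine (Finset.sum_le_sum fun i _ => Finset.sum_le_sum fun j _ => h i j).trans (le_of_eq ?_)
  simp only [Finset.sum_add_distrib, ← Finset.mul_sum]
  rw [Finset.sum_comm (f := fun i j => (dirDeriv (EuclideanSpace.single i 1) q x j) ^ 2)]
  ring

/-- The strain of a polynomial field on a ball is controlled by its strain on a large subset. -/
lemma exists_strainSq_le_integral (d p : ℕ) (R : ℝ) {c : ℝ} (hc : 0 < c) :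
    ∃ C : ℝ, 0 < C ∧ ∀ h : ℝ, 0 < h → ∀ (y : Vec d) (q : Vec d → Vec d), PolyField p q →
      ∀ E : Set (Vec d), MeasurableSet E → E ⊆ Metric.closedBall y (R * h) →
      ENNReal.ofReal (c * h ^ d) ≤ volume E → ∀ x ∈ Metric.closedBall y (R * h),
      strainSq q x ≤ C * (h ^ d)⁻¹ * ∫ z in E, strainSq q z := by
  obtain ⟨C, hC, H⟩ := exists_sq_le_integral_sq d p R hc
  refine ⟨C, hC, fun h hh y q hq E hE hEb hvol x hx => ?_⟩
  have hint : ∀ i j, IntegrableOn (fun z =>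
      (strain (fun j => dirDeriv (EuclideanSpace.single j 1) q z) i j) ^ 2) E := fun i j =>
    (((hq.strain i j).continuous.pow 2).continuousOn.integrableOn_compact
      (isCompact_closedBall y (R * h))).mono_set hEb
  simp only [strainSq_eq_sum]
  rw [integral_finsetSum _ fun i _ => integrable_finsetSum _ fun j _ => hint i j, Finset.mul_sum]
  refine Finset.sum_le_sum fun i _ => ?_
  rw [integral_finsetSum _ fun j _ => hint i j, Finset.mul_sum]
  exact Finset.sum_le_sum fun j _ => H h hh y _ (hq.strain i j) E hE hEb hvol x hx

/-! ### Estimates across a face -/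

lemma setIntegral_image_chart {k : ℕ} (A : Vec k →ₗᵢ[ℝ] Vec d) (x₀ : Vec d) (f : Vec d → ℝ)
    (E : Set (Vec k)) :
    ∫ x in (fun y => x₀ + A y) '' E, f x ∂(μHE[k] : Measure (Vec d)) = ∫ y in E, f (x₀ + A y) := by
  have hi := isometry_chart A x₀
  have h1 := hi.map_euclideanHausdorffMeasure (d := k)
  rw [EuclideanSpace.euclideanHausdorffMeasure_eq_volume] at h1
  have h2 := hi.isClosedEmbedding.measurableEmbedding.setIntegral_map (μ := volume) f
    ((fun y => x₀ + A y) '' E)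
  rw [hi.injective.preimage_image, h1, Measure.restrict_restrict_of_subset
    (Set.image_subset_range _ _)] at h2
  exact h2

/-- Dimension count: the direction space of a `(d-1)`-dimensional face is the whole orthogonal
complement of its normal. -/
lemma mem_affineSpan_of_inner_eq_zero {F : Set (Vec d)} {n x₀ x : Vec d} (hn : ‖n‖ = 1)
    (hno : n ∈ (vectorSpan ℝ F)ᗮ) (hdim : Module.finrank ℝ (vectorSpan ℝ F) + 1 = d) (hx₀ : x₀ ∈ F)
    (hx : ⟪x - x₀, n⟫ = 0) : x ∈ affineSpan ℝ F := by
  have hn0 : n ≠ 0 := by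
    rintro rfl
    simp at hn
  have hle : vectorSpan ℝ F ≤ (ℝ ∙ n)ᗮ := by
    intro w hw
    rw [Submodule.mem_orthogonal_singleton_iff_inner_left]
    exact (Submodule.mem_orthogonal _ _).mp hno w hw
  have hfin : Module.finrank ℝ ((ℝ ∙ n)ᗮ : Submodule ℝ (Vec d)) + 1 = d := by
    have h1 := Submodule.finrank_add_finrank_orthogonal (ℝ ∙ n)
    rw [finrank_span_singleton hn0, finrank_euclideanSpace_fin] at h1
    omega
  have heq := Submodule.eq_of_le_of_finrank_eq hle (by omega)
  have hmem : x - x₀ ∈ vectorSpan ℝ F := by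
    rw [heq, Submodule.mem_orthogonal_singleton_iff_inner_left]
    exact hx
  have := AffineSubspace.vadd_mem_of_mem_direction (s := affineSpan ℝ F)
    (by rwa [direction_affineSpan]) (subset_affineSpan ℝ F hx₀)
  simpa using this

/-- A polynomial which vanishes on a face is controlled by its normal derivatives on the face. -/
lemma exists_sq_le_face (hd : 0 < d) (p : ℕ) {ρ R : ℝ} (hρ : 0 < ρ) (hR : 1 ≤ R) :
    ∃ C : ℝ, 0 < C ∧ ∀ h : ℝ, 0 < h → ∀ (F : Set (Vec d)) (n x₀ : Vec d), IsCompact F →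
      (μHE[d - 1] : Measure (Vec d)) F < ⊤ → ‖n‖ = 1 →
      (∀ x, ‖x - x₀‖ ≤ ρ * h → ⟪x - x₀, n⟫ = 0 → x ∈ F) →
      ∀ q : Vec d → ℝ, PolyFun p q → (∀ x ∈ F, q x = 0) → ∀ x ∈ Metric.closedBall x₀ (R * h),
      q x ^ 2 ≤ C * (h ^ d)⁻¹ * ∑ l ∈ Finset.Icc 1 p, h ^ (2 * l + 1) *
        ∫ z, ((dirDeriv n)^[l] q z) ^ 2 ∂(surfaceMeasure F) := by
  set V := volume.real (Metric.closedBall (0 : Vec (d - 1)) 1) with hV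
  have hV0 : 0 < V := ENNReal.toReal_pos (Metric.measure_closedBall_pos _ _ one_pos).ne'
    (isCompact_closedBall _ _).measure_lt_top.ne
  obtain ⟨C₀, hC₀, H⟩ := exists_sq_le_integral_sq (d - 1) p (R + ρ)
    (by positivity : 0 < ρ ^ (d - 1) * V)
  have hR0 : 0 < R := by linarith
  refine ⟨(p + 1) * R ^ (2 * p) * C₀, by positivity,
    fun h hh F n x₀ hF hfin hn hball q hq hq0 x hx => ?_⟩
  obtain ⟨A, hA, hdec⟩ := exists_isometry_orthogonal hn
  set E := Metric.closedBall (0 : Vec (d - 1)) (ρ * h) with hE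
  have hEF : (fun y => x₀ + A y) '' E ⊆ F := by
    rintro _ ⟨u, hu, rfl⟩
    refine hball _ ?_ ?_
    · rw [add_sub_cancel_left, A.norm_map]
      rwa [hE, mem_closedBall_zero_iff] at hu
    · rw [add_sub_cancel_left, hA]
  have hEvol : ENNReal.ofReal (ρ ^ (d - 1) * V * h ^ (d - 1)) ≤ volume E := by
    rw [hE, Measure.addHaar_closedBall' _ _ (by positivity), finrank_euclideanSpace_fin, mul_right_comm,
      ← mul_pow, ENNReal.ofReal_mul (by positivity), hV, measureReal_def,
      ENNReal.ofReal_toReal (isCompact_closedBall _ _).measure_lt_top.ne]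
  -- Norm equivalence in dimension `d - 1`: the disc contained in the face controls the polynomial
  -- on a larger disc of the hyperplane.
  have key : ∀ g : Vec d → ℝ, PolyFun p g → ∀ u, ‖u‖ ≤ R * h →
      g (x₀ + A u) ^ 2 ≤ C₀ * (h ^ (d - 1))⁻¹ * ∫ z, g z ^ 2 ∂(surfaceMeasure F) := by
    intro g hg u hu
    have hpow := hg.comp_affine x₀ A.toLinearMap
    refine (H h hh 0 _ hpow E Metric.isClosed_closedBall.measurableSet
      (Metric.closedBall_subset_closedBall (by nlinarith)) hEvol u
      (by rw [mem_closedBall_zero_iff]; nlinarith)).trans ?_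
    gcongr
    have h1 := setIntegral_image_chart A x₀ (fun z => g z ^ 2) E
    refine le_of_eq_of_le h1.symm ?_
    refine setIntegral_mono_set ?_ (Eventually.of_forall fun z => sq_nonneg _) hEF.eventuallyLE
    have : IsFiniteMeasure ((μHE[d - 1] : Measure (Vec d)).restrict F) :=
      ⟨by rwa [Measure.restrict_apply_univ]⟩
    obtain ⟨B, hB⟩ := hF.exists_bound_of_continuousOn (hg.continuous.pow 2).continuousOn
    exact Integrable.of_bound (hg.continuous.pow 2).aestronglyMeasurable B
      (ae_restrict_of_forall_mem hF.measurableSet hB)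
  obtain ⟨u, hu⟩ := hdec (x - x₀)
  set t := ⟪x - x₀, n⟫ with ht
  rw [Metric.mem_closedBall, dist_eq_norm] at hx
  have htR : |t| ≤ R * h := by
    have := abs_real_inner_le_norm (x - x₀) n
    rw [hn, mul_one] at this
    exact this.trans hx
  have huR : ‖u‖ ≤ R * h := by
    refine le_trans ?_ hx
    have h1 := norm_sub_inner_smul_sq hn (x - x₀)
    rw [← ht, sub_eq_of_eq_add hu, A.norm_map] at h1
    refine (pow_le_pow_iff_left₀ (norm_nonneg _) (norm_nonneg _) two_ne_zero).mp ?_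
    nlinarith [sq_nonneg t]
  have hxu : x = (x₀ + A u) + t • n := by
    rw [add_assoc, ← hu]
    abel
  have hq1 : q x = _ := (congrArg q hxu).trans (hq.taylor_line (x₀ + A u) n t)
  set a : ℕ → ℝ := fun l => t ^ l / (l.factorial : ℝ) * (dirDeriv n)^[l] q (x₀ + A u) with ha
  -- Vanishing on the face forces vanishing on the relevant part of the hyperplane, so the Taylor
  -- sum starts at `l = 1`.
  have ha0 : a 0 = 0 := by
    have h1 := key q hq u huR
    have h2 : ∫ z, q z ^ 2 ∂(surfaceMeasure F) = 0 := by
      refine integral_eq_zero_of_ae ?_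
      refine ae_restrict_of_forall_mem hF.measurableSet fun z hz => ?_
      simp [hq0 z hz]
    rw [h2, mul_zero] at h1
    have h3 : q (x₀ + A u) = 0 := by
      have := sq_nonneg (q (x₀ + A u))
      exact pow_eq_zero_iff two_ne_zero |>.mp (le_antisymm h1 this)
    simp [ha, h3]
  have hal : ∀ l ∈ Finset.Icc 1 p, a l ^ 2 ≤ R ^ (2 * p) * C₀ * (h ^ d)⁻¹ * (h ^ (2 * l + 1) *
      ∫ z, ((dirDeriv n)^[l] q z) ^ 2 ∂(surfaceMeasure F)) := by
    intro l hl
    have hlp := (Finset.mem_Icc.mp hl).2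
    set I := ∫ z, ((dirDeriv n)^[l] q z) ^ 2 ∂(surfaceMeasure F) with hI
    have hI0 : 0 ≤ I := integral_nonneg fun _ => sq_nonneg _
    have h1 := key _ (hq.iterate_dirDeriv n l) u huR
    have h2 : (t ^ l / (l.factorial : ℝ)) ^ 2 ≤ R ^ (2 * p) * h ^ (2 * l) := by
      have hf : (1 : ℝ) ≤ l.factorial := by exact_mod_cast Nat.one_le_iff_ne_zero.mpr l.factorial_ne_zero
      have h3 : |t ^ l / (l.factorial : ℝ)| ≤ (R * h) ^ l := by
        rw [abs_div, abs_pow, abs_of_pos (by positivity : (0 : ℝ) < l.factorial)]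
        refine (div_le_self (by positivity) hf).trans ?_
        gcongr
      rw [← sq_abs]
      calc |t ^ l / (l.factorial : ℝ)| ^ 2 ≤ ((R * h) ^ l) ^ 2 := by gcongr
        _ = R ^ (2 * l) * h ^ (2 * l) := by rw [mul_pow, mul_pow]; ring
        _ ≤ R ^ (2 * p) * h ^ (2 * l) := by
            gcongr
    -- The extra `h` turns the factor `h ^ (2 * l)` of the Taylor term into the weight `h ^ (2 * l +
    -- 1)` of the stabilization.
    have h4 : (h ^ (d - 1))⁻¹ = (h ^ d)⁻¹ * h := by
      obtain ⟨m, rfl⟩ := Nat.exists_eq_succ_of_ne_zero hd.ne'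
      rw [Nat.succ_sub_one, pow_succ]
      field_simp
    calc a l ^ 2 = (t ^ l / (l.factorial : ℝ)) ^ 2 * ((dirDeriv n)^[l] q (x₀ + A u)) ^ 2 := by
          rw [ha, mul_pow]
      _ ≤ (R ^ (2 * p) * h ^ (2 * l)) * (C₀ * (h ^ (d - 1))⁻¹ * I) := by gcongr
      _ = _ := by rw [h4]; ring
  have hsub : Finset.Icc 1 p ⊆ Finset.range (p + 1) := fun l hl => by
    rw [Finset.mem_Icc] at hl
    rw [Finset.mem_range]
    omega
  have hz : ∀ l ∈ Finset.range (p + 1), l ∉ Finset.Icc 1 p → a l ^ 2 = 0 := by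
    intro l hl hl'
    have : l = 0 := by
      rw [Finset.mem_range] at hl
      rw [Finset.mem_Icc] at hl'
      omega
    rw [this, ha0]
    norm_num
  rw [hq1]
  calc (∑ l ∈ Finset.range (p + 1), a l) ^ 2
      ≤ (Finset.range (p + 1)).card * ∑ l ∈ Finset.range (p + 1), a l ^ 2 := sq_sum_le_card_mul_sum_sq
    _ = (p + 1) * ∑ l ∈ Finset.Icc 1 p, a l ^ 2 := by
        rw [Finset.sum_subset hsub hz, Finset.card_range]
        push_cast
        rfl
    _ ≤ (p + 1) * ∑ l ∈ Finset.Icc 1 p, R ^ (2 * p) * C₀ * (h ^ d)⁻¹ * (h ^ (2 * l + 1) *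
          ∫ z, ((dirDeriv n)^[l] q z) ^ 2 ∂(surfaceMeasure F)) := by
        gcongr with l hl
        exact hal l hl
    _ = _ := by rw [← Finset.mul_sum]; ring

/-- The strain of a polynomial field which vanishes on a face is controlled by its normal derivatives on
the face. -/
lemma exists_strainSq_le_face (hd : 0 < d) (p : ℕ) {ρ R : ℝ} (hρ : 0 < ρ) (hR : 1 ≤ R) :
    ∃ C : ℝ, 0 < C ∧ ∀ h : ℝ, 0 < h → ∀ (F : Set (Vec d)) (n x₀ y : Vec d), IsCompact F →
      (μHE[d - 1] : Measure (Vec d)) F < ⊤ → ‖n‖ = 1 → x₀ ∈ Metric.closedBall y (R * h) →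
      (∀ x, ‖x - x₀‖ ≤ ρ * h → ⟪x - x₀, n⟫ = 0 → x ∈ F) →
      ∀ q : Vec d → Vec d, PolyField p q → (∀ x ∈ F, q x = 0) → ∀ x ∈ Metric.closedBall y (R * h),
      strainSq q x ≤ C * (h ^ 2)⁻¹ * (h ^ d)⁻¹ * ∑ l ∈ Finset.Icc 1 p, h ^ (2 * l + 1) *
        ∫ z, ⟪(dirDeriv n)^[l] q z, (dirDeriv n)^[l] q z⟫ ∂(surfaceMeasure F) := by
  obtain ⟨C₁, hC₁, H₁⟩ := exists_sq_le_face hd p hρ (by linarith : 1 ≤ 2 * R)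
  obtain ⟨C₂, hC₂, H₂⟩ := exists_dirDeriv_sq_le d p (by linarith : 0 < R)
  have hd' : (0 : ℝ) < d := by exact_mod_cast hd
  refine ⟨d * C₂ * C₁, by positivity,
    fun h hh F n x₀ y hF hfin hn hx₀ hball q hq hq0 x hx => ?_⟩
  set s : Fin d → ℝ := fun i => C₁ * (h ^ d)⁻¹ * ∑ l ∈ Finset.Icc 1 p, h ^ (2 * l + 1) *
    ∫ z, ((dirDeriv n)^[l] (fun x => q x i) z) ^ 2 ∂(surfaceMeasure F) with hs
  have hi : ∀ i, ∀ x ∈ Metric.closedBall y (R * h), q x i ^ 2 ≤ s i := by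
    intro i x hx
    refine H₁ h hh F n x₀ hF hfin hn hball _ (hq i) (fun z hz => by simp [hq0 z hz]) x ?_
    rw [Metric.mem_closedBall] at *
    linarith [dist_triangle_right x x₀ y]
  have hij : ∀ i j, (dirDeriv (EuclideanSpace.single j 1) q x i) ^ 2 ≤ C₂ * (h ^ 2)⁻¹ * s i := by
    intro i j
    rw [dirDeriv_apply (hq.contDiff.differentiable (by simp))]
    exact H₂ h hh y _ (hq i) _ (by simp) (s i) (hi i) x hx
  have hfinm : IsFiniteMeasure (surfaceMeasure F) :=
    ⟨by rwa [surfaceMeasure, Measure.restrict_apply_univ]⟩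
  have hint : ∀ l i, Integrable (fun z => ((dirDeriv n)^[l] (fun x => q x i) z) ^ 2)
      (surfaceMeasure F) := by
    intro l i
    have hc := ((hq i).iterate_dirDeriv n l).continuous.pow 2
    obtain ⟨B, hB⟩ := hF.exists_bound_of_continuousOn hc.continuousOn
    exact Integrable.of_bound hc.aestronglyMeasurable B (ae_restrict_of_forall_mem hF.measurableSet hB)
  have hsum : ∑ i, s i = C₁ * (h ^ d)⁻¹ * ∑ l ∈ Finset.Icc 1 p, h ^ (2 * l + 1) *
      ∫ z, ⟪(dirDeriv n)^[l] q z, (dirDeriv n)^[l] q z⟫ ∂(surfaceMeasure F) := by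
    simp only [hs]
    rw [← Finset.mul_sum, Finset.sum_comm]
    congr 1
    refine Finset.sum_congr rfl fun l _ => ?_
    rw [← Finset.mul_sum, ← integral_finsetSum _ fun i _ => hint l i]
    congr 1
    refine integral_congr_ae (Eventually.of_forall fun z => ?_)
    simp only [real_inner_self_eq_norm_sq, EuclideanSpace.norm_sq_eq, Real.norm_eq_abs, sq_abs,
      hq.iterate_dirDeriv_apply]
  calc strainSq q x ≤ ∑ i, ∑ j, (dirDeriv (EuclideanSpace.single j 1) q x i) ^ 2 :=
        strainSq_le_sum q x
    _ ≤ ∑ i, ∑ _j : Fin d, C₂ * (h ^ 2)⁻¹ * s i :=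
        Finset.sum_le_sum fun i _ => Finset.sum_le_sum fun j _ => hij i j
    _ = d * (C₂ * (h ^ 2)⁻¹ * ∑ i, s i) := by
        simp only [Finset.sum_const, Finset.card_univ, Fintype.card_fin, nsmul_eq_mul]
        rw [← Finset.mul_sum, ← Finset.mul_sum]
    _ = _ := by rw [hsum]; ring

end PolyEstimates

/-! ### The strain on cut elements -/

section CutElements

variable {d p : ℕ} {Ω ΓD : Set (Vec d)} {ρ h₀ r κ : ℝ}

/-- The squared norm of the strain over the part of an element in the domain. -/
def elementEnergy (Ω : Set (Vec d)) (v : Vec d → Vec d) (L : Set (Vec d)) : ℝ :=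
  ∫ x in interior L ∩ Ω, frob (strain (gradIn Ω v x)) (strain (gradIn Ω v x))

open Classical in
/-- The contribution of an element to the stabilized energy. -/
def localEnergy (p : ℕ) (Ω : Set (Vec d)) (M : Mesh d) (h : ℝ) (v : Vec d → Vec d)
    (L : Set (Vec d)) : ℝ :=
  elementEnergy Ω v L + (h ^ 2)⁻¹ * ∑ L' ∈ M.elements,
    if IsStabilized Ω L L' then faceForm p h L L' v v else 0

open Classical in
/-- The elements at distance at most `s` from `K`. -/
def Mesh.near (M : Mesh d) (s : ℝ) (K : Set (Vec d)) : Finset (Set (Vec d)) :=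
  M.elements.filter fun L => ∃ a ∈ K, ∃ b ∈ L, dist a b ≤ s

lemma elementEnergy_nonneg (Ω : Set (Vec d)) (v : Vec d → Vec d) (L : Set (Vec d)) :
    0 ≤ elementEnergy Ω v L := integral_nonneg fun _ => frob_self_nonneg _

lemma sum_faceForm_nonneg (p : ℕ) (Ω : Set (Vec d)) (M : Mesh d) {h : ℝ} (hh : 0 < h)
    (v : Vec d → Vec d) (L : Set (Vec d)) :
    open Classical in 0 ≤ ∑ L' ∈ M.elements, if IsStabilized Ω L L' then faceForm p h L L' v v else 0 := by
  refine Finset.sum_nonneg fun L' _ => ?_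
  split_ifs
  · exact faceForm_self_nonneg hh _ _ _
  · exact le_rfl

lemma elementEnergy_le_localEnergy (p : ℕ) (Ω : Set (Vec d)) (M : Mesh d) {h : ℝ} (hh : 0 < h)
    (v : Vec d → Vec d) (L : Set (Vec d)) : elementEnergy Ω v L ≤ localEnergy p Ω M h v L :=
  le_add_of_nonneg_right (mul_nonneg (by positivity) (sum_faceForm_nonneg p Ω M hh v L))

lemma localEnergy_nonneg (p : ℕ) (Ω : Set (Vec d)) (M : Mesh d) {h : ℝ} (hh : 0 < h)
    (v : Vec d → Vec d) (L : Set (Vec d)) : 0 ≤ localEnergy p Ω M h v L :=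
  (elementEnergy_nonneg Ω v L).trans (elementEnergy_le_localEnergy p Ω M hh v L)

lemma faceForm_le_localEnergy {M : Mesh d} {h : ℝ} (hh : 0 < h) (v : Vec d → Vec d)
    {L L' : Set (Vec d)} (hL' : L' ∈ M.elements) (hst : IsStabilized Ω L L') :
    (h ^ 2)⁻¹ * faceForm p h L L' v v ≤ localEnergy p Ω M h v L := by
  classical
  refine le_trans ?_ (le_add_of_nonneg_left (elementEnergy_nonneg Ω v L))
  gcongr
  have := Finset.single_le_sum (s := M.elements)
    (f := fun L' => if IsStabilized Ω L L' then faceForm p h L L' v v else 0) (fun L' _ => by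
      split_ifs
      · exact faceForm_self_nonneg hh _ _ _
      · exact le_rfl) hL'
  simpa only [if_pos hst] using this

/-- The strain on an element with a large part in the domain. -/
lemma exists_strainSq_le_elementEnergy (p : ℕ) (hΩ : IsOpen Ω) (R : ℝ) {c : ℝ} (hc : 0 < c) :
    ∃ C : ℝ, 0 < C ∧ ∀ h : ℝ, 0 < h → ∀ (M : Mesh d), Ω ⊆ M.domain →
      ∀ (v : Vec d → Vec d) (P : Set (Vec d) → Vec d → Vec d), IsPiecewise p Ω M v P →
      ∀ L ∈ M.elements, ∀ y, L ⊆ Metric.closedBall y (R * h) →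
      ENNReal.ofReal (c * h ^ d) ≤ volume (interior L ∩ Ω) → ∀ x ∈ Metric.closedBall y (R * h),
      strainSq (P L) x ≤ C * (h ^ d)⁻¹ * elementEnergy Ω v L := by
  obtain ⟨C, hC, H⟩ := exists_strainSq_le_integral d p R hc
  refine ⟨C, hC, fun h hh M hcov v P hP L hL y hLy hvol x hx => ?_⟩
  have hm : MeasurableSet (interior L ∩ Ω) := (isOpen_interior.inter hΩ).measurableSet
  have heq : elementEnergy Ω v L = ∫ z in interior L ∩ Ω, strainSq (P L) z := by
    refine setIntegral_congr_ae hm ?_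
    have := (ae_restrict_iff' hΩ.measurableSet).mp (hP.ae_gradIn_eq hΩ hcov)
    filter_upwards [this] with z hz hzm
    rw [hz hzm.2 L hL hzm.1, strainSq]
  rw [heq]
  exact H h hh y _ (hP.poly L) _ hm
    ((Set.inter_subset_left.trans interior_subset).trans hLy) hvol x hx

/-- The strain of neighbouring elements which share a stabilized face. -/
lemma exists_strainSq_le_neighbour (hd : 0 < d) (p : ℕ) (hρ : 0 < ρ) {R : ℝ} (hR : 1 ≤ R) :
    ∃ C : ℝ, 0 < C ∧ ∀ h : ℝ, 0 < h → ∀ (M : Mesh d), M.IsQuasiUniform ρ h →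
      ∀ (v : Vec d → Vec d) (P : Set (Vec d) → Vec d → Vec d), IsPiecewise p Ω M v P →
      ∀ L ∈ M.elements, ∀ L' ∈ M.elements, IsStabilized Ω L L' →
      ∀ y, L ⊆ Metric.closedBall y (R * h) → ∀ x ∈ Metric.closedBall y (R * h),
      strainSq (P L) x ≤ 2 * strainSq (P L') x +
        C * (h ^ 2)⁻¹ * (h ^ d)⁻¹ * faceForm p h L L' v v := by
  obtain ⟨C, hC, H⟩ := exists_strainSq_le_face hd p hρ hR
  refine ⟨2 * C, by positivity, fun h hh M hM v P hP L hL L' hL' hst y hLy x hx => ?_⟩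
  refine (strainSq_le_two_mul_add (hP.poly L) (hP.poly L') x).trans ?_
  rw [mul_assoc 2 C, mul_assoc 2, mul_assoc 2]
  gcongr
  obtain ⟨hLa, hLa', ⟨hne, hdim⟩, -⟩ := id hst
  set F := L ∩ L' with hF
  obtain ⟨hn, hno⟩ : ‖faceNormal F‖ = 1 ∧ faceNormal F ∈ (vectorSpan ℝ F)ᗮ := by
    have h1 := exists_norm_eq_one_mem_orthogonal (M.finrank_vectorSpan_inter_lt hd hL hL' hne)
    rw [faceNormal, dif_pos h1]
    exact h1.choose_spec
  obtain ⟨x₀, hx₀, hball⟩ := hM.2 L hL L' hL' ⟨hne, hdim⟩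
  have hFc : IsCompact F := (M.isCompact hL).inter (M.isCompact hL')
  -- By continuity of `v` the difference of the two polynomials vanishes on the face, and its normal
  -- derivatives there are exactly the jumps.
  have key := H h hh F (faceNormal F) x₀ y hFc (M.surface_inter_lt_top hd hL hL' hne) hn
    (hLy hx₀.1) (fun z hz hzn => hball ⟨by rwa [Metric.mem_closedBall, dist_eq_norm],
      mem_affineSpan_of_inner_eq_zero hn hno hdim hx₀ hzn⟩) (P L - P L')
    ((hP.poly L).sub (hP.poly L')) (fun z hz => by
      rw [Pi.sub_apply, ← hP.eqOn L hL hLa hz.1, ← hP.eqOn L' hL' hLa' hz.2, sub_self]) x hx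
  refine key.trans (le_of_eq ?_)
  rw [faceForm]
  congr 1
  refine Finset.sum_congr rfl fun l _ => ?_
  congr 1
  refine integral_congr_ae ?_
  refine ae_restrict_of_forall_mem hFc.measurableSet fun z hz => ?_
  simp only [iterate_dirDeriv_sub (hP.poly L) (hP.poly L'), hP.normalJump_eq hL hLa hL' hLa' l hz,
    Pi.sub_apply]
  rfl

/-- An element is connected; if it misses `∂Ω` it is covered by `Ω` and its exterior, and being
active it lies in `Ω`. -/
lemma Mesh.subset_of_disjoint_frontier {M : Mesh d} {L : Set (Vec d)} (hΩ : IsOpen Ω)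
    (hL : L ∈ M.elements) (hLa : IsActive Ω L) (hf : ¬(L ∩ frontier Ω).Nonempty) : L ⊆ Ω := by
  intro a ha
  by_contra haΩ
  have key : ∀ y ∈ L, y ∉ Ω → y ∈ (closure Ω)ᶜ := fun y hy hyΩ hyc =>
    hf ⟨y, hy, by rw [hΩ.frontier_eq]; exact ⟨hyc, hyΩ⟩⟩
  obtain ⟨y, -, hyΩ, hyc⟩ := (M.convex hL).isPreconnected Ω (closure Ω)ᶜ hΩ
    isClosed_closure.isOpen_compl (fun y hy => by
      by_cases hyΩ : y ∈ Ω
      · exact Or.inl hyΩ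
      · exact Or.inr (key y hy hyΩ)) hLa ⟨a, ha, key a ha haΩ⟩
  exact hyc (subset_closure hyΩ)

lemma volume_closedBall_eq (y : Vec d) {s : ℝ} (hs : 0 ≤ s) : volume (Metric.closedBall y s) =
    ENNReal.ofReal (s ^ d * volume.real (Metric.ball (0 : Vec d) 1)) := by
  rw [Measure.addHaar_closedBall _ _ hs, finrank_euclideanSpace_fin,
    ENNReal.ofReal_mul (by positivity), measureReal_def, ENNReal.ofReal_toReal measure_ball_lt_top.ne]

/-- The strain on a cut element is controlled by the stabilized energy of the elements close to it. -/
lemma exists_strainSq_cut_le (hd : 0 < d) (p : ℕ) (hΩ : IsOpen Ω) (hU : UniformCone Ω r κ)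
    (hρ : 0 < ρ) (hh₀ : 0 < h₀) :
    ∃ C : ℝ, 0 < C ∧ ∀ h : ℝ, 0 < h → h ≤ h₀ → ∀ (M : Mesh d), M.IsQuasiUniform ρ h →
      Ω ⊆ M.domain → ∀ (v : Vec d → Vec d) (P : Set (Vec d) → Vec d → Vec d),
      IsPiecewise p Ω M v P → ∀ K ∈ M.elements, IsActive Ω K → (K ∩ frontier Ω).Nonempty →
      ∀ x ∈ K, strainSq (P K) x ≤
        C * (h ^ d)⁻¹ * ∑ L ∈ M.near (2 * h) K, localEnergy p Ω M h v L := by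
  have : Nonempty (Fin d) := ⟨⟨0, hd⟩⟩
  obtain ⟨c, hc, Hcone⟩ := hU.exists_convex_subset hΩ hh₀
  obtain ⟨N, hN, Hcard⟩ := exists_card_meeting_le hd hρ (zero_le_two (α := ℝ))
  set V := volume.real (Metric.ball (0 : Vec d) 1) with hV
  have hV0 : 0 < V := ENNReal.toReal_pos (Metric.measure_ball_pos _ _ one_pos).ne'
    measure_ball_lt_top.ne
  have hN' : (0 : ℝ) < N := by exact_mod_cast hN
  -- The volume fraction that makes an element good. The first value is attained by elements inside
  -- `Ω`, through their inscribed ball; the second by at least one element meeting `U`, by the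
  -- pigeonhole argument below.
  set cg := min (ρ ^ d * V) (c ^ d * V / (2 * N)) with hcg
  have hcg0 : 0 < cg := lt_min (by positivity) (by positivity)
  set R := 2 + ρ⁻¹ with hR
  have hR1 : 1 ≤ R := by
    have : 0 < ρ⁻¹ := by positivity
    linarith
  obtain ⟨C₁, hC₁, H₁⟩ := exists_strainSq_le_elementEnergy p hΩ R hcg0
  obtain ⟨C₂, hC₂, H₂⟩ := exists_strainSq_le_neighbour (Ω := Ω) hd p hρ hR1
  refine ⟨3 ^ N * (C₁ + C₂), by positivity, fun h hh hhh₀ M hM hcov v P hP K hK hKa hKf => ?_⟩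
  obtain ⟨y, z, U, hyK, hyU, hUo, hUc, hUΩ, hUb, hzU⟩ := Hcone h hh hhh₀ K (M.convex hK) hKa hKf
  have hmeet : M.meeting U ⊆ M.meeting (Metric.closedBall y (2 * h)) := fun L hL => by
    rw [Mesh.mem_meeting] at hL ⊢
    exact ⟨hL.1, hL.2.mono (Set.inter_subset_inter_right _ hUb)⟩
  have hsub : ∀ L ∈ M.meeting U, L ⊆ Metric.closedBall y (R * h) := fun L hL =>
    hM.subset_closedBall (Mesh.mem_meeting.mp (hmeet hL)).1 (Mesh.mem_meeting.mp (hmeet hL)).2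
  have hact : ∀ L ∈ M.meeting U, IsActive Ω L := fun L hL =>
    (Mesh.mem_meeting.mp hL).2.mono (Set.inter_subset_inter_right _ hUΩ)
  have hnear : ∀ L ∈ M.meeting U, L ∈ M.near (2 * h) K := by
    intro L hL
    obtain ⟨hLm, b, hbL, hbU⟩ := Mesh.mem_meeting.mp hL
    classical
    rw [Mesh.near, Finset.mem_filter]
    refine ⟨hLm, y, hyK, b, hbL, ?_⟩
    rw [dist_comm]
    exact hUb hbU
  set Q := ∑ L ∈ M.near (2 * h) K, localEnergy p Ω M h v L with hQ
  have hloc : ∀ L ∈ M.meeting U, localEnergy p Ω M h v L ≤ Q := fun L hL =>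
    Finset.single_le_sum (f := fun L => localEnergy p Ω M h v L)
      (fun L _ => localEnergy_nonneg p Ω M hh v L) (hnear L hL)
  have hQ0 : 0 ≤ Q := Finset.sum_nonneg fun L _ => localEnergy_nonneg p Ω M hh v L
  set T := (C₁ + C₂) * (h ^ d)⁻¹ * Q with hT
  have hT0 : 0 ≤ T := by positivity
  have hgood : ∀ L ∈ M.meeting U, ENNReal.ofReal (cg * h ^ d) ≤ volume (interior L ∩ Ω) →
      ∀ x ∈ Metric.closedBall y (R * h), strainSq (P L) x ≤ T := by
    intro L hL hvol x hx
    refine (H₁ h hh M hcov v P hP L (Mesh.mem_meeting.mp hL).1 y (hsub L hL) hvol x hx).trans ?_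
    have h1 := (elementEnergy_le_localEnergy p Ω M hh v L).trans (hloc L hL)
    have h2 := elementEnergy_nonneg Ω v L
    rw [hT]
    gcongr
    linarith
  have hinner : ∀ L ∈ M.meeting U, ¬(L ∩ frontier Ω).Nonempty →
      ENNReal.ofReal (cg * h ^ d) ≤ volume (interior L ∩ Ω) := by
    intro L hL hf
    have hLm := (Mesh.mem_meeting.mp hL).1
    have hLΩ := M.subset_of_disjoint_frontier hΩ hLm (hact L hL) hf
    rw [Set.inter_eq_left.mpr (interior_subset.trans hLΩ)]
    obtain ⟨x₀, hx₀⟩ := (hM.1 L hLm).2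
    calc ENNReal.ofReal (cg * h ^ d) ≤ ENNReal.ofReal ((ρ * h) ^ d * V) := by
          refine ENNReal.ofReal_le_ofReal ?_
          rw [mul_pow, mul_right_comm]
          gcongr
          exact min_le_left _ _
      _ = volume (Metric.ball x₀ (ρ * h)) := by
          rw [← volume_closedBall_eq x₀ (by positivity), Measure.addHaar_closedBall_eq_addHaar_ball]
      _ ≤ volume (interior L) := measure_mono (interior_maximal
          (Metric.ball_subset_closedBall.trans hx₀) Metric.isOpen_ball)
  -- At most `N` elements meet `U`. If none were good, they would cover at most half the volume of
  -- the ball of radius `c h` contained in `U`.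
  obtain ⟨L₀, hL₀, hL₀v⟩ : ∃ L ∈ M.meeting U,
      ENNReal.ofReal (cg * h ^ d) ≤ volume (interior L ∩ Ω) := by
    by_contra! hcon
    have h1 : volume U ≤ volume (⋃ L ∈ M.meeting U, interior L ∩ Ω) := by
      refine measure_mono_ae ?_
      filter_upwards [ae_exists_mem_interior hcov] with x hx hxU
      obtain ⟨L, hL, hxL⟩ := hx (hUΩ hxU)
      exact Set.mem_biUnion (Mesh.mem_meeting.mpr ⟨hL, x, interior_subset hxL, hxU⟩)
        ⟨hxL, hUΩ hxU⟩
    have h2 : volume (⋃ L ∈ M.meeting U, interior L ∩ Ω) ≤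
        ENNReal.ofReal (c ^ d * V / 2 * h ^ d) := by
      refine (measure_biUnion_finset_le _ _).trans ?_
      refine (Finset.sum_le_sum fun L hL => (hcon L hL).le).trans ?_
      rw [Finset.sum_const, nsmul_eq_mul, ← ENNReal.ofReal_natCast,
        ← ENNReal.ofReal_mul (by positivity), ← mul_assoc]
      refine ENNReal.ofReal_le_ofReal ?_
      gcongr
      have h3 : ((M.meeting U).card : ℝ) ≤ N := by
        exact_mod_cast (Finset.card_le_card hmeet).trans (Hcard h hh M hM y)
      calc ((M.meeting U).card : ℝ) * cg ≤ N * (c ^ d * V / (2 * N)) := by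
            gcongr
            exact min_le_right _ _
        _ = c ^ d * V / 2 := by field_simp
    have h3 : ENNReal.ofReal ((c * h) ^ d * V) ≤ volume U := by
      rw [← volume_closedBall_eq z (by positivity), Measure.addHaar_closedBall_eq_addHaar_ball]
      exact measure_mono hzU
    have h4 := (ENNReal.ofReal_le_ofReal_iff (by positivity)).mp ((h3.trans h1).trans h2)
    rw [mul_pow] at h4
    have : 0 < c ^ d * V * h ^ d := by positivity
    nlinarith
  have hKm : K ∈ M.meeting U := Mesh.mem_meeting.mpr ⟨hK, y, hyK, hyU⟩
  obtain ⟨k, hk, Hchain⟩ := M.exists_chain hd hUo hUc (hUΩ.trans hcov) hKm hL₀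
  have hkN : k ≤ N := hk.le.trans ((Finset.card_le_card hmeet).trans (Hcard h hh M hM y))
  -- The bound is propagated on the whole ball `B(y, R h)`, where the polynomials of successive
  -- elements can be compared at the same point. A link gives at most `2 * 3 ^ j * T + T`, hence `3
  -- ^ (j + 1) * T`.
  have hfin := Hchain (fun j L => ∀ x ∈ Metric.closedBall y (R * h), strainSq (P L) x ≤ 3 ^ j * T)
    (fun x hx => by simpa using hgood L₀ hL₀ hL₀v x hx) (fun j K' hK' L' hL' hnb hj x hx => by
      -- A cut element makes the shared face a stabilized one; an uncut element lies in `Ω` and is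
      -- good by itself, whatever happened earlier in the chain.
      by_cases hf : (K' ∩ frontier Ω).Nonempty
      · have hst : IsStabilized Ω K' L' := ⟨hact K' hK', hact L' hL', hnb, Or.inl hf⟩
        have hL'm := (Mesh.mem_meeting.mp hL').1
        have h1 := H₂ h hh M hM v P hP K' (Mesh.mem_meeting.mp hK').1 L' hL'm hst y (hsub K' hK') x hx
        have h2 := (faceForm_le_localEnergy (p := p) hh v hL'm hst).trans (hloc K' hK')
        have h3 : C₂ * (h ^ 2)⁻¹ * (h ^ d)⁻¹ * faceForm p h K' L' v v ≤ T := by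
          calc C₂ * (h ^ 2)⁻¹ * (h ^ d)⁻¹ * faceForm p h K' L' v v
              = C₂ * (h ^ d)⁻¹ * ((h ^ 2)⁻¹ * faceForm p h K' L' v v) := by ring
            _ ≤ C₂ * (h ^ d)⁻¹ * Q := by gcongr
            _ ≤ T := by
                rw [hT]
                gcongr
                linarith
        have h4 := hj x hx
        have h5 : T ≤ 3 ^ j * T := le_mul_of_one_le_left hT0 (one_le_pow₀ (by norm_num))
        rw [pow_succ]
        linarith
      · refine (hgood K' hK' (hinner K' hK' hf) x hx).trans ?_
        exact le_mul_of_one_le_left hT0 (one_le_pow₀ (by norm_num)))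
  intro x hx
  refine (hfin x (hsub K hKm hx)).trans ?_
  calc (3 : ℝ) ^ k * T ≤ 3 ^ N * T := by
        gcongr
        norm_num
    _ = _ := by rw [hT]; ring

/-! ### Summation over the mesh -/

/-- Exchange the order of summation: each element is close to at most `N` others. -/
lemma exists_sum_near_le (hd : 0 < d) (hρ : 0 < ρ) : ∃ N : ℕ, 0 < N ∧ ∀ h : ℝ, 0 < h →
    ∀ M : Mesh d, M.IsQuasiUniform ρ h → ∀ E : Set (Vec d) → ℝ, (∀ L, 0 ≤ E L) →
      ∑ K ∈ M.elements, ∑ L ∈ M.near (2 * h) K, E L ≤ N * ∑ L ∈ M.elements, E L := by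
  classical
  obtain ⟨N, hN, H⟩ := exists_card_meeting_le hd hρ (by positivity : 0 ≤ 2 + ρ⁻¹)
  refine ⟨N, hN, fun h hh M hM E hE => ?_⟩
  simp only [Mesh.near, Finset.sum_filter]
  rw [Finset.sum_comm, Finset.mul_sum]
  refine Finset.sum_le_sum fun L hL => ?_
  rw [← Finset.sum_filter, Finset.sum_const, nsmul_eq_mul]
  refine mul_le_mul_of_nonneg_right ?_ (hE L)
  obtain ⟨y, hy⟩ := M.nondegenerate L hL
  have hsub : (M.elements.filter fun K => ∃ a ∈ K, ∃ b ∈ L, dist a b ≤ 2 * h) ⊆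
      M.meeting (Metric.closedBall y ((2 + ρ⁻¹) * h)) := by
    intro K hK
    obtain ⟨hKm, a, haK, b, hbL, hab⟩ := Finset.mem_filter.mp hK
    refine Mesh.mem_meeting.mpr ⟨hKm, a, haK, ?_⟩
    have h1 := Metric.dist_le_diam_of_mem (M.isCompact hL).isBounded hbL (interior_subset hy)
    have h2 := (hM.1 L hL).1
    rw [Metric.mem_closedBall]
    linarith [dist_triangle a b y]
  exact_mod_cast (Finset.card_le_card hsub).trans (H h hh M hM y)

/-- The sum over ordered pairs is twice `j_h`, whose factor `1 / 2` removes the double count; the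
element interiors are disjoint parts of the domain. -/
lemma sum_localEnergy_le {M : Mesh d} {h : ℝ} {v : Vec d → Vec d} (hΩ : IsOpen Ω)
    (hv : v ∈ contSpace p Ω ΓD M) : ∑ L ∈ M.elements, localEnergy p Ω M h v L ≤
      (∫ x in Ω, frob (strain (gradIn Ω v x)) (strain (gradIn Ω v x))) +
        2 * ((h ^ 2)⁻¹ * jForm p Ω M h v v) := by
  have hint : IntegrableOn (fun x => frob (strain (gradIn Ω v x)) (strain (gradIn Ω v x))) Ω := by
    have := (memLp_sqrt_frob (memLp_strain (memLp_gradIn hv))).integrable_sq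
    simp only [Real.sq_sqrt (frob_self_nonneg _)] at this
    exact this
  simp only [localEnergy]
  rw [Finset.sum_add_distrib, ← Finset.mul_sum, jForm_eq]
  refine add_le_add ?_ (le_of_eq (by ring))
  simp only [elementEnergy]
  rw [← integral_biUnion_finset (s := fun L => interior L ∩ Ω)]
  · refine setIntegral_mono_set hint (Eventually.of_forall fun _ => frob_self_nonneg _) ?_
    exact (Set.iUnion₂_subset fun _ _ => Set.inter_subset_right).eventuallyLE
  · exact fun L _ => (isOpen_interior.inter hΩ).measurableSet
  · intro K hK L hL hne
    exact (M.disjoint_interior hK hL hne).mono Set.inter_subset_left Set.inter_subset_left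
  · exact fun L _ => hint.mono_set Set.inter_subset_right

lemma frob_stress_le (mu lam : ℝ) (G : Fin d → Vec d) :
    frob (stress mu lam G) (stress mu lam G) ≤
      (2 * (2 * mu) ^ 2 + 2 * lam ^ 2 * d ^ 2) * frob (strain G) (strain G) := by
  set ε := strain G with hε
  have htr : ε.trace ^ 2 ≤ d * frob ε ε := by
    have h1 := sq_sum_le_card_mul_sum_sq (s := (Finset.univ : Finset (Fin d))) (f := fun i => ε i i)
    rw [Finset.card_univ, Fintype.card_fin] at h1
    refine h1.trans ?_
    gcongr
    refine Finset.sum_le_sum fun i _ => ?_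
    rw [sq]
    exact Finset.single_le_sum (f := fun j => ε i j * ε i j) (fun j _ => mul_self_nonneg _)
      (Finset.mem_univ i)
  have hone : frob (1 : Matrix (Fin d) (Fin d) ℝ) 1 = d := by
    simp [frob, Matrix.one_apply]
  have hle : frob (stress mu lam G) (stress mu lam G) ≤
      2 * (2 * mu) ^ 2 * frob ε ε + 2 * (lam * ε.trace) ^ 2 * frob (1 : Matrix (Fin d) (Fin d) ℝ) 1 := by
    simp only [frob, Finset.mul_sum, ← Finset.sum_add_distrib]
    refine Finset.sum_le_sum fun i _ => Finset.sum_le_sum fun j _ => ?_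
    simp only [stress, Matrix.add_apply, Matrix.smul_apply, smul_eq_mul, ← hε]
    nlinarith [sq_nonneg (2 * mu * ε i j - lam * ε.trace * (1 : Matrix (Fin d) (Fin d) ℝ) i j)]
  rw [hone] at hle
  refine hle.trans ?_
  have : 2 * (lam * ε.trace) ^ 2 * d ≤ 2 * lam ^ 2 * d ^ 2 * frob ε ε := by
    calc 2 * (lam * ε.trace) ^ 2 * d = 2 * lam ^ 2 * d * ε.trace ^ 2 := by ring
      _ ≤ 2 * lam ^ 2 * d * (d * frob ε ε) := by gcongr
      _ = _ := by ring
  linarith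

/-- The inverse estimate for the stress on the boundary. -/
theorem exists_stress_boundary_le (hd : 0 < d) (p : ℕ) {mu : ℝ} (hmu : 0 < mu) (lam : ℝ)
    (hΩ : IsOpen Ω) (hb : Bornology.IsBounded Ω) (hU : UniformCone Ω r κ) (hΓ : ΓD ⊆ frontier Ω)
    (hΓm : MeasurableSet ΓD) (hρ : 0 < ρ) (hh₀ : 0 < h₀) :
    ∃ C : ℝ, 0 < C ∧ ∀ h : ℝ, 0 < h → h ≤ h₀ → ∀ (M : Mesh d), M.IsQuasiUniform ρ h →
      Ω ⊆ M.domain → ∀ v ∈ feSpace p Ω M,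
      h * ∫ x, frob (stress mu lam (gradTrace Ω v x)) (stress mu lam (gradTrace Ω v x))
        ∂(surfaceMeasure ΓD) ≤
      C * ((∫ x in Ω, frob (strain (gradIn Ω v x)) (strain (gradIn Ω v x))) +
        (h ^ 2)⁻¹ * jForm p Ω M h v v) := by
  classical
  obtain ⟨C₁, hC₁, H₁⟩ := exists_strainSq_cut_le hd p hΩ hU hρ hh₀
  obtain ⟨C₂, hC₂, H₂⟩ := hU.surface_le hΩ hb
  obtain ⟨N, hN, H₃⟩ := exists_sum_near_le hd hρ
  have hN' : (0 : ℝ) < N := by exact_mod_cast hN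
  have hd' : (0 : ℝ) < d := by exact_mod_cast hd
  set S := 2 * (2 * mu) ^ 2 + 2 * lam ^ 2 * d ^ 2 with hS
  have hS0 : 0 < S := by positivity
  set t := 2 * ρ⁻¹ with ht
  have ht0 : 0 < t := by positivity
  refine ⟨2 * N * (S * C₁ * C₂ * t ^ (d - 1)), by positivity,
    fun h hh hhh₀ M hM hcov v hv => ?_⟩
  obtain ⟨P, hP⟩ := exists_isPiecewise hv
  have hvc := feSpace_subset_contSpace (ΓD := ΓD) hd hΩ hb hU hΓ hΓm hcov hv
  set E := localEnergy p Ω M h v with hE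
  have hE0 : ∀ L, 0 ≤ E L := localEnergy_nonneg p Ω M hh v
  set b : Set (Vec d) → ℝ := fun K => S * (C₁ * (h ^ d)⁻¹ * ∑ L ∈ M.near (2 * h) K, E L) with hbdef
  have hb0 : ∀ K, 0 ≤ b K := fun K =>
    mul_nonneg hS0.le (mul_nonneg (by positivity) (Finset.sum_nonneg fun L _ => hE0 L))
  have hfin : IsFiniteMeasure (surfaceMeasure (frontier Ω)) :=
    surfaceMeasure_univ_lt_top (hU.surface_frontier_lt_top hΩ hb) subset_rfl
  have hfinD : IsFiniteMeasure (surfaceMeasure ΓD) :=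
    surfaceMeasure_univ_lt_top (hU.surface_frontier_lt_top hΩ hb) hΓ
  have hmK : ∀ K ∈ M.elements, MeasurableSet K := fun K hK => (M.isClosed hK).measurableSet
  have hind : ∀ K ∈ M.elements, Integrable (K.indicator fun _ => b K) (surfaceMeasure ΓD) :=
    fun K hK => (integrable_const _).indicator (hmK K hK)
  -- At almost every point the trace of the gradient is that of one active element containing it.
  -- This element meets `∂Ω`, so the estimate on cut elements applies.
  have hpt : ∀ᵐ x ∂(surfaceMeasure ΓD),
      frob (stress mu lam (gradTrace Ω v x)) (stress mu lam (gradTrace Ω v x)) ≤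
      ∑ K ∈ M.elements, K.indicator (fun _ => b K) x := by
    filter_upwards [ae_surfaceMeasure_mono hΓ (hP.ae_gradTrace_eq hd hΩ hcov hU),
      ae_restrict_mem hΓm] with x ⟨K, hK, hKa, hxK, hx⟩ hxΓ
    have hg : gradTrace Ω v x = fun j => dirDeriv (EuclideanSpace.single j 1) (P K) x :=
      funext fun j => (hx j).trace_eq
    have h1 := H₁ h hh hhh₀ M hM hcov v P hP K hK hKa ⟨x, hxK, hΓ hxΓ⟩ x hxK
    have h2 : frob (stress mu lam (gradTrace Ω v x)) (stress mu lam (gradTrace Ω v x)) ≤ b K := by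
      refine (frob_stress_le mu lam _).trans ?_
      rw [hg, hbdef]
      exact mul_le_mul_of_nonneg_left h1 hS0.le
    refine h2.trans ?_
    have h3 := Finset.single_le_sum (s := M.elements) (f := fun K => K.indicator (fun _ => b K) x)
      (fun K _ => Set.indicator_nonneg (fun _ _ => hb0 K) x) hK
    simpa only [Set.indicator_of_mem hxK] using h3
  have hmeas : ∀ K ∈ M.elements, (surfaceMeasure ΓD).real K ≤ C₂ * (t * h) ^ (d - 1) := by
    intro K hK
    rw [measureReal_def, surfaceMeasure, Measure.restrict_apply (hmK K hK)]
    refine ENNReal.toReal_le_of_le_ofReal (by positivity) ?_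
    rcases (K ∩ ΓD).eq_empty_or_nonempty with hemp | ⟨x, hxK, hxΓ⟩
    · simp [hemp]
    · refine le_trans (measure_mono fun z hz => ?_) (H₂ x (hΓ hxΓ) (t * h) (by positivity))
      refine ⟨hΓ hz.2, ?_⟩
      have h1 := Metric.dist_le_diam_of_mem (M.isCompact hK).isBounded hz.1 hxK
      have h2 := (hM.1 K hK).1
      have h3 : 0 < ρ⁻¹ * h := by positivity
      rw [Metric.mem_ball, ht]
      linarith
  -- The powers of `h` balance: the weight, the pointwise bound `h ^ (-d)` and the surface measure
  -- `h ^ (d - 1)` of a cut piece.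
  have hhd : h * ((h ^ d)⁻¹ * h ^ (d - 1)) = 1 := by
    obtain ⟨m, rfl⟩ := Nat.exists_eq_succ_of_ne_zero hd.ne'
    rw [Nat.succ_sub_one, pow_succ]
    field_simp
  have hA0 : 0 ≤ ∫ x in Ω, frob (strain (gradIn Ω v x)) (strain (gradIn Ω v x)) :=
    integral_nonneg fun _ => frob_self_nonneg _
  calc h * ∫ x, frob (stress mu lam (gradTrace Ω v x)) (stress mu lam (gradTrace Ω v x))
        ∂(surfaceMeasure ΓD)
      ≤ h * ∫ x, ∑ K ∈ M.elements, K.indicator (fun _ => b K) x ∂(surfaceMeasure ΓD) := by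
        refine mul_le_mul_of_nonneg_left ?_ hh.le
        exact integral_mono_of_nonneg (Eventually.of_forall fun _ => frob_self_nonneg _)
          (integrable_finsetSum _ hind) hpt
    _ = h * ∑ K ∈ M.elements, (surfaceMeasure ΓD).real K * b K := by
        rw [integral_finsetSum _ hind]
        congr 1
        refine Finset.sum_congr rfl fun K hK => ?_
        rw [integral_indicator (hmK K hK), setIntegral_const, smul_eq_mul]
    _ ≤ h * ∑ K ∈ M.elements, C₂ * (t * h) ^ (d - 1) * b K := by
        gcongr with K hK
        · exact hb0 K
        · exact hmeas K hK
    _ = h * ((h ^ d)⁻¹ * h ^ (d - 1)) * (S * C₁ * C₂ * t ^ (d - 1)) *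
          ∑ K ∈ M.elements, ∑ L ∈ M.near (2 * h) K, E L := by
        rw [← Finset.mul_sum, hbdef, ← Finset.mul_sum, ← Finset.mul_sum, mul_pow]
        ring
    _ ≤ 1 * (S * C₁ * C₂ * t ^ (d - 1)) * (N * ∑ L ∈ M.elements, E L) := by
        rw [hhd]
        gcongr
        exact H₃ h hh M hM E hE0
    _ ≤ 1 * (S * C₁ * C₂ * t ^ (d - 1)) * (N * (2 *
          ((∫ x in Ω, frob (strain (gradIn Ω v x)) (strain (gradIn Ω v x))) +
            (h ^ 2)⁻¹ * jForm p Ω M h v v))) := by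
        gcongr
        refine (sum_localEnergy_le hΩ hvc).trans ?_
        linarith
    _ = _ := by ring

end CutElements

/-! ### Coercivity -/

section Coercivity

variable {d p : ℕ} {Ω ΓD : Set (Vec d)} {ρ h₀ r κ : ℝ} {mu lam γ : ℝ}

/-- Young's inequality with weight `δ`, distributing `h` and `h⁻¹` as in the energy norm. -/
lemma two_mul_tractionForm_le {M : Mesh d} {h δ : ℝ} {v : Vec d → Vec d} (hh : 0 < h) (hδ : 0 < δ)
    (hv : v ∈ contSpace p Ω ΓD M) :
    2 * tractionForm mu lam Ω ΓD v v ≤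
      δ * (h * ∫ x, frob (stress mu lam (gradTrace Ω v x)) (stress mu lam (gradTrace Ω v x))
        ∂(surfaceMeasure ΓD)) +
      δ⁻¹ * (h⁻¹ * ∫ x, ⟪trace Ω v x, trace Ω v x⟫ ∂(surfaceMeasure ΓD)) := by
  have h1 := (le_abs_self _).trans (abs_tractionForm_le (mu := mu) (lam := lam) hv hv)
  have ha : 0 ≤ ∫ x, frob (stress mu lam (gradTrace Ω v x)) (stress mu lam (gradTrace Ω v x))
      ∂(surfaceMeasure ΓD) := integral_nonneg fun _ => frob_self_nonneg _
  have hb : 0 ≤ ∫ x, ⟪trace Ω v x, trace Ω v x⟫ ∂(surfaceMeasure ΓD) := integral_inner_self_nonneg _ _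
  set a := ∫ x, frob (stress mu lam (gradTrace Ω v x)) (stress mu lam (gradTrace Ω v x))
      ∂(surfaceMeasure ΓD)
  set b := ∫ x, ⟪trace Ω v x, trace Ω v x⟫ ∂(surfaceMeasure ΓD)
  have h2 : √a * √b = √(δ * (h * a)) * √(δ⁻¹ * (h⁻¹ * b)) := by
    rw [← Real.sqrt_mul ha, ← Real.sqrt_mul (by positivity)]
    congr 1
    field_simp
  have h3 := two_mul_le_add_sq (√(δ * (h * a))) (√(δ⁻¹ * (h⁻¹ * b)))
  rw [Real.sq_sqrt (by positivity), Real.sq_sqrt (by positivity)] at h3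
  linarith

/-- With `a = a_h(v, v)` and `B = h⁻¹ b_h(v, v)`, the inverse estimate reads `h ‖σ(v)‖² ≤ D a`.
Young's inequality with `δ = 1 / (2 D)` bounds the two consistency terms by `a / 2 + (D / mu) B`, so
`β ≥ D / mu + 1` leaves `A_h(v, v) ≥ a / 2 + B`. The squared norm is at most `(1 + D) a + B`, whence
the constant `2 (1 + D)`. -/
theorem exists_energySq_le (hd : 0 < d) (p : ℕ) (hmu : 0 < mu) (hlam : 0 ≤ lam) (hγ : 0 < γ)
    (hΩ : IsOpen Ω) (hb : Bornology.IsBounded Ω) (hU : UniformCone Ω r κ) (hΓ : ΓD ⊆ frontier Ω)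
    (hΓm : MeasurableSet ΓD) (hρ : 0 < ρ) (hh₀ : 0 < h₀) :
    ∃ β₀ : ℝ, 0 < β₀ ∧ ∃ C : ℝ, 0 < C ∧ ∀ β : ℝ, β₀ ≤ β → ∀ h : ℝ, 0 < h → h ≤ h₀ →
      ∀ M : Mesh d, M.IsQuasiUniform ρ h → Ω ⊆ M.domain → ∀ v ∈ feSpace p Ω M,
      energySq mu lam γ p Ω ΓD M h v ≤ C * nitscheForm mu lam γ β p Ω ΓD M h v v := by
  obtain ⟨C₁, hC₁, H⟩ := exists_stress_boundary_le hd p hmu lam hΩ hb hU hΓ hΓm hρ hh₀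
  set D := C₁ * ((2 * mu)⁻¹ + γ⁻¹) with hD
  have hD0 : 0 < D := by positivity
  refine ⟨D / mu + 1, by positivity, 2 * (1 + D), by positivity,
    fun β hβ h hh hhh₀ M hM hcov v hv => ?_⟩
  have hvc := feSpace_subset_contSpace (ΓD := ΓD) hd hΩ hb hU hΓ hΓm hcov hv
  have h1 := H h hh hhh₀ M hM hcov v hv
  obtain ⟨t1, t2, t3, t4, t5, t6⟩ :=
    energySq_terms (p := p) (Ω := Ω) (ΓD := ΓD) (M := M) hmu hlam hγ hh v
  have h2 := two_mul_tractionForm_le (mu := mu) (lam := lam) hh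
    (by positivity : 0 < 1 / (2 * D)) hvc
  rw [energySq, nitscheForm, bForm, ahForm, aForm]
  set e := ∫ x in Ω, frob (strain (gradIn Ω v x)) (strain (gradIn Ω v x))
  set q := ∫ x in Ω, (strain (gradIn Ω v x)).trace * (strain (gradIn Ω v x)).trace
  set j := jForm p Ω M h v v
  set s := ∫ x, frob (stress mu lam (gradTrace Ω v x)) (stress mu lam (gradTrace Ω v x))
    ∂(surfaceMeasure ΓD)
  set τ := ∫ x, ⟪trace Ω v x, trace Ω v x⟫ ∂(surfaceMeasure ΓD)
  set ν := ∫ x, ⟪trace Ω v x, exteriorNormal Ω x⟫ * ⟪trace Ω v x, exteriorNormal Ω x⟫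
    ∂(surfaceMeasure ΓD)
  set a := 2 * mu * e + lam * q + γ * (h ^ 2)⁻¹ * j with ha
  set B := h⁻¹ * (2 * mu * τ + lam * ν) with hB
  have ha0 : 0 ≤ a := by linarith
  have hB1 : h⁻¹ * τ ≤ (2 * mu)⁻¹ * B := by
    have : h⁻¹ * τ = (2 * mu)⁻¹ * (h⁻¹ * (2 * mu * τ)) := by field_simp
    rw [this, hB, mul_add]
    gcongr
    linarith
  have hB0 : 0 ≤ B := by
    rw [hB, mul_add]
    linarith
  have he : e ≤ (2 * mu)⁻¹ * a := by
    have : e = (2 * mu)⁻¹ * (2 * mu * e) := by field_simp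
    rw [this]
    gcongr
    linarith
  have hj : (h ^ 2)⁻¹ * j ≤ γ⁻¹ * a := by
    have : (h ^ 2)⁻¹ * j = γ⁻¹ * (γ * (h ^ 2)⁻¹ * j) := by field_simp
    rw [this]
    gcongr
    linarith
  have hs : h * s ≤ D * a := by
    refine h1.trans ?_
    rw [hD, mul_assoc, add_mul]
    gcongr
  have h3 : 1 / (2 * D) * (h * s) ≤ a / 2 := by
    calc 1 / (2 * D) * (h * s) ≤ 1 / (2 * D) * (D * a) := by gcongr
      _ = a / 2 := by field_simp
  have h4 : (1 / (2 * D))⁻¹ * (h⁻¹ * τ) ≤ D / mu * B := by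
    calc (1 / (2 * D))⁻¹ * (h⁻¹ * τ) ≤ (1 / (2 * D))⁻¹ * ((2 * mu)⁻¹ * B) := by gcongr
      _ = D / mu * B := by field_simp
  have h5 : (D / mu + 1) * B ≤ β * B := by gcongr
  have h6 : β * h⁻¹ * (2 * mu * τ + lam * ν) = β * B := by rw [hB]; ring
  rw [h6]
  have h7 : a / 2 + B ≤ a - tractionForm mu lam Ω ΓD v v - tractionForm mu lam Ω ΓD v v + β * B := by
    linarith
  calc a + h * s + B ≤ 2 * (1 + D) * (a / 2 + B) := by nlinarith
    _ ≤ _ := by gcongr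

end Coercivity

end CutFEM

end

/-! ### Continuity and coercivity of the stabilized Nitsche form -/

theorem mainTheorem4 (d : ℕ) (hd : d = 2 ∨ d = 3) (p : ℕ) (hp : 1 ≤ p)
    (Ω : Set (CutFEM.Vec d)) (hΩ_open : IsOpen Ω) (hΩ_conn : IsConnected Ω)
    (hΩ_bdd : Bornology.IsBounded Ω) (hΩ_lip : CutFEM.HasLipschitzBoundary Ω)
    (ΓD : Set (CutFEM.Vec d)) (hΓD : ΓD ⊆ frontier Ω) (hΓD_meas : MeasurableSet ΓD)
    (mu lam γ : ℝ) (hmu : 0 < mu) (hlam : 0 ≤ lam) (hγ : 0 < γ)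
    (ρ : ℝ) (hρ : 0 < ρ) (h₀ : ℝ) (hh₀ : 0 < h₀) :
    (∀ β : ℝ, 0 < β → ∃ C : ℝ, 0 < C ∧
      ∀ h : ℝ, 0 < h → h ≤ h₀ →
      ∀ M : CutFEM.Mesh d, M.IsQuasiUniform ρ h → Ω ⊆ M.domain →
      ∀ v ∈ CutFEM.contSpace p Ω ΓD M + CutFEM.feSpace p Ω M,
      ∀ w ∈ CutFEM.contSpace p Ω ΓD M + CutFEM.feSpace p Ω M,
        |CutFEM.nitscheForm mu lam γ β p Ω ΓD M h v w| ≤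
          C * CutFEM.energyNorm mu lam γ p Ω ΓD M h v *
            CutFEM.energyNorm mu lam γ p Ω ΓD M h w) ∧
    (∃ β₀ : ℝ, 0 < β₀ ∧ ∃ C : ℝ, 0 < C ∧
      ∀ β : ℝ, β₀ ≤ β →
      ∀ h : ℝ, 0 < h → h ≤ h₀ →
      ∀ M : CutFEM.Mesh d, M.IsQuasiUniform ρ h → Ω ⊆ M.domain →
      ∀ v ∈ CutFEM.feSpace p Ω M,
        CutFEM.energyNorm mu lam γ p Ω ΓD M h v ^ 2 ≤
          C * CutFEM.nitscheForm mu lam γ β p Ω ΓD M h v v) := by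
  have hd0 : 0 < d := by omega
  obtain ⟨r, κ, hU⟩ := hΩ_lip.exists_uniformCone hΩ_bdd
  constructor
  · intro β hβ
    refine ⟨3 + 2 * (√(2 * mu))⁻¹ + 2 * β, by positivity, fun h hh _ M _ hcov v hv w hw => ?_⟩
    -- `V_h` is contained in `V` and `V` is closed under addition, so the sum of the two spaces is
    -- no larger than `V`.
    have hmem : ∀ u ∈ CutFEM.contSpace p Ω ΓD M + CutFEM.feSpace p Ω M,
        u ∈ CutFEM.contSpace p Ω ΓD M := by
      intro u hu
      obtain ⟨u₁, hu₁, u₂, hu₂, rfl⟩ := Set.mem_add.mp hu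
      exact CutFEM.add_mem_contSpace hΩ_open hu₁
        (CutFEM.feSpace_subset_contSpace hd0 hΩ_open hΩ_bdd hU hΓD hΓD_meas hcov hu₂)
    exact CutFEM.abs_nitscheForm_le hmu hlam hγ hβ hh (hmem v hv) (hmem w hw)
  · obtain ⟨β₀, hβ₀, C, hC, H⟩ := CutFEM.exists_energySq_le hd0 p hmu hlam hγ hΩ_open hΩ_bdd hU hΓD
      hΓD_meas hρ hh₀
    refine ⟨β₀, hβ₀, C, hC, fun β hβ h hh hhh₀ M hM hcov v hv => ?_⟩
    have hsq : CutFEM.energyNorm mu lam γ p Ω ΓD M h v ^ 2 =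
        CutFEM.energySq mu lam γ p Ω ΓD M h v :=
      Real.sq_sqrt (CutFEM.energySq_nonneg hmu hlam hγ hh v)
    rw [hsq]
    exact H β hβ h hh hhh₀ M hM hcov v hv
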